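/- Let $1\le i\le n$ and $m\ge 0$ be integers, let $\mathfrak{sl}_{n+1}(\mathbb C)=\mathfrak n^-\oplus\mathfrak h\oplus\mathfrak n^+$ be the standard triangular decomposition, $\mathfrak b=\mathfrak h\oplus\mathfrak n^+$, let $\mathbb U$ be the group of unipotent upper triangular matrices (with Lie algebra $\mathfrak n^+$), and let $\varepsilon_1,\dots,\varepsilon_{n+1}$ be the coordinate functions on diagonal matrices, $\alpha_{k,j}=\varepsilon_k-\varepsilon_{j+1}$ $(1\le k\le j\le n)$ the positive roots and $\omega_i=\varepsilon_1+\dots+\varepsilon_i$. Let $V(m\omega_i)$ be the simple finite-dimensional module of highest weight $m\omega_i$, let $w\in W=S_{n+1}$, let $v$ be a generator of the (one-dimensional) weight space of weight $w(m\omega_i)$, and let $V_w(m\omega_i)=U(\mathfrak b).v$ be the Demazure module. **Polytope.** Let $u$ be the representative of minimal length of the coset $w\,\mathrm{Stab}_W(\omega_i)$. For $1\le k\le i$ put $$\ell_k=\max\big(\{i-1\}\cup\{j : i\le j\le n,\ u(j+1)<u(k)\}\big),$$ let $\mathcal P$ be the poset of all $x_{k,j}$ with $1\le k\le i\le j\le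 \ell_k$, ordered by $x_{k_1,j_1}\ge x_{k_2,j_2}$ iff $k_1\le k_2$ and $j_1\ge j_2$, and let $\mathcal C_{\underline\ell_w}\subset\mathbb R^{\mathcal P}$ be its chain polytope: all $s\ge 0$ with $\sum_{x\in c}s_x\le 1$ for every chain $c$ of $\mathcal P$. Via $x_{k,j}\mapsto -u(\alpha_{k,j})=\varepsilon_{u(j+1)}-\varepsilon_{u(k)}$, which is a positive root, and extension by zero, regard $\mathcal C_{\underline\ell_w}$ as a polytope in $\mathbb R^{R^+}$, where $R^+$ is the set of positive roots. **Order.** On $\mathcal P$ let $x_{k_2,j_2}\prec x_{k_1,j_1}$ iff $j_1-k_1>j_2-k_2$, or $j_1-k_1=j_2-k_2$ and $k_2<k_1$. Fix any total order on $R^+$ that extends the order $\prec$ transported to $R^+$ by $x_{k,j}\mapsto -u(\alpha_{k,j})$. Order the basis $(e_\beta)_{\beta\in R^+}$ of root vectors (elementary matrices) of $\mathfrak n^+$ accordingly, and put on $\mathbb Z_{\ge0}^{R^+}$ the induced homogeneous lexicographic order: first compare total degrees, then, in equal degree, compare the exponents at the largest root at which they differ. For $\mathbf p\in\mathbb Z_{\ge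 0}^{R^+}$ let $e^{\mathbf p}\in U(\mathfrak n^+)$ be the ordered monomial. **Favourable modules.** Let $M=U(\mathfrak n^+).v$ be a cyclic finite-dimensional $\mathbb U$-module. An exponent $\mathbf p$ is *essential* if $\langle e^{\mathbf q}.v : \mathbf q\preceq\mathbf p\rangle\ne\langle e^{\mathbf q}.v : \mathbf q\prec\mathbf p\rangle$. $M$ is *favourable via* a polytope $P\subset\mathbb R^{R^+}$ if $P$ is a normal lattice polytope (for all $k\ge1$, each lattice point of $kP$ is a sum of $k$ lattice points of $P$), the set of essential exponents equals $P\cap\mathbb Z^{R^+}$, and for all $k\ge 1$ $$\dim U(\mathfrak n^+).v^{\otimes k}=|kP\cap\mathbb Z^{R^+}|,\qquad U(\mathfrak n^+).v^{\otimes k}\subset M^{\otimes k}.$$ **Statement.** $V_w(m\omega_i)$, with the cyclic vector $v$, is a favourable $\mathbb U$-module via the polytope $m\,\mathcal C_{\underline\ell_w}$. In particular its essential exponents are exactly the lattice points of $m\,\mathcal C_{\underline\ell_w}$. Moreover, for all $k\ge1$ the vectors $e^{\mathbf p}.v^{\otimes k}$, $\mathbf p\in k\,m\,\mathcal C_{\underline\ell_w}\cap\mathbb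 Z^{R^+}$, form a basis of the Cartan component $U(\mathfrak n^+).v^{\otimes k}$ of $V_w(m\omega_i)^{\otimes k}$. -/

import Mathlib

open scoped TensorProduct Pointwise

namespace PBWDemazure

noncomputable section

attribute [local instance 100] LieRing.ofAssociativeRing

/-! ### Representations, universal enveloping algebras and tensor powers -/

section Representations

variable {L : Type*} [LieRing L] [LieAlgebra ℂ L]
variable {M : Type*} [AddCommGroup M] [Module ℂ M]

/-- The action of the universal enveloping algebra `U(L)` on a representation `ρ` of `L`. -/
def envAction (ρ : L →ₗ⁅ℂ⁆ Module.End ℂ M) :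
    UniversalEnvelopingAlgebra ℂ L →ₐ[ℂ] Module.End ℂ M :=
  UniversalEnvelopingAlgebra.lift ℂ ρ

/-- The subspace `U(L).v`. -/
def cyclicSpan (ρ : L →ₗ⁅ℂ⁆ Module.End ℂ M) (v : M) : Submodule ℂ M :=
  LinearMap.range ((LinearMap.applyₗ v).comp (envAction ρ).toLinearMap)

theorem mem_cyclicSpan (ρ : L →ₗ⁅ℂ⁆ Module.End ℂ M) (v w : M) :
    w ∈ cyclicSpan ρ v ↔ ∃ a, envAction ρ a v = w := by
  simp [cyclicSpan]

theorem self_mem_cyclicSpan (ρ : L →ₗ⁅ℂ⁆ Module.End ℂ M) (v : M) : v ∈ cyclicSpan ρ v :=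
  (mem_cyclicSpan ρ v v).2 ⟨1, by simp⟩

theorem apply_mem_cyclicSpan (ρ : L →ₗ⁅ℂ⁆ Module.End ℂ M) (v w : M) (x : L)
    (hw : w ∈ cyclicSpan ρ v) : ρ x w ∈ cyclicSpan ρ v := by
  obtain ⟨a, rfl⟩ := (mem_cyclicSpan ρ v w).1 hw
  refine (mem_cyclicSpan ρ v _).2 ⟨UniversalEnvelopingAlgebra.ι ℂ x * a, ?_⟩
  simp [envAction]

/-- The operator `1 ⊗ ⋯ ⊗ f ⊗ ⋯ ⊗ 1` on `M^{⊗k}` with `f` in the position `j`. -/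
def slotMap (k : ℕ) (j : Fin k) :
    Module.End ℂ M →ₗ[ℂ] Module.End ℂ (⨂[ℂ] _ : Fin k, M) where
  toFun f := PiTensorProduct.map (Function.update (fun _ => LinearMap.id) j f)
  map_add' _ _ := PiTensorProduct.map_update_add _ _ _ _
  map_smul' _ _ := PiTensorProduct.map_update_smul _ _ _ _

theorem slotMap_eq (k : ℕ) (j : Fin k) (f : Module.End ℂ M) :
    slotMap k j f = PiTensorProduct.mapMonoidHom
      (Pi.mulSingle (M := fun _ : Fin k => Module.End ℂ M) j f) := rfl

theorem slotMap_mul (k : ℕ) (j : Fin k) (f g : Module.End ℂ M) :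
    slotMap k j (f * g) = slotMap k j f * slotMap k j g := by
  rw [slotMap_eq, slotMap_eq, slotMap_eq, ← map_mul, ← Pi.mulSingle_mul]

theorem slotMap_comm (k : ℕ) {j l : Fin k} (h : j ≠ l) (f g : Module.End ℂ M) :
    slotMap k j f * slotMap k l g = slotMap k l g * slotMap k j f := by
  simp only [slotMap_eq, ← map_mul]
  rw [(Pi.mulSingle_commute (f := fun _ : Fin k => Module.End ℂ M) h f g).eq]

/-- The tensor power `M^{⊗k}` of a representation:
`x ↦ ∑ⱼ 1 ⊗ ⋯ ⊗ ρ(x) ⊗ ⋯ ⊗ 1`. -/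
def tensorPowerRep (ρ : L →ₗ⁅ℂ⁆ Module.End ℂ M) (k : ℕ) :
    L →ₗ⁅ℂ⁆ Module.End ℂ (⨂[ℂ] _ : Fin k, M) where
  toLinearMap := ∑ j : Fin k, (slotMap k j).comp (ρ : L →ₗ[ℂ] Module.End ℂ M)
  map_lie' {x y} := by
    have key : ∀ z : L, (∑ j : Fin k, (slotMap k j).comp (ρ : L →ₗ[ℂ] Module.End ℂ M)) z
        = ∑ j : Fin k, slotMap k j (ρ z) := by
      intro z; simp
    simp only [AddHom.toFun_eq_coe, LinearMap.coe_toAddHom, key, LieHom.map_lie,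
      LieRing.of_associative_ring_bracket, map_sub, slotMap_mul, Finset.sum_sub_distrib]
    rw [Finset.sum_mul_sum, Finset.sum_mul_sum]
    rw [Finset.sum_comm (f := fun i j => slotMap k i (ρ y) * slotMap k j (ρ x))]
    rw [← Finset.sum_sub_distrib, ← Finset.sum_sub_distrib]
    refine Finset.sum_congr rfl fun i _ => ?_
    rw [← Finset.sum_sub_distrib, Finset.sum_eq_single i]
    · intro j _ hj
      rw [slotMap_comm k hj.symm, sub_self]
    · simp

/-- The vector `v ⊗ ⋯ ⊗ v` in `M^{⊗k}`. -/
def tensorPowerVec (v : M) (k : ℕ) : ⨂[ℂ] _ : Fin k, M :=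
  PiTensorProduct.tprod ℂ fun _ => v

end Representations

/-! ### Essential monomials -/

section Essential

variable {ι : Type*} [Fintype ι] [LinearOrder ι]

/-- The homogeneous lexicographic order on multi-exponents `ι → ℕ` for a totally ordered set `ι`
of variables: first the total degrees are compared; in equal degree the exponents are compared
at the largest variable at which they differ. -/
def HomLexLT (p q : ι → ℕ) : Prop :=
  ∑ a, p a < ∑ a, q a ∨
    (∑ a, p a = ∑ a, q a ∧ ∃ a, p a < q a ∧ ∀ b, a < b → p b = q b)

variable {L : Type*} [LieRing L] [LieAlgebra ℂ L]
variable {M : Type*} [AddCommGroup M] [Module ℂ M]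

/-- The ordered monomial `∏ₐ xₐ ^ pₐ` in `U(L)`, the factors in increasing order of `a`. -/
def pbwMonomial (x : Module.Basis ι ℂ L) (p : ι → ℕ) : UniversalEnvelopingAlgebra ℂ L :=
  (((Finset.univ : Finset ι).sort (· ≤ ·)).map
    fun a => UniversalEnvelopingAlgebra.ι ℂ (x a) ^ p a).prod

/-- The vector `x^p.v`. -/
def monomialVec (ρ : L →ₗ⁅ℂ⁆ Module.End ℂ M) (x : Module.Basis ι ℂ L) (v : M) (p : ι → ℕ) : M :=
  envAction ρ (pbwMonomial x p) v

/-- `M^{≼ p}`, the span of all `x^q.v` with `q ≼ p`. -/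
def filtLE (ρ : L →ₗ⁅ℂ⁆ Module.End ℂ M) (x : Module.Basis ι ℂ L) (v : M) (p : ι → ℕ) :
    Submodule ℂ M :=
  Submodule.span ℂ (monomialVec ρ x v '' {q | HomLexLT q p ∨ q = p})

/-- `M^{≺ p}`, the span of all `x^q.v` with `q ≺ p`. -/
def filtLT (ρ : L →ₗ⁅ℂ⁆ Module.End ℂ M) (x : Module.Basis ι ℂ L) (v : M) (p : ι → ℕ) :
    Submodule ℂ M :=
  Submodule.span ℂ (monomialVec ρ x v '' {q | HomLexLT q p})

/-- The multi-exponents `p` for which `M^{≼ p} / M^{≺ p}` is non-zero. -/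
def essentialSet (ρ : L →ₗ⁅ℂ⁆ Module.End ℂ M) (x : Module.Basis ι ℂ L) (v : M) :
    Set (ι → ℕ) :=
  {p | filtLT ρ x v p ≠ filtLE ρ x v p}

end Essential

/-! ### Lattice polytopes -/

section Polytopes

variable {ι : Type*}

/-- The lattice points `P ∩ ℤ^ι`. -/
def latticePoints (P : Set (ι → ℝ)) : Set (ι → ℤ) :=
  {p | (fun a => (p a : ℝ)) ∈ P}

/-- The convex hull of finitely many lattice points. -/
def IsLatticePolytope (P : Set (ι → ℝ)) : Prop :=
  ∃ F : Set (ι → ℤ), F.Finite ∧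
    P = convexHull ℝ ((fun (p : ι → ℤ) (a : ι) => (p a : ℝ)) '' F)

/-- A lattice polytope `P` such that for all `k ≥ 1` every lattice point of `kP` is a sum of `k`
lattice points of `P`. -/
structure IsNormalPolytope (P : Set (ι → ℝ)) : Prop where
  isLatticePolytope : IsLatticePolytope P
  decomp : ∀ k : ℕ, 1 ≤ k → ∀ p ∈ latticePoints ((k : ℝ) • P),
    ∃ q : Fin k → ι → ℤ, (∀ j, q j ∈ latticePoints P) ∧ p = ∑ j, q j

end Polytopes

/-! ### Favourable modules -/

section Favourable

variable {ι : Type*} [Fintype ι] [LinearOrder ι]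
variable {L : Type*} [LieRing L] [LieAlgebra ℂ L]
variable {M : Type*} [AddCommGroup M] [Module ℂ M]

/-- The module `M` of the unipotent group with Lie algebra `L` (equivalently: the finite-dimensional
representation `ρ` of `L` by nilpotent operators), with the cyclic vector `v`, is favourable via
the polytope `P`, with respect to the ordered basis `x` of `L` and the induced homogeneous
lexicographic order. -/
structure IsFavourableVia (ρ : L →ₗ⁅ℂ⁆ Module.End ℂ M) (x : Module.Basis ι ℂ L) (v : M)
    (P : Set (ι → ℝ)) : Prop where
  finite : Module.Finite ℂ M
  nilpotent : ∀ y : L, IsNilpotent (ρ y)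
  cyclic : cyclicSpan ρ v = ⊤
  normal : IsNormalPolytope P
  essential : (fun (p : ι → ℕ) (a : ι) => (p a : ℤ)) '' essentialSet ρ x v = latticePoints P
  cartan : ∀ k : ℕ, 1 ≤ k →
    Module.finrank ℂ (cyclicSpan (tensorPowerRep ρ k) (tensorPowerVec v k)) =
      (latticePoints ((k : ℝ) • P)).ncard

/-- The vectors `x^p.v`, for `p` running through the lattice points of `P` with non-negative
coordinates, form a basis of `U(L).v`. -/
def ParametrizesBasis (ρ : L →ₗ⁅ℂ⁆ Module.End ℂ M) (x : Module.Basis ι ℂ L) (v : M)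
    (P : Set (ι → ℝ)) : Prop :=
  LinearIndepOn ℂ (monomialVec ρ x v) {p | (fun a => (p a : ℤ)) ∈ latticePoints P} ∧
    Submodule.span ℂ (monomialVec ρ x v '' {p | (fun a => (p a : ℤ)) ∈ latticePoints P}) =
      cyclicSpan ρ v

end Favourable

/-! ### The Lie algebra `sl_{n+1}(ℂ)` -/

/-- `sl_{n+1}(ℂ)`; rows and columns are numbered `0, …, n`. -/
abbrev slLie (n : ℕ) : LieSubalgebra ℂ (Matrix (Fin (n + 1)) (Fin (n + 1)) ℂ) :=
  LieAlgebra.SpecialLinear.sl (Fin (n + 1)) ℂ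

/-- The upper triangular matrices in `sl_{n+1}`. -/
def borel (n : ℕ) : LieSubalgebra ℂ (slLie n) where
  carrier := {A | ∀ a b : Fin (n + 1), b < a → A.1 a b = 0}
  zero_mem' := by intro a b _; rfl
  add_mem' {A B} hA hB := by
    intro a b h
    simp [hA a b h, hB a b h]
  smul_mem' c A hA := by
    intro a b h
    simp [hA a b h]
  lie_mem' {A B} hA hB := by
    have key : ∀ A B : slLie n, (∀ a b : Fin (n + 1), b < a → A.1 a b = 0) →
        (∀ a b : Fin (n + 1), b < a → B.1 a b = 0) →
        ∀ a b : Fin (n + 1), b < a → (A.1 * B.1) a b = 0 := by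
      intro A B hA hB a b h
      rw [Matrix.mul_apply]
      refine Finset.sum_eq_zero fun c _ => ?_
      rcases lt_or_ge c a with hc | hc
      · rw [hA a c hc, zero_mul]
      · rw [hB c b (lt_of_lt_of_le h hc), mul_zero]
    intro a b h
    rw [LieAlgebra.SpecialLinear.sl_bracket]
    simp only [Matrix.sub_apply]
    rw [key A B hA hB a b h, key B A hB hA a b h, sub_zero]

/-- `𝔫⁺`, the strictly upper triangular matrices. -/
def nilPlus (n : ℕ) : LieSubalgebra ℂ (slLie n) where
  carrier := {A | ∀ a b : Fin (n + 1), b ≤ a → A.1 a b = 0}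
  zero_mem' := by intro a b _; rfl
  add_mem' {A B} hA hB := by
    intro a b h
    simp [hA a b h, hB a b h]
  smul_mem' c A hA := by
    intro a b h
    simp [hA a b h]
  lie_mem' {A B} hA hB := by
    have key : ∀ A B : slLie n, (∀ a b : Fin (n + 1), b ≤ a → A.1 a b = 0) →
        (∀ a b : Fin (n + 1), b ≤ a → B.1 a b = 0) →
        ∀ a b : Fin (n + 1), b ≤ a → (A.1 * B.1) a b = 0 := by
      intro A B hA hB a b h
      rw [Matrix.mul_apply]
      refine Finset.sum_eq_zero fun c _ => ?_
      rcases le_or_gt c a with hc | hc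
      · rw [hA a c hc, zero_mul]
      · rw [hB c b (h.trans hc.le), mul_zero]
    intro a b h
    rw [LieAlgebra.SpecialLinear.sl_bracket]
    simp only [Matrix.sub_apply]
    rw [key A B hA hB a b h, key B A hB hA a b h, sub_zero]

theorem nilPlus_le_borel (n : ℕ) : nilPlus n ≤ borel n :=
  fun _ hA a b h => hA a b h.le

/-- The positive root `ε_fst - ε_snd`, `fst < snd`. With rows and columns numbered `0, …, n`, the
root `α_{k,j} = α_k + ⋯ + α_j` (`1 ≤ k ≤ j ≤ n`) is `fst = k - 1`, `snd = j`. -/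
structure PosRoot (n : ℕ) where
  fst : Fin (n + 1)
  snd : Fin (n + 1)
  fst_lt_snd : fst < snd

namespace PosRoot

theorem toPair_injective (n : ℕ) :
    Function.Injective fun β : PosRoot n => (β.fst, β.snd) := by
  rintro ⟨a, b, h⟩ ⟨c, d, h'⟩ e
  simp only [Prod.mk.injEq] at e
  obtain ⟨rfl, rfl⟩ := e
  rfl

instance (n : ℕ) : Fintype (PosRoot n) := Fintype.ofInjective _ (toPair_injective n)

end PosRoot

/-- The coordinates of a strictly upper triangular matrix. -/
def nilPlusEquiv (n : ℕ) : nilPlus n ≃ₗ[ℂ] (PosRoot n → ℂ) where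
  toFun A β := A.1.1 β.fst β.snd
  map_add' _ _ := rfl
  map_smul' _ _ := rfl
  invFun c := ⟨⟨Matrix.of fun a b => if h : a < b then c ⟨a, b, h⟩ else 0, by
      exact LinearMap.mem_ker.2 (by simp [Matrix.trace])⟩, by
      intro a b h
      simp [not_lt.2 h]⟩
  left_inv A := by
    apply Subtype.ext
    apply Subtype.ext
    ext a b
    by_cases h : a < b
    · simp [h]
    · simp [h, A.2 a b (not_lt.1 h)]
  right_inv c := by
    funext β
    simp [β.fst_lt_snd]

/-- The basis of `𝔫⁺` given by the root vectors `e_β`, that is the elementary matrices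
`E_{fst, snd}`. -/
def rootVectorBasis (n : ℕ) : Module.Basis (PosRoot n) ℂ (nilPlus n) :=
  Module.Basis.ofEquivFun (nilPlusEquiv n)

/-! ### Weights and the Weyl group -/

/-- A weight `∑ₐ λₐ εₐ`. -/
abbrev Weight (n : ℕ) := Fin (n + 1) → ℤ

/-- The fundamental weight `ω_i = ε_1 + ⋯ + ε_i` (in zero-based numbering `ε_0 + ⋯ + ε_{i-1}`). -/
def fundWeight (n i : ℕ) : Weight n := fun a => if a.val < i then 1 else 0

/-- The action of the Weyl group `S_{n+1}` on weights, `w(ε_a) = ε_{w(a)}`. -/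
def weylAct {n : ℕ} (w : Equiv.Perm (Fin (n + 1))) (lam : Weight n) : Weight n :=
  fun a => lam (w⁻¹ a)

/-- The length of a permutation, that is its number of inversions. -/
def permLength {n : ℕ} (w : Equiv.Perm (Fin (n + 1))) : ℕ :=
  ((Finset.univ : Finset (Fin (n + 1) × Fin (n + 1))).filter
    fun p => p.1 < p.2 ∧ w p.2 < w p.1).card

/-- `u` is a representative of minimal length of the coset of `w` modulo the stabilizer
of `ω_i`. -/
def IsMinRep {n : ℕ} (i : ℕ) (w u : Equiv.Perm (Fin (n + 1))) : Prop :=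
  weylAct (w⁻¹ * u) (fundWeight n i) = fundWeight n i ∧
    ∀ s : Equiv.Perm (Fin (n + 1)), weylAct s (fundWeight n i) = fundWeight n i →
      permLength u ≤ permLength (u * s)

section Modules

variable {n : ℕ} {V : Type*} [AddCommGroup V] [Module ℂ V]
  [LieRingModule (slLie n) V] [LieModule ℂ (slLie n) V]

/-- `v` is a non-zero vector of weight `lam` for the subalgebra of diagonal matrices. -/
def IsWeightVector (lam : Weight n) (v : V) : Prop :=
  v ≠ 0 ∧ ∀ h : slLie n, (h : Matrix (Fin (n + 1)) (Fin (n + 1)) ℂ).IsDiag →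
    ⁅h, v⁆ = (∑ a, (lam a : ℂ) * h.1 a a) • v

variable (V) in
/-- `V` is the simple finite-dimensional `sl_{n+1}`-module of highest weight `lam`. -/
structure IsSimpleOfHighestWeight (lam : Weight n) : Prop where
  finite : Module.Finite ℂ V
  irreducible : LieModule.IsIrreducible ℂ (slLie n) V
  exists_highest : ∃ v : V, IsWeightVector lam v ∧
    ∀ x : slLie n, x ∈ nilPlus n → ⁅x, v⁆ = 0

end Modules

/-- `U(𝔟).v` as a `𝔟`-module; for `v` a generator of the extremal weight space of weight `w(lam)`
in `V(lam)` this is the Demazure module `V_w(lam)`. -/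
def demazureModule (n : ℕ) {V : Type*} [AddCommGroup V] [Module ℂ V]
    [LieRingModule (slLie n) V] [LieModule ℂ (slLie n) V] (v : V) : LieSubmodule ℂ (borel n) V where
  toSubmodule := cyclicSpan (LieModule.toEnd ℂ (borel n) V) v
  lie_mem {x w} hw := apply_mem_cyclicSpan (LieModule.toEnd ℂ (borel n) V) v w x hw

/-- The generator of `U(𝔟).v`. -/
def demazureGen (n : ℕ) {V : Type*} [AddCommGroup V] [Module ℂ V]
    [LieRingModule (slLie n) V] [LieModule ℂ (slLie n) V] (v : V) : demazureModule n v :=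
  ⟨v, self_mem_cyclicSpan (LieModule.toEnd ℂ (borel n) V) v⟩

/-- The action of `𝔫⁺ ⊆ 𝔟` on `U(𝔟).v`. -/
def demazureRep (n : ℕ) {V : Type*} [AddCommGroup V] [Module ℂ V]
    [LieRingModule (slLie n) V] [LieModule ℂ (slLie n) V] (v : V) :
    nilPlus n →ₗ⁅ℂ⁆ Module.End ℂ (demazureModule n v) :=
  (LieModule.toEnd ℂ (borel n) (demazureModule n v)).comp
    (LieSubalgebra.inclusion (nilPlus_le_borel n))


/-! ### The posets and the chain polytopes -/

/-- The elements `x_{k,j}`, `1 ≤ k ≤ i`, `i ≤ j ≤ ℓ_k` of the poset `P_ℓ`, with `row = k - 1`,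
`col = j`, and `ell row = ℓ_k`. -/
structure Vertex (n i : ℕ) (ell : Fin (n + 1) → ℕ) where
  row : Fin (n + 1)
  col : Fin (n + 1)
  row_lt : row.val < i
  le_col : i ≤ col.val
  col_le : col.val ≤ ell row

namespace Vertex

variable {n i : ℕ} {ell : Fin (n + 1) → ℕ}

theorem toPair_injective :
    Function.Injective fun x : Vertex n i ell => (OrderDual.toDual x.row, x.col) := by
  rintro ⟨a, b, h1, h2, h3⟩ ⟨c, d, h4, h5, h6⟩ e
  simp only [Prod.mk.injEq, OrderDual.toDual_inj] at e
  obtain ⟨rfl, rfl⟩ := e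
  rfl

instance : Fintype (Vertex n i ell) := Fintype.ofInjective _ toPair_injective

/-- `x_{k₁,j₁} ≥ x_{k₂,j₂}` if and only if `k₁ ≤ k₂` and `j₁ ≥ j₂`. -/
instance : PartialOrder (Vertex n i ell) := PartialOrder.lift _ toPair_injective

theorem le_iff (x y : Vertex n i ell) : x ≤ y ↔ y.row ≤ x.row ∧ x.col ≤ y.col := Iff.rfl

/-- The total order on `P_ℓ`: `x_{k₂,j₂} ≺ x_{k₁,j₁}` if and only if `j₁ - k₁ > j₂ - k₂`, or
`j₁ - k₁ = j₂ - k₂` and `k₂ < k₁`. -/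
def totLT (y x : Vertex n i ell) : Prop :=
  ((y.col : ℕ) : ℤ) - ((y.row : ℕ) : ℤ) < ((x.col : ℕ) : ℤ) - ((x.row : ℕ) : ℤ) ∨
    (((y.col : ℕ) : ℤ) - ((y.row : ℕ) : ℤ) = ((x.col : ℕ) : ℤ) - ((x.row : ℕ) : ℤ) ∧
      y.row < x.row)

end Vertex

/-- The chain polytope of the poset `P_ℓ`. -/
def chainPolytope (n i : ℕ) (ell : Fin (n + 1) → ℕ) : Set (Vertex n i ell → ℝ) :=
  {s | (∀ x, 0 ≤ s x) ∧
    ∀ c : Finset (Vertex n i ell), IsChain (· ≤ ·) (c : Set (Vertex n i ell)) →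
      ∑ x ∈ c, s x ≤ 1}

/-- The sequence `ℓ_w`: for `1 ≤ k ≤ i`, `ℓ_k` is the maximum of `i - 1` and all `j`, `i ≤ j ≤ n`,
with `w(j + 1) < w(k)`, that is with `α_{k,j} ∈ w⁻¹(R⁻) ∩ R⁺`; in zero-based numbering
`w(j + 1) < w(k)` reads `w j < w a` where `a = k - 1`. -/
def ellSeq {n : ℕ} (i : ℕ) (w : Equiv.Perm (Fin (n + 1))) (a : Fin (n + 1)) : ℕ :=
  max (i - 1)
    (((Finset.univ : Finset (Fin (n + 1))).filter fun b => i ≤ b.val ∧ w b < w a).sup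
      fun b => b.val)

/-- `β = -w(α_{k,j})`, where `x = x_{k,j}`: as `-w(ε_a - ε_b) = ε_{w(b)} - ε_{w(a)}`, this is
`fst = w(col)`, `snd = w(row)`. -/
def IsRootOf {n i : ℕ} {ell : Fin (n + 1) → ℕ} (w : Equiv.Perm (Fin (n + 1)))
    (x : Vertex n i ell) (β : PosRoot n) : Prop :=
  β.fst = w x.col ∧ β.snd = w x.row

open Classical in
/-- The map `ℝ^{P_ℓ} → ℝ^{R⁺}` that moves the coordinate at `x_{k,j}` to the coordinate at the
root `-w(α_{k,j})` and puts zero at all other positive roots. -/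
def transport {n i : ℕ} {ell : Fin (n + 1) → ℕ} (w : Equiv.Perm (Fin (n + 1)))
    (s : Vertex n i ell → ℝ) : PosRoot n → ℝ :=
  fun β => ∑ x : Vertex n i ell, if IsRootOf w x β then s x else 0

/-- The chain polytope `C_{ℓ_w}` inside `ℝ^{R⁺}`. -/
def demazurePolytope {n : ℕ} (i : ℕ) (w : Equiv.Perm (Fin (n + 1))) : Set (PosRoot n → ℝ) :=
  transport w '' chainPolytope n i (ellSeq i w)

end

end PBWDemazure

open PBWDemazure

/-! Let `N` be `m`, or `k * m` when the `k`-th tensor power is treated. A minimal representative `u`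
increases on the first `i` indices and on the remaining ones (`IsMinRep.lt_of_lt`). Hence every root
vector whose root does not come from the poset kills `v`, the root vectors that do come from it
commute, and the principal order ideals of the poset are full rectangles.

Spanning. Over a principal ideal, a sum of root vectors with coefficients `s_row * t_col` is a
matrix of rank at most one and square zero, so its `(N+1)`-st power kills `v`. As `s` and `t` are
arbitrary, this power splits into one relation for each choice of row and column sums. Among the
exponents with given margins, one supported on a chain is the largest (`lexLT_of_chain`). A monomial
that violates a chain inequality is therefore a combination of smaller ones
(`expMonomial_mem_of_chain`). Monomials that involve roots outside the poset drop in degree. Thus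
each monomial vector is a combination of not larger ones with exponents in the dilated polytope
(`monomialVec_mem_span`).

Independence. `V(m ω_i)` embeds into the span of products of `m` minors of size `i` in disjoint sets
of variables, and `v` goes to a multiple of the product of the minors with rows `u(1), …, u(i)`. The
embedding is the graph generated by a pair of highest weight vectors; positivity of the Fischer form
shows that the generated submodule of the model has no nonzero submodule missing its generator
(`submodule_eq_bot`). Restricted to an orbit of the commuting root vectors, each minor becomes a
determinant whose smallest exponent is the indicator of a prescribed antichain
(`hasMinExponent_det`). An integral point whose chain sums are at most `N` is a sum of `N`
antichains (`exists_antichain_decomposition`), so it is the smallest exponent of a product of such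
determinants. The resulting functionals are triangular (`linearIndepOn_extremalVec`).

Both halves together give the essential set, the bases and the dimensions. For tensor powers an
equivariant map to the model with `k * m` minors suffices. The antichain decomposition also yields
normality, and its real analogue shows that the polytope is a lattice polytope. -/

namespace PBWDemazure

attribute [local instance 100] LieRing.ofAssociativeRing

/-! ### Antichain decompositions and the vertices of the chain polytope. -/

section ChainDecomposition

variable {X : Type*} [Fintype X] [PartialOrder X]

open Classical in
/-- The maximal elements of the support of a function. -/
noncomputable def maxSupport {R : Type*} [Zero R] (s : X → R) : Finset X :=
  Finset.univ.filter fun x => s x ≠ 0 ∧ ∀ y, s y ≠ 0 → x ≤ y → y = x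

theorem mem_maxSupport {R : Type*} [Zero R] {s : X → R} {x : X} :
    x ∈ maxSupport s ↔ s x ≠ 0 ∧ ∀ y, s y ≠ 0 → x ≤ y → y = x := by
  classical simp [maxSupport]

theorem isAntichain_maxSupport {R : Type*} [Zero R] (s : X → R) :
    IsAntichain (· ≤ ·) (maxSupport s : Set X) := by
  intro x hx y hy hxy hle
  exact hxy ((mem_maxSupport.1 hx).2 y (mem_maxSupport.1 hy).1 hle).symm

theorem exists_le_mem_maxSupport {R : Type*} [Zero R] {s : X → R} {y : X} (hy : s y ≠ 0) :
    ∃ x ∈ maxSupport s, y ≤ x := by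
  classical
  obtain ⟨x, hx, hmax⟩ := (Finset.univ.filter fun x => s x ≠ 0).exists_le_maximal
    (show y ∈ Finset.univ.filter fun x => s x ≠ 0 by simpa using hy)
  refine ⟨x, mem_maxSupport.2 ⟨by simpa using hmax.1, fun z hz hxz => ?_⟩, hx⟩
  exact (le_antisymm hxz (hmax.2 (by simpa using hz) hxz)).symm

-- A chain that meets the maximal support loses at least `ε` there. A chain that misses it has the
-- largest element of its support below some maximal support element `x`; adjoining `x` keeps a
-- chain and brings in `s x ≥ ε`. Either way the bound drops by `ε`, which permits induction.
open Classical in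
theorem chain_sum_peel {R : Type*} [AddCommMonoid R] [LinearOrder R] [IsOrderedCancelAddMonoid R]
    (s f : X → R) (ε t : R) (hε : 0 ≤ ε) (hεt : ε ≤ t) (hf : ∀ x, 0 ≤ f x)
    (hs : ∀ x, s x = f x + if x ∈ maxSupport s then ε else 0)
    (hc : ∀ c : Finset X, IsChain (· ≤ ·) (c : Set X) → ∑ x ∈ c, s x ≤ t)
    (c : Finset X) (hcc : IsChain (· ≤ ·) (c : Set X)) : ∑ x ∈ c, f x + ε ≤ t := by
  by_cases hA : ∃ x ∈ c, x ∈ maxSupport s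
  · obtain ⟨x, hxc, hxA⟩ := hA
    refine le_trans ?_ (hc c hcc)
    rw [Finset.sum_congr rfl fun x _ => hs x, Finset.sum_add_distrib]
    gcongr
    refine le_trans ?_ (Finset.single_le_sum (f := fun x => if x ∈ maxSupport s then ε else 0)
      (fun y _ => ?_) hxc)
    · simp [hxA]
    · split_ifs
      · exact hε
      · exact le_rfl
  · push Not at hA
    have hfs : ∀ x ∈ c, f x = s x := fun x hx => by rw [hs x, if_neg (hA x hx), add_zero]
    rw [Finset.sum_congr rfl hfs, ← Finset.sum_filter_ne_zero]
    set c' := c.filter fun x => s x ≠ 0 with hc'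
    have hsub : (c' : Set X) ⊆ c := Finset.coe_subset.2 (Finset.filter_subset _ _)
    rcases c'.eq_empty_or_nonempty with h0 | hne
    · simpa [h0] using hεt
    · obtain ⟨y, hy, hmax⟩ := c'.exists_maximal hne
      obtain ⟨x, hxA, hyx⟩ := exists_le_mem_maxSupport (s := s) (y := y)
        (by simpa [hc'] using (Finset.mem_filter.1 hy).2)
      have hxc : x ∉ c' := fun h => hA x (hsub h) hxA
      have hch : IsChain (· ≤ ·) ((insert x c' : Finset X) : Set X) := by
        rw [Finset.coe_insert]
        refine (hcc.mono hsub).insert fun z hz _ => Or.inr ?_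
        rcases eq_or_ne z y with rfl | hzy
        · exact hyx
        · rcases hcc (hsub hz) (hsub hy) hzy with h | h
          · exact h.trans hyx
          · exact (hmax hz h).trans hyx
      have h := hc _ hch
      rw [Finset.sum_insert hxc, add_comm] at h
      refine le_trans ?_ h
      gcongr
      rw [hs x, if_pos hxA]
      exact le_add_of_nonneg_left (hf x)

open Classical in
/-- A function with values in `ℕ` whose sums over chains are at most `N` is a sum of `N`
indicators of antichains. -/
theorem exists_antichain_decomposition (N : ℕ) (p : X → ℕ)
    (hp : ∀ c : Finset X, IsChain (· ≤ ·) (c : Set X) → ∑ x ∈ c, p x ≤ N) :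
    ∃ A : Fin N → Finset X, (∀ r, IsAntichain (· ≤ ·) (A r : Set X)) ∧
      ∀ x, p x = ∑ r, if x ∈ A r then 1 else 0 := by
  induction N generalizing p with
  | zero =>
    refine ⟨fun _ => ∅, fun r => r.elim0, fun x => ?_⟩
    simpa using hp {x} (by simp)
  | succ N ih =>
    -- The truncated subtraction is exact, since `p` is nonzero on its maximal support.
    let f : X → ℕ := fun x => p x - if x ∈ maxSupport p then 1 else 0
    have hs : ∀ x, p x = f x + if x ∈ maxSupport p then 1 else 0 := by
      intro x
      by_cases h : x ∈ maxSupport p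
      · have := (mem_maxSupport.1 h).1
        simp only [f, h, if_true]; omega
      · simp [f, h]
    obtain ⟨A, hA, hsum⟩ := ih f fun c hc => by
      have := chain_sum_peel p f 1 (N + 1) (by simp) (by simp) (fun _ => Nat.zero_le _) hs hp c hc
      omega
    refine ⟨Fin.cons (maxSupport p) A, fun r => ?_, fun x => ?_⟩
    · refine Fin.cases ?_ (fun r => ?_) r
      · simpa using isAntichain_maxSupport p
      · simpa using hA r
    · rw [hs x, hsum x, Fin.sum_univ_succ, add_comm]
      simp

open Classical in
/-- The indicator functions of the antichains. -/
def antichainIndicators (X : Type*) [PartialOrder X] : Set (X → ℝ) :=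
  {s | ∃ A : Finset X, IsAntichain (· ≤ ·) (A : Set X) ∧ s = fun x => if x ∈ A then 1 else 0}

-- Greedy peeling: subtract the indicator of the maximal support, weighted by the least value of `s`
-- on it. This shrinks the support and lowers the chain bound by that value, and convexity
-- reassembles the two dilates.
open Classical in
theorem mem_smul_convexHull_antichain (s : X → ℝ) (t : ℝ) (ht : 0 ≤ t) (hs0 : ∀ x, 0 ≤ s x)
    (hs : ∀ c : Finset X, IsChain (· ≤ ·) (c : Set X) → ∑ x ∈ c, s x ≤ t) :
    s ∈ t • convexHull ℝ (antichainIndicators X) := by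
  induction hn : (Finset.univ.filter fun x => s x ≠ 0).card using Nat.strong_induction_on
    generalizing s t with
  | _ k ih =>
  rcases (maxSupport s).eq_empty_or_nonempty with h0 | hne
  · have hz : s = 0 := by
      funext x
      by_contra hx
      obtain ⟨y, hy, _⟩ := exists_le_mem_maxSupport (s := s) (y := x) hx
      simp [h0] at hy
    rw [hz]
    refine ⟨0, subset_convexHull ℝ _ ⟨∅, by simp, ?_⟩, by simp⟩
    funext x; simp
  · obtain ⟨y, hy, hmin⟩ := (maxSupport s).exists_min_image s hne
    have hy0 : 0 < s y := lt_of_le_of_ne (hs0 y) (Ne.symm (mem_maxSupport.1 hy).1)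
    have hyt : s y ≤ t := by simpa using hs {y} (by simp)
    let f : X → ℝ := fun x => s x - if x ∈ maxSupport s then s y else 0
    have hsf : ∀ x, s x = f x + if x ∈ maxSupport s then s y else 0 := by
      intro x; simp [f]
    have hf0 : ∀ x, 0 ≤ f x := by
      intro x
      by_cases h : x ∈ maxSupport s
      · simpa [f, h] using hmin x h
      · simpa [f, h] using hs0 x
    have hlt : (Finset.univ.filter fun x => f x ≠ 0).card < k := by
      rw [← hn]
      refine Finset.card_lt_card ((Finset.ssubset_iff_of_subset ?_).2 ⟨y, ?_, ?_⟩)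
      · intro x hx
        simp only [Finset.mem_filter, Finset.mem_univ, true_and] at hx ⊢
        intro h
        have : x ∉ maxSupport s := fun h' => (mem_maxSupport.1 h').1 h
        simp [f, h, this] at hx
      · simpa using hy0.ne'
      · simp [f, hy]
    have hmem := ih _ hlt f (t - s y) (sub_nonneg.2 hyt) hf0 (fun c hc => by
      have := chain_sum_peel s f (s y) t hy0.le hyt hf0 hsf hs c hc
      linarith) rfl
    have hconv := (convex_convexHull ℝ (antichainIndicators X)).add_smul
      (sub_nonneg.2 hyt) hy0.le
    rw [sub_add_cancel] at hconv
    rw [hconv]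
    refine ⟨f, hmem, s y • fun x => if x ∈ maxSupport s then (1 : ℝ) else 0,
      Set.smul_mem_smul_set (subset_convexHull ℝ _ ⟨_, isAntichain_maxSupport s, rfl⟩), ?_⟩
    funext x
    rw [hsf x]
    change f x + s y * _ = _
    by_cases h : x ∈ maxSupport s <;> simp [h]

end ChainDecomposition

theorem sum_indicator_le_one {X : Type*} [PartialOrder X] [DecidableEq X] {c A : Finset X}
    (hc : IsChain (· ≤ ·) (c : Set X)) (hA : IsAntichain (· ≤ ·) (A : Set X)) :
    ∑ x ∈ c, (if x ∈ A then (1 : ℝ) else 0) ≤ 1 := by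
  rw [Finset.sum_ite_mem, Finset.sum_const, nsmul_eq_mul, mul_one]
  have : (c ∩ A).card ≤ 1 := by
    rw [Finset.card_le_one]
    intro a ha b hb
    rw [Finset.mem_inter] at ha hb
    by_contra hab
    rcases hc ha.1 hb.1 hab with h | h
    · exact hA ha.2 hb.2 hab h
    · exact hA hb.2 ha.2 (Ne.symm hab) h
  exact_mod_cast this

/-- Stanley's description of the chain polytope. The nontrivial inclusion is the greedy peeling with
bound 1; the other holds because a chain meets an antichain at most once. -/
theorem chainPolytope_eq_convexHull (n i : ℕ) (ell : Fin (n + 1) → ℕ) :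
    chainPolytope n i ell = convexHull ℝ (antichainIndicators (Vertex n i ell)) := by
  classical
  apply subset_antisymm
  · intro s hs
    have := mem_smul_convexHull_antichain s 1 zero_le_one hs.1 hs.2
    rwa [one_smul] at this
  · refine convexHull_min ?_ ?_
    · rintro s ⟨A, hA, rfl⟩
      refine ⟨fun x => by dsimp only; split_ifs <;> simp, fun c hc => ?_⟩
      convert! sum_indicator_le_one hc hA
    · intro s hs t ht a b ha hb hab
      refine ⟨fun x => ?_, fun c hc => ?_⟩
      · have h1 := hs.1 x
        have h2 := ht.1 x
        simp only [Pi.add_apply, Pi.smul_apply, smul_eq_mul]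
        positivity
      · simp only [Pi.add_apply, Pi.smul_apply, smul_eq_mul, Finset.sum_add_distrib,
          ← Finset.mul_sum]
        have h1 := mul_le_mul_of_nonneg_left (hs.2 c hc) ha
        have h2 := mul_le_mul_of_nonneg_left (ht.2 c hc) hb
        linarith

/-! ### Lexicographic extremality of chains and antichains among exponents with fixed margins. -/

section LexOrder

variable {n i : ℕ} {ell : Fin (n + 1) → ℕ}

theorem Vertex.ext_row_col {x y : Vertex n i ell} (hr : x.row = y.row) (hc : x.col = y.col) :
    x = y := by
  cases x; cases y; simp_all

/-- `x_{k,j} ↦ (j - k, k)` embeds the total order `totLT` into a lexicographic product. -/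
def Vertex.lexKey (x : Vertex n i ell) : ℤ ×ₗ ℕ :=
  toLex (((x.col : ℕ) : ℤ) - ((x.row : ℕ) : ℤ), x.row.val)

theorem Vertex.totLT_iff (x y : Vertex n i ell) : Vertex.totLT x y ↔ x.lexKey < y.lexKey := by
  rw [Vertex.lexKey, Vertex.lexKey, Prod.Lex.toLex_lt_toLex]
  rfl

theorem Vertex.lexKey_injective : Function.Injective (Vertex.lexKey (n := n) (i := i) (ell := ell)) := by
  intro x y h
  simp only [Vertex.lexKey, EmbeddingLike.apply_eq_iff_eq, Prod.mk.injEq] at h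
  have hr : x.row = y.row := Fin.ext h.2
  refine Vertex.ext_row_col hr (Fin.ext ?_)
  have := h.1
  rw [hr] at this
  omega

theorem Vertex.totLT_trichotomy (x y : Vertex n i ell) :
    Vertex.totLT x y ∨ x = y ∨ Vertex.totLT y x := by
  rw [Vertex.totLT_iff, Vertex.totLT_iff]
  rcases lt_trichotomy x.lexKey y.lexKey with h | h | h
  · exact Or.inl h
  · exact Or.inr (Or.inl (Vertex.lexKey_injective h))
  · exact Or.inr (Or.inr h)

/-- The lexicographic order on exponents: compare at the `totLT`-largest variable at which the
exponents differ. -/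
def LexLT (p q : Vertex n i ell → ℕ) : Prop :=
  ∃ x, p x < q x ∧ ∀ y, Vertex.totLT x y → p y = q y

theorem LexLT.add_right {p q : Vertex n i ell → ℕ} (h : LexLT p q) (r : Vertex n i ell → ℕ) :
    LexLT (p + r) (q + r) := by
  obtain ⟨x, hx, hy⟩ := h
  exact ⟨x, by simpa using hx, fun y h => by simp [hy y h]⟩

theorem LexLT.trans {p q r : Vertex n i ell → ℕ} (h₁ : LexLT p q) (h₂ : LexLT q r) :
    LexLT p r := by
  obtain ⟨x, hx, hxy⟩ := h₁
  obtain ⟨y, hy, hyz⟩ := h₂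
  rcases Vertex.totLT_trichotomy x y with h | rfl | h
  · refine ⟨y, by rw [hxy y h]; exact hy, fun z hz => ?_⟩
    rw [hxy z ?_, hyz z hz]
    rw [Vertex.totLT_iff] at *
    exact h.trans hz
  · exact ⟨x, hx.trans hy, fun z hz => by rw [hxy z hz, hyz z hz]⟩
  · refine ⟨x, by rw [← hyz x h]; exact hx, fun z hz => ?_⟩
    rw [hxy z hz, hyz z ?_]
    rw [Vertex.totLT_iff] at *
    exact h.trans hz

theorem LexLT.irrefl (p : Vertex n i ell → ℕ) : ¬ LexLT p p := by
  rintro ⟨x, hx, -⟩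
  exact lt_irrefl _ hx

theorem LexLT.add {p q p' q' : Vertex n i ell → ℕ} (h : LexLT p q) (h' : LexLT p' q') :
    LexLT (p + p') (q + q') := by
  have h2 := h'.add_right q
  rw [add_comm p', add_comm q'] at h2
  exact (h.add_right p').trans h2

theorem exists_top_ne {p q : Vertex n i ell → ℕ} (h : p ≠ q) :
    ∃ x, p x ≠ q x ∧ ∀ y, Vertex.totLT x y → p y = q y := by
  classical
  obtain ⟨x₀, hx₀⟩ := Function.ne_iff.1 h
  obtain ⟨x, hx, hmax⟩ := (Finset.univ.filter fun x => p x ≠ q x).exists_max_image Vertex.lexKey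
    ⟨x₀, by simpa using hx₀⟩
  refine ⟨x, by simpa using hx, fun y hy => ?_⟩
  by_contra hne
  rw [Vertex.totLT_iff] at hy
  exact absurd (hmax y (by simpa using hne)) (not_le.2 hy)

/-- Two exponents have the same row sums and the same column sums. -/
def SameMargins (p q : Vertex n i ell → ℕ) : Prop :=
  (∀ f : Fin (n + 1) → ℕ, ∑ x, p x * f x.row = ∑ x, q x * f x.row) ∧
    ∀ f : Fin (n + 1) → ℕ, ∑ x, p x * f x.col = ∑ x, q x * f x.col

theorem SameMargins.row_filter {p q : Vertex n i ell → ℕ} (h : SameMargins p q)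
    (P : Fin (n + 1) → Prop) [DecidablePred P] :
    ∑ x with P x.row, p x = ∑ x with P x.row, q x := by
  simpa [Finset.sum_filter] using h.1 fun a => if P a then 1 else 0

theorem SameMargins.col_filter {p q : Vertex n i ell → ℕ} (h : SameMargins p q)
    (P : Fin (n + 1) → Prop) [DecidablePred P] :
    ∑ x with P x.col, p x = ∑ x with P x.col, q x := by
  simpa [Finset.sum_filter] using h.2 fun a => if P a then 1 else 0

/-- Going up strictly in the poset strictly increases `col - row`, so the total order refines the
partial one without recourse to the tie-break. -/
theorem Vertex.totLT_of_le {x y : Vertex n i ell} (hr : y.row ≤ x.row) (hc : x.col ≤ y.col)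
    (hne : x ≠ y) : Vertex.totLT x y := by
  have h : x.row ≠ y.row ∨ x.col ≠ y.col := by
    by_contra hcon
    push Not at hcon
    exact hne (Vertex.ext_row_col hcon.1 hcon.2)
  rw [← Fin.val_ne_iff, ← Fin.val_ne_iff] at h
  rw [Fin.le_def] at hr hc
  left
  omega

/-- An exponent supported on a chain is the largest one with its margins. -/
theorem lexLT_of_chain {p q : Vertex n i ell → ℕ} (h : SameMargins p q)
    (hp : ∀ x y, p x ≠ 0 → p y ≠ 0 → x ≤ y ∨ y ≤ x) (hne : p ≠ q) : LexLT q p := by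
  obtain ⟨x, hx, htop⟩ := exists_top_ne hne
  refine ⟨x, ?_, fun y hy => (htop y hy).symm⟩
  by_contra hlt
  have hlt' : p x < q x := by omega
  -- If `p` has no mass in the row of `x` to the left of `x`, the sums over that row cannot agree.
  -- Otherwise a support element there is incomparable with every vertex in the column of `x` of
  -- larger row index, so `p` vanishes on these and the sums over the column cannot agree.
  by_cases hrow : ∀ y, y.row = x.row → y.col < x.col → p y = 0
  · have := h.row_filter (· = x.row)
    refine absurd this (Finset.sum_lt_sum (fun y hy => ?_) ⟨x, by simp, hlt'⟩).ne
    have hr : y.row = x.row := by simpa using hy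
    rcases lt_or_ge y.col x.col with hc | hc
    · rw [hrow y hr hc]; exact Nat.zero_le _
    · rcases eq_or_ne x y with rfl | hxy
      · exact hlt'.le
      · exact (htop y (Vertex.totLT_of_le hr.le hc hxy)).le
  · push Not at hrow
    obtain ⟨z, hzr, hzc, hz⟩ := hrow
    have := h.col_filter (· = x.col)
    refine absurd this (Finset.sum_lt_sum (fun y hy => ?_) ⟨x, by simp, hlt'⟩).ne
    have hc : y.col = x.col := by simpa using hy
    rcases lt_or_ge x.row y.row with hr | hr
    · have : p y = 0 := by
        by_contra hy0
        rcases hp y z hy0 hz with h | h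
        · rw [Vertex.le_iff] at h
          exact absurd (hc ▸ h.2) (not_le.2 hzc)
        · rw [Vertex.le_iff] at h
          exact absurd (hzr ▸ h.1) (not_le.2 hr)
      rw [this]; exact Nat.zero_le _
    · rcases eq_or_ne x y with rfl | hxy
      · exact hlt'.le
      · exact (htop y (Vertex.totLT_of_le hr hc.ge hxy)).le

/-- An exponent supported on an antichain is the smallest one with its margins. -/
theorem lexLT_of_antichain {p q : Vertex n i ell → ℕ} (h : SameMargins p q)
    (hp : ∀ x y, p x ≠ 0 → p y ≠ 0 → x ≤ y → x = y) (hne : p ≠ q) : LexLT p q := by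
  obtain ⟨x, hx, htop⟩ := exists_top_ne hne
  refine ⟨x, ?_, htop⟩
  by_contra hlt
  have hlt' : q x < p x := by omega
  have hr := h.row_filter (· ≤ x.row)
  have hc := h.col_filter (· < x.col)
  -- This quadrant consists of the vertices above `x`, where `p` and `q` differ only at `x`. The
  -- rest of the rows up to `x.row` cannot compensate: an antichain through `x` has all its mass in
  -- columns before `x.col` already in those rows.
  have key : ∑ y with y.row ≤ x.row ∧ ¬ y.col < x.col, q y
      < ∑ y with y.row ≤ x.row ∧ ¬ y.col < x.col, p y := by
    refine Finset.sum_lt_sum (fun y hy => ?_) ⟨x, by simp, hlt'⟩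
    simp only [Finset.mem_filter, Finset.mem_univ, true_and, not_lt] at hy
    rcases eq_or_ne x y with rfl | hxy
    · exact hlt'.le
    · exact (htop y (Vertex.totLT_of_le hy.1 hy.2 hxy)).ge
  have hsplit : ∀ f : Vertex n i ell → ℕ, ∑ y with y.row ≤ x.row, f y =
      ∑ y with y.row ≤ x.row ∧ y.col < x.col, f y +
        ∑ y with y.row ≤ x.row ∧ ¬ y.col < x.col, f y := by
    intro f
    rw [← Finset.sum_filter_add_sum_filter_not _ (fun y => y.col < x.col), Finset.filter_filter,
      Finset.filter_filter]
  rw [hsplit, hsplit] at hr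
  have h1 : ∑ y with y.row ≤ x.row ∧ y.col < x.col, q y ≤ ∑ y with y.col < x.col, q y :=
    Finset.sum_le_sum_of_subset fun y hy => by
      simp only [Finset.mem_filter, Finset.mem_univ, true_and] at hy ⊢
      exact hy.2
  have h2 : ∑ y with y.row ≤ x.row ∧ y.col < x.col, p y = ∑ y with y.col < x.col, p y := by
    refine Finset.sum_subset (fun y hy => ?_) fun y hy hy' => ?_
    · simp only [Finset.mem_filter, Finset.mem_univ, true_and] at hy ⊢
      exact hy.2
    · simp only [Finset.mem_filter, Finset.mem_univ, true_and] at hy hy'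
      by_contra hy0
      have := hp y x hy0 (by omega) (by
        rw [Vertex.le_iff]
        refine ⟨?_, hy.le⟩
        by_contra hcon
        exact hy' ⟨(not_le.1 hcon).le, hy⟩)
      rw [this] at hy
      exact lt_irrefl _ hy
  omega

end LexOrder

/-! ### Straightening relations in the polynomial ring. -/

section Straightening

open MvPolynomial

/-- A functional that kills `J` but not a given coefficient would turn `F` into a nonzero complex
polynomial vanishing at every point. This converts a family of relations with free parameters into
one relation per monomial in the parameters. -/
theorem coeff_mem_of_eval_mem {τ R : Type*} [CommRing R] [Algebra ℂ R] (J : Submodule ℂ R)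
    (F : MvPolynomial τ R) (h : ∀ c : τ → ℂ, eval (fun t => algebraMap ℂ R (c t)) F ∈ J)
    (ν : τ →₀ ℕ) : coeff ν F ∈ J := by
  classical
  by_contra hν
  obtain ⟨f, hf, hJ⟩ := Submodule.exists_dual_map_eq_bot_of_notMem hν inferInstance
  let G : MvPolynomial τ ℂ := ∑ μ ∈ F.support, monomial μ (f (coeff μ F))
  have hcoeff : ∀ μ, coeff μ G = f (coeff μ F) := by
    intro μ
    simp only [G, coeff_sum, coeff_monomial, Finset.sum_ite_eq', mem_support_iff]
    split_ifs with h
    · rfl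
    · rw [not_not.1 h, map_zero]
  have hG : G = 0 := by
    refine MvPolynomial.funext fun c => ?_
    have h0 : f (eval (fun t => algebraMap ℂ R (c t)) F) = 0 := by
      have := Submodule.mem_map_of_mem (f := f) (h c)
      rwa [hJ, Submodule.mem_bot] at this
    rw [eval_eq] at h0
    rw [map_zero, ← h0, map_sum, map_sum]
    refine Finset.sum_congr rfl fun μ _ => ?_
    rw [eval_monomial, Finsupp.prod]
    simp only [← map_pow, ← map_prod]
    rw [mul_comm (coeff μ F), ← Algebra.smul_def, map_smul, smul_eq_mul, mul_comm]
  exact hf (by rw [← hcoeff, hG, coeff_zero])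

/-- The monomial with exponent `q`. -/
noncomputable def expMonomial {σ : Type*} [Fintype σ] (q : σ → ℕ) : MvPolynomial σ ℂ :=
  ∏ x, X x ^ q x

theorem expMonomial_add {σ : Type*} [Fintype σ] (q r : σ → ℕ) :
    expMonomial (q + r) = expMonomial q * expMonomial r := by
  simp [expMonomial, pow_add, Finset.prod_mul_distrib]

variable {n i : ℕ} {ell : Fin (n + 1) → ℕ}

/-- The exponents of the row and column variables attached to an exponent. -/
noncomputable def margins (q : Vertex n i ell → ℕ) : Fin (n + 1) ⊕ Fin (n + 1) →₀ ℕ :=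
  ∑ x, q x • (Finsupp.single (Sum.inl x.row) 1 + Finsupp.single (Sum.inr x.col) 1)

theorem sameMargins_of_margins_eq {p q : Vertex n i ell → ℕ} (h : margins p = margins q) :
    SameMargins p q := by
  classical
  have key : ∀ (p : Vertex n i ell → ℕ) (f : Fin (n + 1) ⊕ Fin (n + 1) → ℕ),
      (margins p).linearCombination ℕ f =
      ∑ x, p x * (f (Sum.inl x.row) + f (Sum.inr x.col)) := by
    intro p f
    simp [margins, mul_add]
  constructor
  · intro f
    have := congrArg (fun m => Finsupp.linearCombination ℕ (Sum.elim f fun _ => 0) m) h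
    simpa [key] using this
  · intro f
    have := congrArg (fun m => Finsupp.linearCombination ℕ (Sum.elim (fun _ => 0) f) m) h
    simpa [key] using this

/-- The multinomial theorem with generic row and column weights: the weights record exactly the
margins of each exponent. -/
theorem coeff_margins_pow [DecidableEq (Vertex n i ell)] (S : Finset (Vertex n i ell)) (d : ℕ) (ν : Fin (n + 1) ⊕ Fin (n + 1) →₀ ℕ) :
    coeff ν ((∑ x ∈ S, C (X x) * (X (Sum.inl x.row) * X (Sum.inr x.col)) :
      MvPolynomial (Fin (n + 1) ⊕ Fin (n + 1)) (MvPolynomial (Vertex n i ell) ℂ)) ^ d) =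
    ∑ q ∈ S.piAntidiag d with margins q = ν, (Nat.multinomial S q : ℂ) • expMonomial q := by
  classical
  rw [Finset.sum_pow_eq_sum_piAntidiag, coeff_sum, Finset.sum_filter]
  refine Finset.sum_congr rfl fun q hq => ?_
  have hq0 : ∀ x, x ∉ S → q x = 0 := fun x hx => by
    by_contra h
    exact hx ((Finset.mem_piAntidiag.1 hq).2 x h)
  have hX : ∀ x : Vertex n i ell, (X (Sum.inl x.row) * X (Sum.inr x.col) :
      MvPolynomial (Fin (n + 1) ⊕ Fin (n + 1)) (MvPolynomial (Vertex n i ell) ℂ)) =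
      monomial (Finsupp.single (Sum.inl x.row) 1 + Finsupp.single (Sum.inr x.col) 1) 1 := by
    intro x
    simp [X, monomial_mul]
  have h1 : ∏ x ∈ S, (C (X x) * (X (Sum.inl x.row) * X (Sum.inr x.col)) :
      MvPolynomial (Fin (n + 1) ⊕ Fin (n + 1)) (MvPolynomial (Vertex n i ell) ℂ)) ^ q x =
      monomial (margins q) (expMonomial q) := by
    rw [Finset.prod_subset (Finset.subset_univ S) fun x _ hx => by rw [hq0 x hx, pow_zero]]
    simp only [mul_pow, Finset.prod_mul_distrib, hX, monomial_pow, one_pow]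
    rw [show ∏ x : Vertex n i ell, (monomial (q x • (Finsupp.single (Sum.inl x.row) 1 +
        Finsupp.single (Sum.inr x.col) 1)) 1 :
        MvPolynomial (Fin (n + 1) ⊕ Fin (n + 1)) (MvPolynomial (Vertex n i ell) ℂ)) =
        monomial (margins q) 1 by rw [margins, monomial_sum_one]]
    rw [← mul_one (expMonomial q), ← C_mul_monomial, expMonomial, map_prod]
    simp
  rw [h1, ← C_eq_coe_nat, coeff_C_mul, coeff_monomial]
  split_ifs
  · rw [← nsmul_eq_mul, Nat.cast_smul_eq_nsmul]
  · rw [mul_zero]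

/-- A monomial that violates a chain inequality is, modulo `J`, a combination of
smaller monomials. -/
theorem expMonomial_mem_of_chain (J : Ideal (MvPolynomial (Vertex n i ell) ℂ)) (N : ℕ)
    (hJ : ∀ (top : Vertex n i ell) (s t : Fin (n + 1) → ℂ), ∀ S : Finset (Vertex n i ell),
      (∀ x, x ∈ S ↔ x ≤ top) → (∑ x ∈ S, C (s x.row * t x.col) * X x) ^ (N + 1) ∈ J)
    (p : Vertex n i ell → ℕ) (c : Finset (Vertex n i ell))
    (hc : IsChain (· ≤ ·) (c : Set (Vertex n i ell))) (hN : N < ∑ x ∈ c, p x) :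
    expMonomial p ∈ J.restrictScalars ℂ ⊔
      Submodule.span ℂ (expMonomial '' {q | ∑ x, q x = ∑ x, p x ∧ LexLT q p}) := by
  classical
  let p' : Vertex n i ell → ℕ := fun x => if x ∈ c then p x else 0
  have hp' : ∀ x, p' x ≠ 0 → x ∈ c := fun x hx => by
    by_contra h
    simp [p', h] at hx
  let r : Vertex n i ell → ℕ := fun x => if x ∈ c then 0 else p x
  have hpr : p = p' + r := by
    funext x
    by_cases h : x ∈ c <;> simp [p', r, h]
  have hsum : ∑ x ∈ c, p x = ∑ x, p' x := by simp [p']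
  -- The top of the chain: its principal ideal contains the support of `p'`, so the relation
  -- attached to that ideal involves the monomial of `p'`.
  obtain ⟨top, htop⟩ : ∃ top, ∀ x, p' x ≠ 0 → x ≤ top := by
    obtain ⟨x₀, hx₀, hne⟩ := Finset.exists_ne_zero_of_sum_ne_zero (Nat.ne_zero_of_lt hN)
    obtain ⟨top, ht, hmax⟩ := c.exists_maximal ⟨x₀, hx₀⟩
    refine ⟨top, fun x hx => ?_⟩
    rcases eq_or_ne x top with rfl | hxt
    · exact le_rfl
    · rcases hc (hp' x hx) ht hxt with h | h
      · exact h
      · exact hmax (hp' x hx) h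
  set d := ∑ x, p' x with hd
  let S : Finset (Vertex n i ell) := Finset.univ.filter (· ≤ top)
  have hcoeff := coeff_mem_of_eval_mem (J.restrictScalars ℂ)
    ((∑ x ∈ S, C (X x) * (X (Sum.inl x.row) * X (Sum.inr x.col)) :
      MvPolynomial (Fin (n + 1) ⊕ Fin (n + 1)) (MvPolynomial (Vertex n i ell) ℂ)) ^ d)
    (fun v => by
      have h := hJ top (fun a => v (Sum.inl a)) (fun a => v (Sum.inr a)) S (by simp [S])
      have h2 : d = (d - (N + 1)) + (N + 1) := by omega
      rw [map_pow, map_sum, h2, pow_add]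
      refine Ideal.mul_mem_left _ _ ?_
      convert! h using 2
      refine Finset.sum_congr rfl fun x _ => ?_
      simp [algebraMap_eq, mul_comm])
    (margins p')
  rw [coeff_margins_pow] at hcoeff
  have hmem : p' ∈ (S.piAntidiag d).filter fun q => margins q = margins p' := by
    rw [Finset.mem_filter, Finset.mem_piAntidiag]
    refine ⟨⟨?_, fun x hx => by simpa [S] using htop x hx⟩, rfl⟩
    rw [hd]
    refine Finset.sum_subset (Finset.subset_univ _) fun x _ hx => ?_
    by_contra h
    exact hx (by simpa [S] using htop x h)
  rw [← Finset.add_sum_erase _ _ hmem] at hcoeff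
  -- In characteristic zero the monomial of `p'` really occurs in the relation with its margins; all
  -- other terms are smaller because `p'` lives on a chain.
  have hmul : (Nat.multinomial S p' : ℂ) ≠ 0 := by
    exact_mod_cast (Nat.multinomial_pos S p').ne'
  have key : expMonomial p' ∈ J.restrictScalars ℂ ⊔
      Submodule.span ℂ (expMonomial '' {q | ∑ x, q x = ∑ x, p' x ∧ LexLT q p'}) := by
    have h2 : ∑ q ∈ ((S.piAntidiag d).filter fun q => margins q = margins p').erase p',
        (Nat.multinomial S q : ℂ) • expMonomial q ∈
        Submodule.span ℂ (expMonomial '' {q | ∑ x, q x = ∑ x, p' x ∧ LexLT q p'}) := by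
      refine Submodule.sum_mem _ fun q hq => Submodule.smul_mem _ _ (Submodule.subset_span ?_)
      rw [Finset.mem_erase, Finset.mem_filter, Finset.mem_piAntidiag] at hq
      refine ⟨q, ⟨?_, ?_⟩, rfl⟩
      · rw [← hd, ← hq.2.1.1]
        refine (Finset.sum_subset (Finset.subset_univ _) fun x _ hx => ?_).symm
        by_contra h
        exact hx (hq.2.1.2 x h)
      · refine lexLT_of_chain (sameMargins_of_margins_eq hq.2.2.symm) (fun x y hx hy => ?_)
          (Ne.symm hq.1)
        rcases eq_or_ne x y with rfl | hxy
        · exact Or.inl le_rfl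
        · exact hc (hp' x hx) (hp' y hy) hxy
    have h3 := Submodule.sub_mem _ (Submodule.mem_sup_left hcoeff) (Submodule.mem_sup_right h2)
    rw [add_sub_cancel_right] at h3
    exact (Submodule.smul_mem_iff _ hmul).1 h3
  -- The part `r` of `p` off the chain is restored by multiplication, which preserves the ideal and
  -- the lexicographic order.
  obtain ⟨f, hf, g, hg, hfg⟩ := Submodule.mem_sup.1 key
  rw [hpr, expMonomial_add, ← hfg, add_mul]
  refine Submodule.add_mem_sup (Ideal.mul_mem_right _ _ hf) ?_
  refine (Submodule.span_le (p := (Submodule.span ℂ _).comap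
    (LinearMap.mulRight ℂ (expMonomial r)))).2 ?_ hg
  rintro _ ⟨q, ⟨hq1, hq2⟩, rfl⟩
  change expMonomial q * expMonomial r ∈ Submodule.span ℂ _
  rw [← expMonomial_add]
  refine Submodule.subset_span ⟨q + r, ⟨?_, hq2.add_right r⟩, rfl⟩
  simp only [Pi.add_apply, Finset.sum_add_distrib, hq1]

end Straightening

/-! ### Cyclic submodules, the homogeneous order and commuting operators. -/

section Cyclic

variable {L : Type*} [LieRing L] [LieAlgebra ℂ L]
variable {M : Type*} [AddCommGroup M] [Module ℂ M]

/-- `U(L).v` is the smallest `L`-stable subspace that contains `v`. -/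
theorem cyclicSpan_le (ρ : L →ₗ⁅ℂ⁆ Module.End ℂ M) (v : M) (S : Submodule ℂ M) (hv : v ∈ S)
    (hS : ∀ x, ∀ w ∈ S, ρ x w ∈ S) : cyclicSpan ρ v ≤ S := by
  let B : Subalgebra ℂ (Module.End ℂ M) :=
    { carrier := {f | ∀ w ∈ S, f w ∈ S}
      mul_mem' := fun {f g} hf hg w hw => hf _ (hg w hw)
      add_mem' := fun {f g} hf hg w hw => S.add_mem (hf w hw) (hg w hw)
      algebraMap_mem' := fun c w hw => by
        rw [Module.algebraMap_end_apply]; exact S.smul_mem c hw }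
  let σ : L →ₗ⁅ℂ⁆ B :=
    { toFun := fun x => ⟨ρ x, hS x⟩
      map_add' := fun x y => Subtype.ext (map_add ρ x y)
      map_smul' := fun c x => Subtype.ext (map_smul ρ c x)
      map_lie' := fun {x y} => Subtype.ext (LieHom.map_lie ρ x y) }
  have h : B.val.comp (UniversalEnvelopingAlgebra.lift ℂ σ) = envAction ρ := by
    refine (UniversalEnvelopingAlgebra.lift_unique ℂ ρ _).1 ?_
    funext x
    simp [σ]
  intro w hw
  obtain ⟨a, rfl⟩ := (mem_cyclicSpan ρ v w).1 hw
  rw [← h]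
  exact (UniversalEnvelopingAlgebra.lift ℂ σ a).2 v hv

end Cyclic

section HomLex

variable {ι : Type*} [Fintype ι] [LinearOrder ι]

theorem HomLexLT.trans {p q r : ι → ℕ} (h₁ : HomLexLT p q) (h₂ : HomLexLT q r) :
    HomLexLT p r := by
  rcases h₁ with h₁ | ⟨e₁, a, ha, ha'⟩
  · rcases h₂ with h₂ | ⟨e₂, -⟩
    · exact Or.inl (h₁.trans h₂)
    · exact Or.inl (e₂ ▸ h₁)
  · rcases h₂ with h₂ | ⟨e₂, b, hb, hb'⟩
    · exact Or.inl (e₁ ▸ h₂)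
    · refine Or.inr ⟨e₁.trans e₂, ?_⟩
      rcases lt_trichotomy a b with h | rfl | h
      · exact ⟨b, by rw [ha' b h]; exact hb, fun c hc => by rw [ha' c (h.trans hc), hb' c hc]⟩
      · exact ⟨a, ha.trans hb, fun c hc => by rw [ha' c hc, hb' c hc]⟩
      · exact ⟨a, by rw [← hb' a h]; exact ha, fun c hc => by rw [ha' c hc, hb' c (h.trans hc)]⟩

theorem HomLexLT.irrefl (p : ι → ℕ) : ¬ HomLexLT p p := by
  rintro (h | ⟨-, a, h, -⟩) <;> exact lt_irrefl _ h

theorem HomLexLT.wellFounded : WellFounded (HomLexLT (ι := ι)) := by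
  have h1 : WellFounded (Pi.Lex (fun a b : ι => b < a) (fun {_} (a b : ℕ) => a < b)) :=
    Pi.Lex.wellFounded (r := fun a b : ι => b < a) (α := fun _ => ℕ) (s := fun _ a b => a < b)
      fun _ => wellFounded_lt
  have h2 := InvImage.wf (fun p : ι → ℕ => (∑ a, p a, p))
    ((Prod.lex ⟨_, wellFounded_lt (α := ℕ)⟩ ⟨_, h1⟩).wf)
  refine Subrelation.wf (fun {p q} h => ?_) h2
  rcases h with h | ⟨e, a, ha, hb⟩
  · exact Prod.Lex.left _ _ h
  · change Prod.Lex _ _ (∑ a, p a, p) (∑ a, q a, q)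
    rw [e]
    exact Prod.Lex.right _ ⟨a, hb, ha⟩

end HomLex

section CommutingAction

open MvPolynomial

variable {M : Type*} [AddCommGroup M] [Module ℂ M] {σ : Type*}

open Classical in
/-- The action of a polynomial ring by pairwise commuting operators. -/
theorem exists_commAction (f : σ → Module.End ℂ M) (h : ∀ x y, f x * f y = f y * f x) :
    ∃ Ψ : MvPolynomial σ ℂ →ₐ[ℂ] Module.End ℂ M, ∀ x, Ψ (X x) = f x := by
  have hcomm := Algebra.isMulCommutative_adjoin ℂ (s := Set.range f) (by
    rintro _ ⟨x, rfl⟩ _ ⟨y, rfl⟩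
    exact h x y)
  let _ : CommSemiring (Algebra.adjoin ℂ (Set.range f)) :=
    { (Algebra.adjoin ℂ (Set.range f)).toSemiring with mul_comm := hcomm.is_comm.comm }
  refine ⟨(Algebra.adjoin ℂ (Set.range f)).val.comp
    (aeval fun x => (⟨f x, Algebra.subset_adjoin ⟨x, rfl⟩⟩ : Algebra.adjoin ℂ (Set.range f))),
    fun x => ?_⟩
  simp

/-- The annihilator of a vector under a polynomial action. -/
def annIdeal (Ψ : MvPolynomial σ ℂ →ₐ[ℂ] Module.End ℂ M) (v : M) :
    Ideal (MvPolynomial σ ℂ) where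
  carrier := {f | Ψ f v = 0}
  zero_mem' := by simp
  add_mem' {f g} hf hg := by
    simp only [Set.mem_ofPred_eq] at *
    rw [map_add, LinearMap.add_apply, hf, hg, add_zero]
  smul_mem' g f hf := by
    simp only [Set.mem_ofPred_eq] at *
    rw [smul_eq_mul, map_mul, Module.End.mul_apply, hf, map_zero]

end CommutingAction

/-! ### Ordered monomials and the degree filtration of a cyclic module. -/

section AbstractModule

open MvPolynomial

variable {ι : Type*} [Fintype ι] [LinearOrder ι] {σ : Type*} [Fintype σ]
variable {L : Type*} [LieRing L] [LieAlgebra ℂ L]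
variable {M : Type*} [AddCommGroup M] [Module ℂ M]

theorem monomialVec_eq (ρ : L →ₗ⁅ℂ⁆ Module.End ℂ M) (e : Module.Basis ι ℂ L) (v : M)
    (p : ι → ℕ) : monomialVec ρ e v p =
    (((Finset.univ : Finset ι).sort (· ≤ ·)).map fun a => ρ (e a) ^ p a).prod v := by
  rw [monomialVec, pbwMonomial, map_list_prod, List.map_map]
  congr 3
  funext a
  simp [envAction]

/-- For exponents supported on the range of `β` all factors are images of elements of a commutative
ring, so their order is immaterial. -/
theorem monomialVec_extend (ρ : L →ₗ⁅ℂ⁆ Module.End ℂ M) (e : Module.Basis ι ℂ L) (v : M)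
    {β : σ → ι} (hβ : Function.Injective β) (Ψ : MvPolynomial σ ℂ →ₐ[ℂ] Module.End ℂ M)
    (hΨ : ∀ x, Ψ (X x) = ρ (e (β x))) (q : σ → ℕ) :
    monomialVec ρ e v (Function.extend β q 0) = Ψ (expMonomial q) v := by
  classical
  let g : ι → MvPolynomial σ ℂ := Function.extend β (fun x => X x) 1
  have h1 : (fun a => ρ (e a) ^ Function.extend β q 0 a) =
      Ψ ∘ fun a => g a ^ Function.extend β q 0 a := by
    funext a
    by_cases ha : ∃ x, β x = a
    · obtain ⟨x, rfl⟩ := ha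
      simp [g, hβ.extend_apply, hΨ]
    · simp [Function.extend_apply' _ _ _ ha]
  rw [monomialVec_eq, h1, ← List.map_map, ← map_list_prod]
  congr 2
  have h2 : (((Finset.univ : Finset ι).sort (· ≤ ·)).map
      fun a => g a ^ Function.extend β q 0 a).prod = ∏ a, g a ^ Function.extend β q 0 a := by
    rw [Finset.prod_eq_multiset_prod, ← Finset.sort_eq (s := Finset.univ) (r := (· ≤ ·)),
      Multiset.map_coe, Multiset.prod_coe]
  rw [h2, expMonomial]
  symm
  refine Finset.prod_of_injOn β hβ.injOn (by simp) (fun a _ ha => ?_) fun x _ => ?_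
  · rw [Function.extend_apply' _ _ _ (by simpa using ha)]
    simp
  · simp [g, hβ.extend_apply]

/-- The span of the vectors `x^q.v` with `q` of degree at most `d`. -/
def degreeSpan (Ψ : MvPolynomial σ ℂ →ₐ[ℂ] Module.End ℂ M) (v : M) (d : ℕ) : Submodule ℂ M :=
  Submodule.span ℂ ((fun q => Ψ (expMonomial q) v) '' {q | ∑ x, q x ≤ d})

theorem degreeSpan_mono (Ψ : MvPolynomial σ ℂ →ₐ[ℂ] Module.End ℂ M) (v : M) {d d' : ℕ}
    (h : d ≤ d') : degreeSpan Ψ v d ≤ degreeSpan Ψ v d' :=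
  Submodule.span_mono (Set.image_mono fun _ hq => le_trans hq h)

theorem X_mem_degreeSpan (Ψ : MvPolynomial σ ℂ →ₐ[ℂ] Module.End ℂ M) (v : M) (d : ℕ) (x : σ)
    (w : M) (hw : w ∈ degreeSpan Ψ v d) : Ψ (X x) w ∈ degreeSpan Ψ v (d + 1) := by
  classical
  refine (Submodule.span_le (p := (degreeSpan Ψ v (d + 1)).comap (Ψ (X x)))).2 ?_ hw
  rintro _ ⟨q, hq, rfl⟩
  refine Submodule.subset_span ⟨Pi.single x 1 + q, ?_, ?_⟩
  · simp only [Set.mem_ofPred_eq, Pi.add_apply, Finset.sum_add_distrib] at hq ⊢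
    rw [Fintype.sum_pi_single']
    omega
  · simp only [expMonomial_add, map_mul, Module.End.mul_apply]
    congr 2
    rw [expMonomial, Finset.prod_eq_single x]
    · simp
    · intro y _ hy; simp [hy]
    · simp

/-- Induction on the degree: when a basis vector outside the range of `β` moves past one variable,
the commutator is an arbitrary Lie algebra element acting on a vector of degree one less, so it only
makes up the lost degree. At the end the vector reaches `v` and kills it. -/
theorem degreeSpan_stable (ρ : L →ₗ⁅ℂ⁆ Module.End ℂ M) (e : Module.Basis ι ℂ L) (v : M)
    {β : σ → ι} (Ψ : MvPolynomial σ ℂ →ₐ[ℂ] Module.End ℂ M)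
    (hΨ : ∀ x, Ψ (X x) = ρ (e (β x))) (hkill : ∀ b, b ∉ Set.range β → ρ (e b) v = 0) (d : ℕ) :
    (∀ b, b ∉ Set.range β → ∀ w ∈ degreeSpan Ψ v d, ρ (e b) w ∈ degreeSpan Ψ v d) ∧
      ∀ y, ∀ w ∈ degreeSpan Ψ v d, ρ y w ∈ degreeSpan Ψ v (d + 1) := by
  classical
  have step : ∀ d, (∀ b, b ∉ Set.range β → ∀ w ∈ degreeSpan Ψ v d,
      ρ (e b) w ∈ degreeSpan Ψ v d) →
      ∀ y, ∀ w ∈ degreeSpan Ψ v d, ρ y w ∈ degreeSpan Ψ v (d + 1) := by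
    intro d h y w hw
    rw [← e.sum_repr y, map_sum, LinearMap.sum_apply]
    refine Submodule.sum_mem _ fun b _ => ?_
    rw [map_smul, LinearMap.smul_apply]
    refine Submodule.smul_mem _ _ ?_
    by_cases hb : b ∈ Set.range β
    · obtain ⟨x, rfl⟩ := hb
      rw [← hΨ]
      exact X_mem_degreeSpan Ψ v d x w hw
    · exact degreeSpan_mono Ψ v (Nat.le_succ d) (h b hb w hw)
  have main : ∀ d, ∀ b, b ∉ Set.range β → ∀ w ∈ degreeSpan Ψ v d,
      ρ (e b) w ∈ degreeSpan Ψ v d := by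
    intro d
    induction d with
    | zero =>
      intro b hb w hw
      refine (Submodule.span_le (p := (degreeSpan Ψ v 0).comap (ρ (e b)))).2 ?_ hw
      rintro _ ⟨q, hq, rfl⟩
      have hq0 : ∀ x, q x = 0 := by simpa using hq
      simp [expMonomial, hq0, hkill b hb]
    | succ d ih =>
      intro b hb w hw
      refine (Submodule.span_le (p := (degreeSpan Ψ v (d + 1)).comap (ρ (e b)))).2 ?_ hw
      rintro _ ⟨q, hq, rfl⟩
      change ρ (e b) (Ψ (expMonomial q) v) ∈ degreeSpan Ψ v (d + 1)
      by_cases hq0 : ∀ x, q x = 0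
      · simp [expMonomial, hq0, hkill b hb]
      · push Not at hq0
        obtain ⟨x, hx⟩ := hq0
        have hqd : q = Pi.single x 1 + (q - Pi.single x 1) := by
          funext y
          by_cases hy : y = x
          · subst hy; simp; omega
          · simp [hy]
        have hX : expMonomial (Pi.single x 1) = (X x : MvPolynomial σ ℂ) := by
          rw [expMonomial, Finset.prod_eq_single x]
          · simp
          · intro y _ hy; simp [hy]
          · simp
        have hmem : Ψ (expMonomial (q - Pi.single x 1)) v ∈ degreeSpan Ψ v d := by
          refine Submodule.subset_span ⟨_, ?_, rfl⟩
          have := congrArg (fun f : σ → ℕ => ∑ y, f y) hqd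
          simp only [Pi.add_apply, Finset.sum_add_distrib, Fintype.sum_pi_single'] at this
          simp only [Set.mem_ofPred_eq] at hq ⊢
          omega
        rw [hqd, expMonomial_add, map_mul, Module.End.mul_apply, hX, hΨ]
        have hbr : ρ (e b) (ρ (e (β x)) (Ψ (expMonomial (q - Pi.single x 1)) v)) =
            ρ (e (β x)) (ρ (e b) (Ψ (expMonomial (q - Pi.single x 1)) v)) +
              ρ ⁅e b, e (β x)⁆ (Ψ (expMonomial (q - Pi.single x 1)) v) := by
          rw [LieHom.map_lie, LieRing.of_associative_ring_bracket]
          simp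
        rw [hbr, ← hΨ]
        exact Submodule.add_mem _ (X_mem_degreeSpan Ψ v d x _ (ih b hb _ hmem))
          (step d ih _ _ hmem)
  exact ⟨main d, step d (main d)⟩

/-- Only exponents on the range of `β` count towards the degree. Hence any monomial with another
factor is a combination of monomials of strictly smaller total degree. -/
theorem monomialVec_mem_degreeSpan (ρ : L →ₗ⁅ℂ⁆ Module.End ℂ M) (e : Module.Basis ι ℂ L) (v : M)
    {β : σ → ι} (hβ : Function.Injective β) (Ψ : MvPolynomial σ ℂ →ₐ[ℂ] Module.End ℂ M)
    (hΨ : ∀ x, Ψ (X x) = ρ (e (β x))) (hkill : ∀ b, b ∉ Set.range β → ρ (e b) v = 0)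
    (p : ι → ℕ) : monomialVec ρ e v p ∈ degreeSpan Ψ v (∑ x, p (β x)) := by
  classical
  have hlist : ∀ l : List ι, (l.map fun a => ρ (e a) ^ p a).prod v ∈
      degreeSpan Ψ v (l.map fun a => if a ∈ Set.range β then p a else 0).sum := by
    intro l
    induction l with
    | nil =>
      refine Submodule.subset_span ⟨0, by simp, ?_⟩
      simp [expMonomial]
    | cons a l ih =>
      simp only [List.map_cons, List.prod_cons, Module.End.mul_apply, List.sum_cons]
      have hpow : ∀ (k d : ℕ) (w : M), w ∈ degreeSpan Ψ v d →
          (ρ (e a) ^ k) w ∈ degreeSpan Ψ v ((if a ∈ Set.range β then k else 0) + d) := by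
        intro k d w hw
        induction k with
        | zero => simpa using hw
        | succ k ihk =>
          rw [pow_succ', Module.End.mul_apply]
          split_ifs at ihk ⊢ with ha
          · have := (degreeSpan_stable ρ e v Ψ hΨ hkill _).2 (e a) _ ihk
            rwa [add_right_comm] at this
          · exact (degreeSpan_stable ρ e v Ψ hΨ hkill _).1 a ha _ ihk
      exact hpow _ _ _ ih
  have h := hlist ((Finset.univ : Finset ι).sort (· ≤ ·))
  rw [← monomialVec_eq] at h
  convert! h using 2
  have h2 : (((Finset.univ : Finset ι).sort (· ≤ ·)).map
      fun a => if a ∈ Set.range β then p a else 0).sum =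
      ∑ a, if a ∈ Set.range β then p a else 0 := by
    rw [Finset.sum_eq_multiset_sum, ← Finset.sort_eq (s := Finset.univ) (r := (· ≤ ·)),
      Multiset.map_coe, Multiset.sum_coe]
  rw [h2]
  refine Finset.sum_of_injOn β hβ.injOn (by simp) (fun a _ ha => ?_) fun x _ => ?_
  · rw [if_neg (by simpa using ha)]
  · simp

theorem cyclicSpan_le_span (ρ : L →ₗ⁅ℂ⁆ Module.End ℂ M) (e : Module.Basis ι ℂ L) (v : M)
    {β : σ → ι} (Ψ : MvPolynomial σ ℂ →ₐ[ℂ] Module.End ℂ M)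
    (hΨ : ∀ x, Ψ (X x) = ρ (e (β x))) (hkill : ∀ b, b ∉ Set.range β → ρ (e b) v = 0) :
    cyclicSpan ρ v ≤ Submodule.span ℂ (Set.range fun q => Ψ (expMonomial q) v) := by
  have hle : ∀ d, degreeSpan Ψ v d ≤ Submodule.span ℂ (Set.range fun q => Ψ (expMonomial q) v) :=
    fun d => Submodule.span_mono (Set.image_subset_range _ _)
  refine cyclicSpan_le ρ v _ (Submodule.subset_span ⟨0, by simp [expMonomial]⟩) fun y w hw => ?_
  refine (Submodule.span_le (p := (Submodule.span ℂ _).comap (ρ y))).2 ?_ hw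
  rintro _ ⟨q, rfl⟩
  exact hle _ ((degreeSpan_stable ρ e v Ψ hΨ hkill (∑ x, q x)).2 y _
    (Submodule.subset_span ⟨q, by simp, rfl⟩))

end AbstractModule

/-! ### Spanning vectors and essential exponents. -/

section Straightening

open MvPolynomial

variable {ι : Type*} [Fintype ι]

theorem sum_extend {σ : Type*} [Fintype σ] {β : σ → ι} (hβ : Function.Injective β) (q : σ → ℕ) :
    ∑ a, Function.extend β q 0 a = ∑ x, q x := by
  symm
  refine Finset.sum_of_injOn β hβ.injOn (by simp) (fun a _ ha => ?_) fun x _ => ?_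
  · rw [Function.extend_apply' _ _ _ (by simpa using ha)]
    rfl
  · rw [hβ.extend_apply]

variable [LinearOrder ι] {n i : ℕ} {ell : Fin (n + 1) → ℕ} {β : Vertex n i ell → ι}

/-- The exponents on the poset all of whose chain sums are at most `N`. -/
def chainExponents (n i : ℕ) (ell : Fin (n + 1) → ℕ) (N : ℕ) : Set (Vertex n i ell → ℕ) :=
  {q | ∀ c : Finset (Vertex n i ell), IsChain (· ≤ ·) (c : Set (Vertex n i ell)) →
    ∑ x ∈ c, q x ≤ N}

/-- Extended exponents vanish off the range of `β`, so only the order among the roots in that range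
matters; any total order extending the prescribed one will do. -/
theorem homLexLT_extend (hβ : Function.Injective β)
    (hord : ∀ x y, Vertex.totLT x y → β x < β y) {p q : Vertex n i ell → ℕ}
    (hs : ∑ x, q x = ∑ x, p x) (h : LexLT q p) :
    HomLexLT (Function.extend β q 0) (Function.extend β p 0) := by
  refine Or.inr ⟨by rw [sum_extend hβ, sum_extend hβ, hs], ?_⟩
  obtain ⟨x, hx, hy⟩ := h
  refine ⟨β x, by rwa [hβ.extend_apply, hβ.extend_apply], fun b hb => ?_⟩
  by_cases hbr : ∃ y, β y = b
  · obtain ⟨y, rfl⟩ := hbr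
    rw [hβ.extend_apply, hβ.extend_apply]
    rcases Vertex.totLT_trichotomy x y with h | rfl | h
    · exact hy y h
    · exact absurd hb (lt_irrefl _)
    · exact absurd hb (hord y x h).not_gt
  · rw [Function.extend_apply' _ _ _ hbr, Function.extend_apply' _ _ _ hbr]

variable {L : Type*} [LieRing L] [LieAlgebra ℂ L]
variable {M : Type*} [AddCommGroup M] [Module ℂ M]

/-- Well-founded induction on the exponent with two rewriting rules: a factor outside the range of
`β` lowers the degree, and a violated chain inequality is straightened inside the annihilator of
`v`. -/
theorem monomialVec_mem_span (ρ : L →ₗ⁅ℂ⁆ Module.End ℂ M) (e : Module.Basis ι ℂ L) (v : M)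
    (N : ℕ) (hβ : Function.Injective β) (hord : ∀ x y, Vertex.totLT x y → β x < β y)
    (Ψ : MvPolynomial (Vertex n i ell) ℂ →ₐ[ℂ] Module.End ℂ M)
    (hΨ : ∀ x, Ψ (X x) = ρ (e (β x))) (hkill : ∀ b, b ∉ Set.range β → ρ (e b) v = 0)
    (hpow : ∀ (top : Vertex n i ell) (s t : Fin (n + 1) → ℂ), ∀ S : Finset (Vertex n i ell),
      (∀ x, x ∈ S ↔ x ≤ top) →
      (ρ (∑ x ∈ S, (s x.row * t x.col) • e (β x)) ^ (N + 1)) v = 0) (p : ι → ℕ) :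
    monomialVec ρ e v p ∈ Submodule.span ℂ (monomialVec ρ e v ''
      {r | r ∈ (fun q => Function.extend β q 0) '' chainExponents n i ell N ∧
        (r = p ∨ HomLexLT r p)}) := by
  classical
  induction p using (HomLexLT.wellFounded (ι := ι)).induction with
  | _ p ih => ?_
  have hlower : ∀ r, HomLexLT r p → monomialVec ρ e v r ∈ Submodule.span ℂ (monomialVec ρ e v ''
      {r | r ∈ (fun q => Function.extend β q 0) '' chainExponents n i ell N ∧
        (r = p ∨ HomLexLT r p)}) := by
    intro r hr
    refine Submodule.span_mono (Set.image_mono ?_) (ih r hr)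
    rintro r' ⟨h1, rfl | h2⟩
    · exact ⟨h1, Or.inr hr⟩
    · exact ⟨h1, Or.inr (h2.trans hr)⟩
  by_cases hoff : ∃ b, b ∉ Set.range β ∧ p b ≠ 0
  · obtain ⟨b, hb, hpb⟩ := hoff
    have hlt : ∑ x, p (β x) < ∑ a, p a := by
      rw [← Finset.sum_image (s := Finset.univ) (g := β) (f := p) hβ.injOn]
      exact Finset.sum_lt_sum_of_subset (Finset.subset_univ _) (Finset.mem_univ b)
        (by simpa using hb) (Nat.pos_of_ne_zero hpb) fun _ _ _ => Nat.zero_le _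
    refine (Submodule.span_le.2 ?_) (monomialVec_mem_degreeSpan ρ e v hβ Ψ hΨ hkill p)
    rintro _ ⟨q, hq, rfl⟩
    dsimp only
    rw [← monomialVec_extend ρ e v hβ Ψ hΨ]
    refine hlower _ (Or.inl ?_)
    rw [sum_extend hβ]
    exact lt_of_le_of_lt hq hlt
  · push Not at hoff
    obtain ⟨q, rfl⟩ : ∃ q : Vertex n i ell → ℕ, Function.extend β q 0 = p := by
      refine ⟨p ∘ β, funext fun a => ?_⟩
      by_cases ha : ∃ x, β x = a
      · obtain ⟨x, rfl⟩ := ha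
        rw [hβ.extend_apply]; rfl
      · rw [Function.extend_apply' _ _ _ ha, hoff a (by simpa using ha)]; rfl
    by_cases hq : q ∈ chainExponents n i ell N
    · exact Submodule.subset_span ⟨_, ⟨⟨q, hq, rfl⟩, Or.inl rfl⟩, rfl⟩
    · have hq' : ∃ c : Finset (Vertex n i ell), IsChain (· ≤ ·) (c : Set (Vertex n i ell)) ∧
          N < ∑ x ∈ c, q x := by
        simpa [chainExponents] using hq
      obtain ⟨c, hc, hN⟩ := hq'
      have hmem := expMonomial_mem_of_chain (annIdeal Ψ v) N (fun top s t S hS => by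
        change Ψ _ v = 0
        rw [map_pow, map_sum, ← hpow top s t S hS, map_sum]
        congr 2
        refine Finset.sum_congr rfl fun x _ => ?_
        rw [map_mul, hΨ, map_smul, ← algebraMap_eq, AlgHom.commutes, ← Algebra.smul_def]) q c hc hN
      obtain ⟨f, hf, g, hg, hfg⟩ := Submodule.mem_sup.1 hmem
      have hf' : Ψ f v = 0 := hf
      rw [monomialVec_extend ρ e v hβ Ψ hΨ, ← hfg, map_add, LinearMap.add_apply, hf', zero_add]
      refine (Submodule.span_le (p := (Submodule.span ℂ _).comap
        ((LinearMap.applyₗ v).comp Ψ.toLinearMap))).2 ?_ hg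
      rintro _ ⟨r, ⟨hr1, hr2⟩, rfl⟩
      change Ψ (expMonomial r) v ∈ Submodule.span ℂ _
      rw [← monomialVec_extend ρ e v hβ Ψ hΨ]
      exact hlower _ (homLexLT_extend hβ hord hr1 hr2)

/-- Straightening never increases an exponent, so exponents outside the candidate set are not
essential; independence makes each candidate essential. -/
theorem essential_and_basis (ρ : L →ₗ⁅ℂ⁆ Module.End ℂ M) (e : Module.Basis ι ℂ L) (v : M)
    (N : ℕ) (hβ : Function.Injective β) (hord : ∀ x y, Vertex.totLT x y → β x < β y)
    (Ψ : MvPolynomial (Vertex n i ell) ℂ →ₐ[ℂ] Module.End ℂ M)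
    (hΨ : ∀ x, Ψ (X x) = ρ (e (β x))) (hkill : ∀ b, b ∉ Set.range β → ρ (e b) v = 0)
    (hpow : ∀ (top : Vertex n i ell) (s t : Fin (n + 1) → ℂ), ∀ S : Finset (Vertex n i ell),
      (∀ x, x ∈ S ↔ x ≤ top) →
      (ρ (∑ x ∈ S, (s x.row * t x.col) • e (β x)) ^ (N + 1)) v = 0)
    (hind : LinearIndepOn ℂ (fun q => Ψ (expMonomial q) v) (chainExponents n i ell N)) :
    LinearIndepOn ℂ (monomialVec ρ e v)
        ((fun q => Function.extend β q 0) '' chainExponents n i ell N) ∧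
      Submodule.span ℂ (monomialVec ρ e v ''
        ((fun q => Function.extend β q 0) '' chainExponents n i ell N)) = cyclicSpan ρ v ∧
      essentialSet ρ e v = (fun q => Function.extend β q 0) '' chainExponents n i ell N := by
  set E := (fun q => Function.extend β q (0 : ι → ℕ)) '' chainExponents n i ell N with hE
  have hext : (fun q => Ψ (expMonomial q) v) =
      monomialVec ρ e v ∘ fun q => Function.extend β q 0 := by
    funext q
    exact (monomialVec_extend ρ e v hβ Ψ hΨ q).symm
  have hinj : Function.Injective fun q : Vertex n i ell → ℕ => Function.extend β q (0 : ι → ℕ) := by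
    intro q q' h
    funext x
    have := congrFun h (β x)
    simpa [hβ.extend_apply] using this
  have hlin : LinearIndepOn ℂ (monomialVec ρ e v) E := by
    rw [hext] at hind
    exact hind.image_of_comp
  have hspan : Submodule.span ℂ (monomialVec ρ e v '' E) = cyclicSpan ρ v := by
    apply le_antisymm
    · rw [Submodule.span_le]
      rintro _ ⟨p, -, rfl⟩
      exact (mem_cyclicSpan ρ v _).2 ⟨_, rfl⟩
    · refine (cyclicSpan_le_span ρ e v Ψ hΨ hkill).trans ?_
      rw [Submodule.span_le]
      rintro _ ⟨q, rfl⟩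
      dsimp only
      rw [← monomialVec_extend ρ e v hβ Ψ hΨ]
      exact Submodule.span_mono (Set.image_mono fun r hr => hr.1)
        (monomialVec_mem_span ρ e v N hβ hord Ψ hΨ hkill hpow _)
  refine ⟨hlin, hspan, Set.ext fun p => ⟨fun hp => ?_, fun hp hcon => ?_⟩⟩
  · by_contra hpE
    apply hp
    apply le_antisymm
    · exact Submodule.span_mono (Set.image_mono fun q hq => Or.inl hq)
    · refine Submodule.span_le.2 ?_
      rintro _ ⟨q, hq | rfl, rfl⟩
      · exact Submodule.subset_span ⟨q, hq, rfl⟩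
      · refine Submodule.span_mono (Set.image_mono ?_)
          (monomialVec_mem_span ρ e v N hβ hord Ψ hΨ hkill hpow q)
        rintro r ⟨hr, rfl | h⟩
        · exact absurd hr hpE
        · exact h
  · have h1 : monomialVec ρ e v p ∈ filtLT ρ e v p := by
      rw [hcon]
      exact Submodule.subset_span ⟨p, Or.inr rfl, rfl⟩
    -- Straightening an exponent below `p` can never produce `p` itself.
    have h2 : filtLT ρ e v p ≤ Submodule.span ℂ (monomialVec ρ e v '' (E \ {p})) := by
      refine Submodule.span_le.2 ?_
      rintro _ ⟨q, hq, rfl⟩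
      refine Submodule.span_mono (Set.image_mono ?_)
        (monomialVec_mem_span ρ e v N hβ hord Ψ hΨ hkill hpow q)
      rintro r ⟨hr, h⟩
      refine ⟨hr, ?_⟩
      rintro rfl
      rcases h with rfl | h
      · exact HomLexLT.irrefl _ hq
      · exact HomLexLT.irrefl _ (h.trans hq)
    rw [← Set.insert_sdiff_self_of_mem hp] at hlin
    exact ((linearIndepOn_insert (by simp)).1 hlin).2 (h2 h1)

end Straightening

/-! ### Derivations on products and determinants. -/

section DerivationDet

variable {A : Type*} [CommRing A] [Algebra ℂ A] (D : Derivation ℂ A A)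

theorem derivation_prod {ι : Type*} [DecidableEq ι] (s : Finset ι) (f : ι → A) :
    D (∏ j ∈ s, f j) = ∑ j ∈ s, ∏ k ∈ s, Function.update f j (D (f j)) k := by
  induction s using Finset.induction_on with
  | empty => simp
  | insert a s ha ih =>
    rw [Finset.prod_insert ha, D.leibniz, ih, Finset.sum_insert ha, Finset.prod_insert ha,
      Function.update_self, add_comm, smul_eq_mul, smul_eq_mul, mul_comm]
    congr 1
    · congr 1
      refine Finset.prod_congr rfl fun k hk => ?_
      rw [Function.update_of_ne (ne_of_mem_of_not_mem hk ha)]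
    · rw [Finset.mul_sum]
      refine Finset.sum_congr rfl fun j hj => ?_
      rw [Finset.prod_insert ha, Function.update_of_ne (ne_of_mem_of_not_mem hj ha).symm]

theorem derivation_det {ι : Type*} [DecidableEq ι] [Fintype ι] (M : Matrix ι ι A) :
    D M.det = ∑ s, (M.updateRow s fun t => D (M s t)).det := by
  simp_rw [← Matrix.det_transpose (Matrix.updateRow _ _ _)]
  rw [← Matrix.det_transpose]
  simp_rw [Matrix.det_apply, Matrix.transpose_apply]
  rw [map_sum, Finset.sum_comm]
  refine Finset.sum_congr rfl fun σ _ => ?_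
  rw [Units.smul_def, map_zsmul, derivation_prod, Finset.smul_sum]
  refine Finset.sum_congr rfl fun s _ => ?_
  rw [Units.smul_def]
  congr 1
  refine Finset.prod_congr rfl fun k _ => ?_
  rw [Matrix.updateRow_apply, Function.update_apply]
  split_ifs with h
  · rw [h]
  · rfl

theorem derivation_pow_mul {y : A} (hy : D (D y) = 0) (x : A) (k : ℕ) :
    ((D : A →ₗ[ℂ] A) ^ (k + 1)) (x * y) =
      ((D : A →ₗ[ℂ] A) ^ (k + 1)) x * y + (k + 1) * (((D : A →ₗ[ℂ] A) ^ k) x * D y) := by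
  induction k with
  | zero => simp [D.leibniz]; ring
  | succ k ih =>
    have h1 : ∀ (j : ℕ) (z : A), ((D : A →ₗ[ℂ] A) ^ (j + 1)) z = D (((D : A →ₗ[ℂ] A) ^ j) z) := by
      intro j z
      rw [pow_succ', Module.End.mul_apply]
      rfl
    rw [h1 (k + 1), ih, h1 (k + 1) x, h1 k x]
    have hk : D ((k : A) + 1) = 0 := by
      rw [map_add, D.map_natCast, D.map_one_eq_zero, add_zero]
    simp only [map_add, D.leibniz, hy, hk, smul_eq_mul]
    push_cast
    ring

/-- Each factor can absorb `D` at most once, so one application more than the number of factors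
gives zero. -/
theorem derivation_pow_prod {ι : Type*} (s : Finset ι) (f : ι → A) (h : ∀ j, D (D (f j)) = 0) :
    ((D : A →ₗ[ℂ] A) ^ (s.card + 1)) (∏ j ∈ s, f j) = 0 := by
  classical
  induction s using Finset.induction_on with
  | empty => simp
  | insert a s ha ih =>
    rw [Finset.prod_insert ha, Finset.card_insert_of_notMem ha, mul_comm,
      derivation_pow_mul D (h a), ih]
    rw [pow_succ', Module.End.mul_apply, ih]
    simp

/-- `D` replaces a row by a multiple of the fixed row `Y`. Twice in the same row gives `D Y = 0`; in
two different rows it makes them proportional. -/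
theorem derivation_derivation_det {ι : Type*} [DecidableEq ι] [Fintype ι] (M : Matrix ι ι A)
    (t : ι → ℂ) (Y : ι → A) (hM : ∀ a b, D (M a b) = t a • Y b) (hY : ∀ b, D (Y b) = 0) :
    D (D M.det) = 0 := by
  rw [derivation_det, map_sum]
  refine Finset.sum_eq_zero fun a _ => ?_
  rw [derivation_det]
  refine Finset.sum_eq_zero fun b _ => ?_
  rcases eq_or_ne b a with rfl | hba
  · refine Matrix.det_eq_zero_of_row_eq_zero b fun c => ?_
    rw [Matrix.updateRow_self, Matrix.updateRow_self, hM, D.map_smul, hY, smul_zero]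
  · have h1 : (M.updateRow a fun c => D (M a c)) b = M b := Matrix.updateRow_ne hba
    have h2 : (fun c => D ((M.updateRow a fun c => D (M a c)) b c)) = t b • Y := by
      funext c
      rw [h1, hM]; rfl
    have h3 : (fun c => D (M a c)) = t a • Y := by
      funext c
      rw [hM]; rfl
    rw [h2, h3, ← algebraMap_smul A (t a), ← algebraMap_smul A (t b), Matrix.det_updateRow_smul,
      Matrix.updateRow_comm _ hba.symm, Matrix.det_updateRow_smul]
    rw [Matrix.det_zero_of_row_eq hba]
    · simp
    · rw [Matrix.updateRow_ne hba, Matrix.updateRow_self, Matrix.updateRow_self]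

end DerivationDet

/-! ### The model: products of minors in disjoint sets of variables. -/

section Model

open MvPolynomial

variable {n i : ℕ} {R : Type*}

/-- The coordinate ring of a product, indexed by `R`, of spaces of `(n+1) × i` matrices. -/
abbrev ModelRing (n i : ℕ) (R : Type*) := MvPolynomial (Fin (n + 1) × (R × Fin i)) ℂ

/-- The derivation by which a matrix acts. -/
noncomputable def glDer (A : Matrix (Fin (n + 1)) (Fin (n + 1)) ℂ) :
    Derivation ℂ (ModelRing n i R) (ModelRing n i R) :=
  mkDerivation ℂ fun x => ∑ c, A c x.1 • X (c, x.2)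

theorem glDer_X (A : Matrix (Fin (n + 1)) (Fin (n + 1)) ℂ) (x : Fin (n + 1) × (R × Fin i)) :
    glDer A (X x) = ∑ c, A c x.1 • (X (c, x.2) : ModelRing n i R) := by
  rw [glDer, mkDerivation_X]

variable (n i R) in
/-- The representation of `𝔤𝔩_{n+1}` on the model ring. -/
noncomputable def glRep : Matrix (Fin (n + 1)) (Fin (n + 1)) ℂ →ₗ⁅ℂ⁆
    Module.End ℂ (ModelRing n i R) where
  toFun A := ((glDer A : Derivation ℂ (ModelRing n i R) (ModelRing n i R)) :
    ModelRing n i R →ₗ[ℂ] ModelRing n i R)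
  map_add' A B := by
    rw [← Derivation.coe_add_linearMap]
    congr 1
    refine derivation_ext fun x => ?_
    rw [Derivation.add_apply]
    simp only [glDer_X, Matrix.add_apply, add_smul, Finset.sum_add_distrib]
  map_smul' a A := by
    rw [RingHom.id_apply, ← Derivation.coe_smul_linearMap]
    congr 1
    refine derivation_ext fun x => ?_
    rw [Derivation.smul_apply]
    simp only [glDer_X, Matrix.smul_apply, smul_assoc, Finset.smul_sum]
  map_lie' {A B} := by
    have h : glDer ⁅A, B⁆ = ⁅glDer (n := n) (i := i) (R := R) A, glDer (n := n) (i := i) (R := R) B⁆ := by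
      refine derivation_ext fun x => ?_
      rw [Derivation.commutator_apply]
      have key : ∀ A B : Matrix (Fin (n + 1)) (Fin (n + 1)) ℂ,
          glDer A (glDer B (X x)) = ∑ c, (A * B) c x.1 • (X (c, x.2) : ModelRing n i R) := by
        intro A B
        simp only [glDer_X, map_sum, Derivation.map_smul, Matrix.mul_apply, Finset.sum_smul,
          Finset.smul_sum, smul_smul]
        rw [Finset.sum_comm]
        simp only [mul_comm]
      rw [key, key, glDer_X, LieRing.of_associative_ring_bracket]
      simp only [Matrix.sub_apply, sub_smul, Finset.sum_sub_distrib]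
    rw [h]
    ext1 f
    rfl

variable [Fintype R]

/-- The product of the minors with rows `f (r, ·)`, `r ∈ R`. -/
noncomputable def minorProd (f : R × Fin i → Fin (n + 1)) : ModelRing n i R :=
  ∏ r, (Matrix.of fun s t => (X (f (r, s), (r, t)) : ModelRing n i R)).det

/-- By Leibniz the action changes one row of one minor at a time, as on a tensor product over `R` of
exterior powers with wedge factors indexed by `f`. -/
theorem glRep_minorProd [DecidableEq R] (A : Matrix (Fin (n + 1)) (Fin (n + 1)) ℂ)
    (f : R × Fin i → Fin (n + 1)) :
    glRep n i R A (minorProd f) = ∑ k, ∑ c, A c (f k) • minorProd (Function.update f k c) := by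
  change glDer A (minorProd f) = _
  rw [minorProd, derivation_prod, Fintype.sum_prod_type]
  refine Finset.sum_congr rfl fun r _ => ?_
  rw [derivation_det]
  have hrow : ∀ s, ((Matrix.of fun s t => (X (f (r, s), (r, t)) : ModelRing n i R)).updateRow s
      fun t => glDer A ((Matrix.of fun s t => (X (f (r, s), (r, t)) : ModelRing n i R)) s t)).det =
      ∑ c, A c (f (r, s)) • (Matrix.of fun s' t =>
        (X (Function.update f (r, s) c (r, s'), (r, t)) : ModelRing n i R)).det := by
    intro s
    have h1 : (fun t => glDer A ((Matrix.of fun s t =>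
        (X (f (r, s), (r, t)) : ModelRing n i R)) s t)) =
        ∑ c, A c (f (r, s)) • fun t => (X (c, (r, t)) : ModelRing n i R) := by
      funext t
      rw [Matrix.of_apply, glDer_X, Finset.sum_apply]
      rfl
    rw [h1]
    change (Matrix.detRowAlternating.toMultilinearMap.toLinearMap
      (Matrix.of fun s t => (X (f (r, s), (r, t)) : ModelRing n i R)) s) _ = _
    rw [map_sum]
    refine Finset.sum_congr rfl fun c _ => ?_
    rw [LinearMap.map_smul_of_tower]
    congr 1
    change Matrix.det (Matrix.updateRow _ _ _) = _
    congr 1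
    ext s' t
    rw [Matrix.updateRow_apply]
    by_cases h : s' = s
    · subst h; simp
    · have : (r, s') ≠ (r, s) := fun h' => h (Prod.mk.inj h').2
      simp [h]
  simp_rw [hrow]
  rw [Finset.prod_update_of_mem (Finset.mem_univ r), Finset.sum_mul]
  refine Finset.sum_congr rfl fun s _ => ?_
  rw [Finset.sum_mul]
  refine Finset.sum_congr rfl fun c _ => ?_
  rw [smul_mul_assoc, minorProd, ← Finset.mul_prod_erase _ _ (Finset.mem_univ r),
    Finset.sdiff_singleton_eq_erase]
  congr 2
  refine Finset.prod_congr rfl fun r' hr' => ?_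
  congr 1
  ext s' t
  have : (r', s') ≠ (r, s) := fun h' => Finset.ne_of_mem_erase hr' (Prod.mk.inj h').1
  simp [Function.update_of_ne this]

theorem glRep_diagonal (a : Fin (n + 1) → ℂ) (f : R × Fin i → Fin (n + 1)) :
    glRep n i R (Matrix.diagonal a) (minorProd f) = (∑ k, a (f k)) • minorProd f := by
  classical
  rw [glRep_minorProd, Finset.sum_smul]
  refine Finset.sum_congr rfl fun k _ => ?_
  rw [Finset.sum_eq_single (f k)]
  · simp
  · intro c _ hc
    simp [Matrix.diagonal_apply_ne _ hc]
  · simp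

variable (n i R) in
/-- The span of the products of minors. -/
noncomputable def minorSpan : Submodule ℂ (ModelRing n i R) :=
  Submodule.span ℂ (Set.range minorProd)

theorem glRep_mem_minorSpan (A : Matrix (Fin (n + 1)) (Fin (n + 1)) ℂ) (x : ModelRing n i R)
    (hx : x ∈ minorSpan n i R) : glRep n i R A x ∈ minorSpan n i R := by
  classical
  refine (Submodule.span_le (p := (minorSpan n i R).comap (glRep n i R A))).2 ?_ hx
  rintro _ ⟨f, rfl⟩
  change glRep n i R A (minorProd f) ∈ minorSpan n i R
  rw [glRep_minorProd]
  exact Submodule.sum_mem _ fun k _ => Submodule.sum_mem _ fun c _ =>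
    Submodule.smul_mem _ _ (Submodule.subset_span ⟨_, rfl⟩)

/-- Strictly upper triangular matrices act nilpotently. -/
theorem glRep_pow_eq_zero (A : Matrix (Fin (n + 1)) (Fin (n + 1)) ℂ)
    (hA : ∀ a b, b ≤ a → A a b = 0) : ∃ N, ∀ x ∈ minorSpan n i R, (glRep n i R A ^ N) x = 0 := by
  classical
  -- Each application replaces a row index by a smaller one, so the sum of the row indices bounds
  -- the number of nonzero steps.
  have key : ∀ (N : ℕ) (f : R × Fin i → Fin (n + 1)), ∑ k, (f k : ℕ) < N →
      (glRep n i R A ^ N) (minorProd f) = 0 := by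
    intro N
    induction N with
    | zero => intro f hf; exact absurd hf (Nat.not_lt_zero _)
    | succ N ih =>
      intro f hf
      rw [pow_succ, Module.End.mul_apply, glRep_minorProd, map_sum]
      refine Finset.sum_eq_zero fun k _ => ?_
      rw [map_sum]
      refine Finset.sum_eq_zero fun c _ => ?_
      rw [map_smul]
      rcases le_or_gt (f k) c with h | h
      · rw [hA _ _ h, zero_smul]
      · rw [ih, smul_zero]
        refine lt_of_lt_of_le ?_ (Nat.lt_succ_iff.1 hf)
        refine Finset.sum_lt_sum (fun j _ => ?_) ⟨k, Finset.mem_univ k, ?_⟩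
        · rcases eq_or_ne j k with rfl | hj
          · simpa using h.le
          · simp [Function.update_of_ne hj]
        · simpa using h
  refine ⟨Fintype.card (R × Fin i) * (n + 1) + 1, fun x hx => ?_⟩
  refine (Submodule.span_le (p := LinearMap.ker (glRep n i R A ^ _))).2 ?_ hx
  rintro _ ⟨f, rfl⟩
  refine key _ f (Nat.lt_succ_iff.2 ?_)
  refine (Finset.sum_le_card_nsmul _ _ (n + 1) fun k _ => (f k).2.le).trans ?_
  simp

/-- A matrix of rank one sends every row of a minor to a multiple of one common row, and
orthogonality of `s` and `t` kills that row. So the square of the action kills each minor. This is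
the source of all chain inequalities. -/
theorem glRep_vecMulVec_pow (s t : Fin (n + 1) → ℂ) (hst : ∑ c, t c * s c = 0)
    (x : ModelRing n i R) (hx : x ∈ minorSpan n i R) :
    (glRep n i R (Matrix.vecMulVec s t) ^ (Fintype.card R + 1)) x = 0 := by
  refine (Submodule.span_le (p := LinearMap.ker (glRep n i R (Matrix.vecMulVec s t) ^ _))).2 ?_ hx
  rintro _ ⟨f, rfl⟩
  refine derivation_pow_prod (glDer (Matrix.vecMulVec s t)) Finset.univ _ fun r => ?_
  have hX : ∀ (d : Fin (n + 1)) (k : R × Fin i), glDer (Matrix.vecMulVec s t) (X (d, k)) =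
      t d • ∑ c, s c • (X (c, k) : ModelRing n i R) := by
    intro d k
    rw [glDer_X, Finset.smul_sum]
    refine Finset.sum_congr rfl fun c _ => ?_
    rw [Matrix.vecMulVec_apply, smul_smul, mul_comm]
  refine derivation_derivation_det _ _ (fun a => t (f (r, a)))
    (fun b => ∑ c, s c • (X (c, (r, b)) : ModelRing n i R)) (fun a b => hX _ _) fun b => ?_
  rw [map_sum]
  simp only [Derivation.map_smul, hX, smul_smul]
  rw [← Finset.sum_smul]
  simp only [mul_comm (s _), hst, zero_smul]

/-- Rows drawn from `g` either permute its indices, which costs a sign, or repeat one, which makes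
the minor vanish. -/
theorem minorProd_mem_span_of_range {g : Fin i → Fin (n + 1)}
    (f : R × Fin i → Fin (n + 1)) (hf : ∀ k, f k ∈ Set.range g) :
    minorProd f ∈ Submodule.span ℂ {(minorProd fun k => g k.2 : ModelRing n i R)} := by
  choose σ hσ using hf
  have key : ∀ r, ∃ c : ℂ, (Matrix.of fun s t => (X (f (r, s), (r, t)) : ModelRing n i R)).det =
      c • (Matrix.of fun s t => (X (g s, (r, t)) : ModelRing n i R)).det := by
    intro r
    by_cases hinj : Function.Injective fun s => σ (r, s)
    · let τ : Equiv.Perm (Fin i) := Equiv.ofBijective _ (Finite.injective_iff_bijective.1 hinj)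
      refine ⟨(Equiv.Perm.sign τ : ℤ), ?_⟩
      have h := Matrix.det_permute τ (Matrix.of fun s t => (X (g s, (r, t)) : ModelRing n i R))
      rw [Int.cast_smul_eq_zsmul, zsmul_eq_mul, ← h]
      congr 1
      ext s t
      simp [τ, hσ]
    · refine ⟨0, ?_⟩
      rw [zero_smul]
      simp only [Function.Injective, not_forall] at hinj
      obtain ⟨s, s', h, hne⟩ := hinj
      refine Matrix.det_zero_of_row_eq hne ?_
      funext t
      simp only [Matrix.of_apply]
      rw [← hσ (r, s), ← hσ (r, s'), h]
  choose c hc using key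
  rw [Submodule.mem_span_singleton]
  refine ⟨∏ r, c r, ?_⟩
  rw [minorProd, minorProd, ← Finset.prod_smul]
  exact (Finset.prod_congr rfl fun r _ => hc r).symm

theorem aeval_apply_of_eigen {M : Type*} [AddCommGroup M] [Module ℂ M] (f : Module.End ℂ M)
    (μ : ℂ) (x : M) (h : f x = μ • x) (Q : Polynomial ℂ) :
    Polynomial.aeval f Q x = Q.eval μ • x := by
  induction Q using Polynomial.induction_on' with
  | add p q hp hq => simp [hp, hq, add_smul]
  | monomial k a =>
    have hk : (f ^ k) x = μ ^ k • x := by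
      induction k with
      | zero => simp
      | succ k ih => rw [pow_succ', Module.End.mul_apply, ih, map_smul, h, smul_smul, pow_succ]
    simp [Polynomial.aeval_monomial, hk, smul_smul, mul_comm]

theorem apply_aeval_of_eigen {M : Type*} [AddCommGroup M] [Module ℂ M] (f : Module.End ℂ M)
    (μ : ℂ) (ξ : M →ₗ[ℂ] ℂ) (h : ∀ x, ξ (f x) = μ * ξ x) (Q : Polynomial ℂ) (x : M) :
    ξ (Polynomial.aeval f Q x) = Q.eval μ * ξ x := by
  induction Q using Polynomial.induction_on' with
  | add p q hp hq => simp [hp, hq, add_mul]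
  | monomial k a =>
    have hk : ξ ((f ^ k) x) = μ ^ k * ξ x := by
      induction k with
      | zero => simp
      | succ k ih => rw [pow_succ', Module.End.mul_apply, h, ih, pow_succ]; ring
    simp [Polynomial.aeval_monomial, hk, mul_assoc]

theorem aeval_mem_of_stable {M : Type*} [AddCommGroup M] [Module ℂ M] (f : Module.End ℂ M)
    (K : Submodule ℂ M) (h : ∀ x ∈ K, f x ∈ K) (Q : Polynomial ℂ) (x : M) (hx : x ∈ K) :
    Polynomial.aeval f Q x ∈ K := by
  induction Q using Polynomial.induction_on' with
  | add p q hp hq => rw [map_add]; exact K.add_mem hp hq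
  | monomial k a =>
    have hk : (f ^ k) x ∈ K := by
      induction k with
      | zero => simpa using hx
      | succ k ih => rw [pow_succ', Module.End.mul_apply]; exact h _ ih
    rw [Polynomial.aeval_monomial, Module.End.mul_apply, Module.algebraMap_end_apply]
    exact K.smul_mem _ hk

open Classical in
/-- The diagonal matrix that is the indicator of the range of `g`. -/
noncomputable def rangeDiag (g : Fin i → Fin (n + 1)) : Matrix (Fin (n + 1)) (Fin (n + 1)) ℂ :=
  Matrix.diagonal fun c => if c ∈ Set.range g then 1 else 0

theorem glRep_rangeDiag_self (g : Fin i → Fin (n + 1)) :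
    glRep n i R (rangeDiag g) (minorProd fun k => g k.2) =
      ((Fintype.card (R × Fin i) : ℕ) : ℂ) • (minorProd fun k => g k.2 : ModelRing n i R) := by
  rw [rangeDiag, glRep_diagonal]
  simp

variable (R) in
/-- A polynomial in `rangeDiag g` projects to the line of the extremal vector. -/
theorem exists_projector (g : Fin i → Fin (n + 1)) :
    ∃ Q : Polynomial ℂ, Q.eval ((Fintype.card (R × Fin i) : ℕ) : ℂ) ≠ 0 ∧
      ∀ x ∈ minorSpan n i R, Polynomial.aeval (glRep n i R (rangeDiag g)) Q x ∈
        Submodule.span ℂ {(minorProd fun k => g k.2 : ModelRing n i R)} := by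
  classical
  -- The eigenvalue of `rangeDiag g` on a product of minors counts the rows that lie in the range of
  -- `g`. The polynomial vanishes at every count below the maximum, which is attained only if all
  -- rows lie there.
  refine ⟨∏ j ∈ Finset.range (Fintype.card (R × Fin i)), (Polynomial.X - Polynomial.C (j : ℂ)),
    ?_, fun x hx => ?_⟩
  · rw [Polynomial.eval_prod, Finset.prod_ne_zero_iff]
    intro j hj
    rw [Polynomial.eval_sub, Polynomial.eval_X, Polynomial.eval_C, sub_ne_zero]
    exact_mod_cast (Finset.mem_range.1 hj).ne'
  · refine (Submodule.span_le (p := (Submodule.span ℂ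
      {(minorProd fun k => g k.2 : ModelRing n i R)}).comap
      (Polynomial.aeval (glRep n i R (rangeDiag g)) _))).2 ?_ hx
    rintro _ ⟨f, rfl⟩
    change Polynomial.aeval (glRep n i R (rangeDiag g)) _ (minorProd f) ∈ Submodule.span ℂ _
    have heig := glRep_diagonal (fun c => if c ∈ Set.range g then (1 : ℂ) else 0) f
    rw [Finset.sum_boole, ← rangeDiag] at heig
    rw [aeval_apply_of_eigen _ _ _ heig]
    by_cases hf : ∀ k, f k ∈ Set.range g
    · exact Submodule.smul_mem _ _ (minorProd_mem_span_of_range f hf)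
    · have hlt : (Finset.univ.filter fun k => f k ∈ Set.range g).card < Fintype.card (R × Fin i) := by
        push Not at hf
        obtain ⟨k, hk⟩ := hf
        exact Finset.card_lt_card ((Finset.ssubset_univ_iff).2 fun h => by
          have := Finset.mem_univ k
          rw [← h] at this
          exact hk (Finset.mem_filter.1 this).2)
      rw [Polynomial.eval_prod, Finset.prod_eq_zero (Finset.mem_range.2 hlt) (by simp), zero_smul]
      exact Submodule.zero_mem _

theorem mem_span_of_extremal (g : Fin i → Fin (n + 1)) (x : ModelRing n i R)
    (hx : x ∈ minorSpan n i R)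
    (h : glRep n i R (rangeDiag g) x = ((Fintype.card (R × Fin i) : ℕ) : ℂ) • x) :
    x ∈ Submodule.span ℂ {(minorProd fun k => g k.2 : ModelRing n i R)} := by
  obtain ⟨Q, hQ, hQx⟩ := exists_projector R g
  have := hQx x hx
  rw [aeval_apply_of_eigen _ _ _ h] at this
  exact (Submodule.smul_mem_iff _ hQ).1 this

/-- The projector maps `K` into its intersection with the extremal line, which is zero, while it
only rescales `ξ` by a nonzero number. -/
theorem functional_eq_zero_of_stable (g : Fin i → Fin (n + 1)) (K : Submodule ℂ (ModelRing n i R))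
    (hK : K ≤ minorSpan n i R) (hstab : ∀ x ∈ K, glRep n i R (rangeDiag g) x ∈ K)
    (hg : (minorProd fun k => g k.2) ∉ K) (ξ : ModelRing n i R →ₗ[ℂ] ℂ)
    (hξ : ∀ x, ξ (glRep n i R (rangeDiag g) x) = ((Fintype.card (R × Fin i) : ℕ) : ℂ) * ξ x)
    (x : ModelRing n i R) (hx : x ∈ K) : ξ x = 0 := by
  obtain ⟨Q, hQ, hQx⟩ := exists_projector R g
  obtain ⟨c, hc⟩ := Submodule.mem_span_singleton.1 (hQx x (hK hx))
  have hmem := aeval_mem_of_stable _ K hstab Q x hx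
  rw [← hc] at hmem
  have hc0 : c = 0 := by
    by_contra h
    exact hg ((Submodule.smul_mem_iff _ h).1 hmem)
  have h := apply_aeval_of_eigen _ _ ξ hξ Q x
  rw [← hc, hc0, zero_smul, map_zero] at h
  exact (mul_eq_zero.1 h.symm).resolve_left hQ

end Model

/-! ### The Fischer inner product and its contravariance. -/

section FischerForm

open MvPolynomial

variable {σ : Type*} [Fintype σ]

/-- The factorial of an exponent. -/
def expFactorial (α : σ →₀ ℕ) : ℕ := ∏ x, (α x).factorial

/-- The Fischer inner product on polynomials, semilinear in the first argument. -/
noncomputable def fischer :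
    MvPolynomial σ ℂ →ₛₗ[starRingEnd ℂ] MvPolynomial σ ℂ →ₗ[ℂ] ℂ where
  toFun g := (MvPolynomial.basisMonomials σ ℂ).constr ℂ fun α =>
    (expFactorial α : ℂ) * (starRingEnd ℂ) (coeff α g)
  map_add' g g' := by
    refine (MvPolynomial.basisMonomials σ ℂ).ext fun α => ?_
    rw [LinearMap.add_apply]
    simp only [Module.Basis.constr_basis, coeff_add, map_add, mul_add]
  map_smul' c g := by
    refine (MvPolynomial.basisMonomials σ ℂ).ext fun α => ?_
    rw [LinearMap.smul_apply]
    simp only [Module.Basis.constr_basis, coeff_smul, smul_eq_mul, map_mul]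
    ring

theorem fischer_monomial (g : MvPolynomial σ ℂ) (α : σ →₀ ℕ) (a : ℂ) :
    fischer g (monomial α a) = a * ((expFactorial α : ℂ) * (starRingEnd ℂ) (coeff α g)) := by
  have h : (monomial α a : MvPolynomial σ ℂ) = a • MvPolynomial.basisMonomials σ ℂ α := by
    simp [smul_monomial]
  rw [h, map_smul, smul_eq_mul]
  congr 1
  exact (MvPolynomial.basisMonomials σ ℂ).constr_basis ℂ _ _

theorem expFactorial_add_single (α : σ →₀ ℕ) (x : σ) :
    expFactorial (α + Finsupp.single x 1) = (α x + 1) * expFactorial α := by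
  classical
  rw [expFactorial, expFactorial, ← Finset.mul_prod_erase _ _ (Finset.mem_univ x),
    ← Finset.mul_prod_erase _ (fun y => (α y).factorial) (Finset.mem_univ x), ← mul_assoc]
  congr 1
  · simp [Nat.factorial_succ]
  · refine Finset.prod_congr rfl fun y hy => ?_
    simp [Finset.ne_of_mem_erase hy]

/-- The factorial weights are chosen so that multiplication by a variable is adjoint to
differentiation. -/
theorem fischer_X_mul (g f : MvPolynomial σ ℂ) (x : σ) :
    fischer g (X x * f) = fischer (pderiv x g) f := by
  induction f using MvPolynomial.induction_on' with
  | add p q hp hq => rw [mul_add, map_add, map_add, hp, hq]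
  | monomial α a =>
    rw [X, monomial_mul, one_mul, fischer_monomial, fischer_monomial, coeff_pderiv, add_comm,
      expFactorial_add_single, map_mul]
    simp only [map_add, map_natCast, map_one, Nat.cast_mul, Nat.cast_add, Nat.cast_one]
    ring

theorem fischer_pderiv (g f : MvPolynomial σ ℂ) (x : σ) :
    fischer g (pderiv x f) = fischer (X x * g) f := by
  classical
  induction f using MvPolynomial.induction_on' with
  | add p q hp hq => rw [map_add, map_add, map_add, hp, hq]
  | monomial α a =>
    rw [pderiv_monomial, fischer_monomial, fischer_monomial, coeff_X_mul']
    by_cases hx : α x = 0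
    · simp [hx]
    · obtain ⟨γ, rfl⟩ : ∃ γ : σ →₀ ℕ, α = γ + Finsupp.single x 1 := by
        refine ⟨α - Finsupp.single x 1, ?_⟩
        rw [tsub_add_cancel_of_le]
        rw [Finsupp.single_le_iff]
        omega
      rw [if_pos (by simp), add_tsub_cancel_right, expFactorial_add_single]
      simp
      ring

theorem eq_zero_of_fischer_self (g : MvPolynomial σ ℂ) (h : fischer g g = 0) : g = 0 := by
  classical
  have h1 : fischer g g = ∑ α ∈ g.support, ((expFactorial α : ℝ) * Complex.normSq (coeff α g) : ℝ) := by
    conv_lhs => enter [2]; rw [g.as_sum]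
    rw [map_sum]
    push_cast
    refine Finset.sum_congr rfl fun α _ => ?_
    rw [fischer_monomial, ← Complex.mul_conj]
    ring
  rw [h1] at h
  have h2 : ∑ α ∈ g.support, (expFactorial α : ℝ) * Complex.normSq (coeff α g) = 0 := by
    exact_mod_cast h
  rw [Finset.sum_eq_zero_iff_of_nonneg fun α _ =>
    mul_nonneg (Nat.cast_nonneg _) (Complex.normSq_nonneg _)] at h2
  ext α
  by_contra hα
  rcases mul_eq_zero.1 (h2 α (mem_support_iff.2 hα)) with h3 | h3
  · have : expFactorial α ≠ 0 := Finset.prod_ne_zero_iff.2 fun x _ => Nat.factorial_ne_zero _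
    exact this (by exact_mod_cast h3)
  · exact hα (Complex.normSq_eq_zero.1 h3)

end FischerForm

section Contravariance

open MvPolynomial

variable {n i : ℕ} {R : Type*} [Fintype R]

theorem derivation_sum_apply {ι A : Type*} [CommRing A] [Algebra ℂ A] (s : Finset ι)
    (D : ι → Derivation ℂ A A) (f : A) : (∑ j ∈ s, D j) f = ∑ j ∈ s, D j f :=
  (congrFun (map_sum Derivation.coeFnAddMonoidHom D s) f).trans (Finset.sum_apply _ _ _)

theorem glDer_eq_sum (A : Matrix (Fin (n + 1)) (Fin (n + 1)) ℂ) (f : ModelRing n i R) :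
    glDer A f = ∑ k, ∑ d, ∑ c, A c d • (X (c, k) * pderiv (d, k) f) := by
  classical
  have h : glDer A = ∑ k, ∑ d, ∑ c, A c d •
      ((X (c, k) : ModelRing n i R) • (pderiv (d, k) : Derivation ℂ (ModelRing n i R) _)) := by
    refine derivation_ext fun x => ?_
    simp only [derivation_sum_apply, Derivation.smul_apply, smul_eq_mul]
    rw [glDer_X, Fintype.sum_eq_single x.2 fun k hk => Finset.sum_eq_zero fun d _ =>
      Finset.sum_eq_zero fun c _ => ?_]
    · symm
      refine (Fintype.sum_eq_single x.1 fun d hd => Finset.sum_eq_zero fun c _ => ?_).trans ?_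
      · rw [pderiv_X_of_ne, mul_zero, smul_zero]
        exact fun h => hd (congrArg Prod.fst h).symm
      · simp
    · rw [pderiv_X_of_ne, mul_zero, smul_zero]
      rintro rfl
      exact hk rfl
  rw [h]
  simp only [derivation_sum_apply, Derivation.smul_apply, smul_eq_mul]

/-- The action is a sum of operators `A c d • X_c ∂_d`, and the adjoint of `X_c ∂_d` is `X_d ∂_c`.
-/
theorem fischer_glRep (A : Matrix (Fin (n + 1)) (Fin (n + 1)) ℂ) (g f : ModelRing n i R) :
    fischer g (glRep n i R A f) = fischer (glRep n i R A.conjTranspose g) f := by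
  change fischer g (glDer A f) = fischer (glDer A.conjTranspose g) f
  rw [glDer_eq_sum, glDer_eq_sum]
  simp only [map_sum, LinearMap.sum_apply, map_smul, LinearMap.map_smulₛₗ, LinearMap.smul_apply,
    fischer_X_mul, fischer_pderiv, Matrix.conjTranspose_apply]
  refine Finset.sum_congr rfl fun k _ => ?_
  rw [Finset.sum_comm]
  simp

end Contravariance

/-! ### Extremal vectors. -/

section Extremal

open MvPolynomial

variable {n i : ℕ} {R : Type*} [Fintype R]

theorem minorProd_eq_zero (f : R × Fin i → Fin (n + 1)) (r : R) {s s' : Fin i} (hne : s ≠ s')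
    (h : f (r, s) = f (r, s')) : (minorProd f : ModelRing n i R) = 0 := by
  refine Finset.prod_eq_zero (Finset.mem_univ r) (Matrix.det_zero_of_row_eq hne ?_)
  funext t
  simp [h]

variable (R) in
/-- The extremal vector attached to a sequence of rows. -/
noncomputable def extremalVec (g : Fin i → Fin (n + 1)) : ModelRing n i R :=
  minorProd fun k => g k.2

/-- Every contributing entry replaces a row by another row already present, so the minor acquires
two equal rows. -/
theorem glRep_extremalVec_eq_zero (g : Fin i → Fin (n + 1))
    (A : Matrix (Fin (n + 1)) (Fin (n + 1)) ℂ)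
    (h : ∀ c s, A c (g s) ≠ 0 → c ∈ Set.range g ∧ c ≠ g s) :
    glRep n i R A (extremalVec R g) = 0 := by
  classical
  rw [extremalVec, glRep_minorProd]
  refine Finset.sum_eq_zero fun k _ => Finset.sum_eq_zero fun c _ => ?_
  by_cases hA : A c (g k.2) = 0
  · rw [hA, zero_smul]
  · obtain ⟨⟨s, rfl⟩, hne⟩ := h c k.2 hA
    have hs : k.2 ≠ s := fun h => hne (by rw [h])
    rw [minorProd_eq_zero _ k.1 hs, smul_zero]
    have : (k.1, s) ≠ k := fun h => hs (congrArg Prod.snd h).symm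
    simp [Function.update_of_ne this]

theorem extremalVec_ne_zero {g : Fin i → Fin (n + 1)} (hg : Function.Injective g) :
    extremalVec R g ≠ 0 := by
  intro h
  -- At this point each of the minors has the identity as its matrix.
  have h2 := congrArg (aeval fun x : Fin (n + 1) × (R × Fin i) =>
    if x.1 = g x.2.2 then (1 : ℂ) else 0) h
  rw [extremalVec, minorProd, map_prod, map_zero] at h2
  refine (Finset.prod_ne_zero_iff.2 fun r _ => ?_) h2
  rw [AlgHom.map_det]
  have : (aeval fun x : Fin (n + 1) × (R × Fin i) => if x.1 = g x.2.2 then (1 : ℂ) else 0).mapMatrix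
      (Matrix.of fun s t => (X (g s, (r, t)) : ModelRing n i R)) = 1 := by
    ext s t
    simp [Matrix.one_apply, hg.eq_iff]
  simp only [this, Matrix.det_one]
  exact one_ne_zero

theorem glRep_one (x : ModelRing n i R) (hx : x ∈ minorSpan n i R) :
    glRep n i R 1 x = ((Fintype.card (R × Fin i) : ℕ) : ℂ) • x := by
  refine (Submodule.span_le (p := LinearMap.ker (glRep n i R 1 -
    ((Fintype.card (R × Fin i) : ℕ) : ℂ) • (1 : Module.End ℂ (ModelRing n i R))))).2 ?_ hx
      |> fun h => by simpa [sub_eq_zero] using h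
  rintro _ ⟨f, rfl⟩
  have := glRep_diagonal (fun _ => (1 : ℂ)) f
  rw [Matrix.diagonal_one] at this
  simp only [SetLike.mem_coe, LinearMap.mem_ker, LinearMap.sub_apply, this]
  simp

/-- The diagonal matrices used as projectors are not traceless in general. The identity acts by a
scalar on `minorSpan`, so this splitting lets them be applied to `sl`-stable subspaces. -/
theorem exists_eq_sl_add_smul_one (A : Matrix (Fin (n + 1)) (Fin (n + 1)) ℂ) :
    ∃ (D : slLie n) (τ : ℂ), A = D.1 + τ • 1 := by
  refine ⟨⟨A - (A.trace / (n + 1 : ℕ)) • 1, ?_⟩, A.trace / (n + 1 : ℕ), by simp⟩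
  refine LinearMap.mem_ker.2 ?_
  have : ((n : ℂ) + 1) ≠ 0 := by exact_mod_cast Nat.succ_ne_zero n
  simp [Matrix.trace_sub, Matrix.trace_smul, Matrix.trace_one, this]

end Extremal

/-! ### Generated subspaces and the triangular decomposition. -/

section StableSpan

variable {L : Type*} [LieRing L] [LieAlgebra ℂ L]
variable {M : Type*} [AddCommGroup M] [Module ℂ M]

/-- The smallest subspace containing `g` and stable under the elements of `N`. -/
def stableSpan (ρ : L →ₗ⁅ℂ⁆ Module.End ℂ M) (N : Set L) (g : M) : Submodule ℂ M :=
  sInf {S | g ∈ S ∧ ∀ f ∈ N, ∀ w ∈ S, ρ f w ∈ S}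

theorem stableSpan_le {ρ : L →ₗ⁅ℂ⁆ Module.End ℂ M} {N : Set L} {g : M} {S : Submodule ℂ M}
    (hg : g ∈ S) (hS : ∀ f ∈ N, ∀ w ∈ S, ρ f w ∈ S) : stableSpan ρ N g ≤ S :=
  sInf_le ⟨hg, hS⟩

theorem self_mem_stableSpan (ρ : L →ₗ⁅ℂ⁆ Module.End ℂ M) (N : Set L) (g : M) :
    g ∈ stableSpan ρ N g :=
  Submodule.mem_sInf.2 fun _ hS => hS.1

theorem apply_mem_stableSpan (ρ : L →ₗ⁅ℂ⁆ Module.End ℂ M) (N : Set L) (g : M) {f : L} (hf : f ∈ N)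
    {w : M} (hw : w ∈ stableSpan ρ N g) : ρ f w ∈ stableSpan ρ N g :=
  Submodule.mem_sInf.2 fun S hS => hS.2 f hf w (Submodule.mem_sInf.1 hw S hS)

/-- Stability under all of `L` need only be tested on the generator: moving `y` past `f` leaves a
bracket, again an element of `L`, applied to a vector already treated. -/
theorem stableSpan_stable (ρ : L →ₗ⁅ℂ⁆ Module.End ℂ M) (N : Set L) (g : M)
    (h : ∀ y, ρ y g ∈ stableSpan ρ N g) (y : L) (w : M) (hw : w ∈ stableSpan ρ N g) :
    ρ y w ∈ stableSpan ρ N g := by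
  let T : Submodule ℂ M :=
    { carrier := {w | w ∈ stableSpan ρ N g ∧ ∀ y, ρ y w ∈ stableSpan ρ N g}
      zero_mem' := ⟨Submodule.zero_mem _, fun y => by rw [map_zero]; exact Submodule.zero_mem _⟩
      add_mem' := fun {a b} ha hb => ⟨Submodule.add_mem _ ha.1 hb.1, fun y => by
        rw [map_add]; exact Submodule.add_mem _ (ha.2 y) (hb.2 y)⟩
      smul_mem' := fun c a ha => ⟨Submodule.smul_mem _ c ha.1, fun y => by
        rw [map_smul]; exact Submodule.smul_mem _ c (ha.2 y)⟩ }
  refine (stableSpan_le (S := T) ⟨self_mem_stableSpan ρ N g, h⟩ fun f hf w hw => ?_) hw |>.2 y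
  refine ⟨apply_mem_stableSpan ρ N g hf hw.1, fun y => ?_⟩
  have : ρ y (ρ f w) = ρ f (ρ y w) + ρ ⁅y, f⁆ w := by
    rw [LieHom.map_lie, LieRing.of_associative_ring_bracket]
    simp
  rw [this]
  exact Submodule.add_mem _ (apply_mem_stableSpan ρ N g hf (hw.2 y)) (hw.2 _)

end StableSpan

section Triangular

open LieAlgebra.SpecialLinear

variable {n : ℕ}

/-- The strictly lower triangular part. -/
noncomputable def lowerPart (y : slLie n) : slLie n :=
  ∑ p : Fin (n + 1) × Fin (n + 1), if h : p.2 < p.1 then y.1 p.1 p.2 • single p.1 p.2 h.ne' 1 else 0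

theorem lowerPart_apply (y : slLie n) (a b : Fin (n + 1)) :
    (lowerPart y).1 a b = if b < a then y.1 a b else 0 := by
  have h1 : (lowerPart y).1 = ∑ p : Fin (n + 1) × Fin (n + 1),
      if p.2 < p.1 then Matrix.single p.1 p.2 (y.1 p.1 p.2) else 0 := by
    rw [lowerPart]
    change (slLie n).toSubmodule.subtype _ = _
    rw [map_sum]
    refine Finset.sum_congr rfl fun p _ => ?_
    split_ifs with h
    · change ((y.1 p.1 p.2 • single p.1 p.2 h.ne' (1 : ℂ) : slLie n)).1 = _
      change y.1 p.1 p.2 • (single p.1 p.2 h.ne' (1 : ℂ)).1 = _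
      simp [Matrix.smul_single]
    · rfl
  rw [h1, Matrix.sum_apply, Finset.sum_eq_single (a, b)]
  · split_ifs with h
    · simp
    · rfl
  · rintro ⟨c, d⟩ _ hne
    split_ifs
    · rw [Matrix.single_apply, if_neg]
      rintro ⟨rfl, rfl⟩
      exact hne rfl
    · rfl
  · simp

/-- The diagonal part. -/
noncomputable def diagPart (y : slLie n) : slLie n :=
  ⟨Matrix.diagonal y.1.diag, LinearMap.mem_ker.2 (by
    have h : y.1.trace = 0 := LinearMap.mem_ker.1 y.2
    simpa [Matrix.trace] using h)⟩

theorem sub_lower_sub_diag_mem (y : slLie n) : y - lowerPart y - diagPart y ∈ nilPlus n := by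
  intro a b hab
  change y.1 a b - (lowerPart y).1 a b - (diagPart y).1 a b = 0
  rw [lowerPart_apply]
  rcases hab.lt_or_eq with h | rfl
  · have : (diagPart y).1 a b = 0 := Matrix.diagonal_apply_ne _ h.ne'
    simp [h, this]
  · have : (diagPart y).1 b b = y.1 b b := Matrix.diagonal_apply_eq _ _
    simp [this]

theorem eq_triangular (y : slLie n) :
    y = lowerPart y + (diagPart y + (y - lowerPart y - diagPart y)) := by abel

end Triangular

/-! ### Embedding the simple module into the model. -/

section Embedding

open LieAlgebra.SpecialLinear

variable {n : ℕ} {V : Type*} [AddCommGroup V] [Module ℂ V]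
  [LieRingModule (slLie n) V] [LieModule ℂ (slLie n) V]

/-- The inclusion of the first `i` indices followed by a permutation. -/
def firstRows {n i : ℕ} (hin : i ≤ n) (u : Equiv.Perm (Fin (n + 1))) (s : Fin i) : Fin (n + 1) :=
  u (Fin.castLE (hin.trans (Nat.le_succ n)) s)

theorem firstRows_injective {n i : ℕ} (hin : i ≤ n) (u : Equiv.Perm (Fin (n + 1))) :
    Function.Injective (firstRows hin u) :=
  u.injective.comp (Fin.castLE_injective _)

theorem mem_range_firstRows {n i : ℕ} (hin : i ≤ n) (u : Equiv.Perm (Fin (n + 1)))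
    (a : Fin (n + 1)) : a ∈ Set.range (firstRows hin u) ↔ (u⁻¹ a).val < i := by
  constructor
  · rintro ⟨s, rfl⟩
    simp [firstRows]
  · intro h
    exact ⟨⟨(u⁻¹ a).val, h⟩, by simp [firstRows]⟩

theorem sum_weylAct {n i : ℕ} (m : ℕ) (hin : i ≤ n) (u : Equiv.Perm (Fin (n + 1)))
    (a : Fin (n + 1) → ℂ) :
    ∑ c, ((weylAct u (m • fundWeight n i) c : ℤ) : ℂ) * a c =
      ∑ k : Fin m × Fin i, a (firstRows hin u k.2) := by
  rw [Fintype.sum_prod_type]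
  change _ = ∑ _r : Fin m, ∑ s, a (firstRows hin u s)
  rw [Finset.sum_const, Finset.card_univ, Fintype.card_fin]
  have h : ∑ s, a (firstRows hin u s) = ∑ c, if (u⁻¹ c).val < i then a c else 0 := by
    refine Finset.sum_of_injOn _ (firstRows_injective hin u).injOn (by simp) (fun c _ hc => ?_)
      fun s _ => ?_
    · rw [if_neg]
      rw [← mem_range_firstRows hin u]
      simpa using hc
    · rw [if_pos]
      rw [← mem_range_firstRows hin u]
      exact ⟨s, rfl⟩
  rw [h, Finset.smul_sum]
  refine Finset.sum_congr rfl fun c _ => ?_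
  simp only [weylAct, Pi.smul_apply, fundWeight]
  split_ifs <;> simp

theorem glRep_extremalVec_diag {n i m : ℕ} (hin : i ≤ n) (u : Equiv.Perm (Fin (n + 1)))
    (A : Matrix (Fin (n + 1)) (Fin (n + 1)) ℂ) (hA : A.IsDiag) :
    glRep n i (Fin m) A (extremalVec (Fin m) (firstRows hin u)) =
      (∑ c, ((weylAct u (m • fundWeight n i) c : ℤ) : ℂ) * A c c) •
        extremalVec (Fin m) (firstRows hin u) := by
  rw [sum_weylAct m hin u fun c => A c c, ← hA.diagonal_diag, extremalVec, glRep_diagonal]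
  simp

variable (V) in
/-- The representation on the sum of `V` and the model. -/
noncomputable def pairRep (i : ℕ) (R : Type*) : slLie n →ₗ⁅ℂ⁆ Module.End ℂ (V × ModelRing n i R) where
  toFun y := LinearMap.prodMap (LieModule.toEnd ℂ (slLie n) V y) (glRep n i R y.1)
  map_add' x y := by
    refine LinearMap.ext fun p => Prod.ext ?_ ?_ <;> simp
  map_smul' c y := by
    refine LinearMap.ext fun p => Prod.ext ?_ ?_ <;> simp
  map_lie' {x y} := by
    have h : glRep n i R (⁅x, y⁆ : slLie n).1 = ⁅glRep n i R x.1, glRep n i R y.1⁆ := by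
      rw [← LieHom.map_lie]; rfl
    rw [h, LieHom.map_lie]
    simp only [LieRing.of_associative_ring_bracket]
    refine LinearMap.ext fun p => Prod.ext ?_ ?_ <;> simp

/-- The elementary matrices below the diagonal. -/
def lowerRoots (n : ℕ) : Set (slLie n) :=
  {f | ∃ (a b : Fin (n + 1)) (h : b < a), f = single a b h.ne' 1}

theorem lowerPart_apply_mem {M : Type*} [AddCommGroup M] [Module ℂ M]
    (ρ : slLie n →ₗ⁅ℂ⁆ Module.End ℂ M) (S : Submodule ℂ M) (w : M)
    (h : ∀ f ∈ lowerRoots n, ρ f w ∈ S) (y : slLie n) : ρ (lowerPart y) w ∈ S := by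
  rw [lowerPart, map_sum, LinearMap.sum_apply]
  refine Submodule.sum_mem _ fun p _ => ?_
  split_ifs with hp
  · rw [map_smul, LinearMap.smul_apply]
    exact Submodule.smul_mem _ _ (h _ ⟨_, _, hp, rfl⟩)
  · rw [map_zero]; exact Submodule.zero_mem _

theorem diag_bracket_single (h : slLie n) (hd : h.1.IsDiag) (a b : Fin (n + 1)) (hab : a ≠ b) :
    ⁅h, (single a b hab 1 : slLie n)⁆ = (h.1 a a - h.1 b b) • (single a b hab 1 : slLie n) := by
  apply Subtype.ext
  rw [sl_bracket]
  change h.1 * Matrix.single a b 1 - Matrix.single a b 1 * h.1 =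
    (h.1 a a - h.1 b b) • Matrix.single a b (1 : ℂ)
  rw [← hd.diagonal_diag]
  ext c d
  simp only [Matrix.sub_apply, Matrix.diagonal_mul, Matrix.mul_diagonal, Matrix.smul_apply,
    Matrix.diagonal_apply_eq, Matrix.diag_apply, smul_eq_mul, Matrix.single_apply]
  split_ifs with hcd
  · obtain ⟨rfl, rfl⟩ := hcd; ring
  · ring

/-- In the submodule generated by a highest weight vector, the highest weight space is a line. -/
theorem mem_span_of_mem_stableSpan {M : Type*} [AddCommGroup M] [Module ℂ M]
    (ρ : slLie n →ₗ⁅ℂ⁆ Module.End ℂ M) (g x : M) (h : slLie n) (hd : h.1.IsDiag)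
    (hh : ∀ a b : Fin (n + 1), b < a → ∃ l : ℕ, h.1 a a - h.1 b b = -((l : ℂ) + 1)) (μ : ℂ)
    (hg : ρ h g = μ • g) (hx : ρ h x = μ • x) (hmem : x ∈ stableSpan ρ (lowerRoots n) g) :
    x ∈ Submodule.span ℂ {g} := by
  -- Lower root vectors shift the eigenvalue of `h` by negative integers, so everything except the
  -- generating line lands in `Y`, which meets the `μ`-eigenspace trivially.
  let Y : Submodule ℂ M := ⨆ j : ℕ, Module.End.eigenspace (ρ h) (μ - ((j : ℂ) + 1))
  have step : ∀ (ν : ℂ) (w : M), ρ h w = ν • w → ∀ f ∈ lowerRoots n, ∃ l : ℕ,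
      ρ h (ρ f w) = (ν - ((l : ℂ) + 1)) • ρ f w := by
    rintro ν w hw f ⟨a, b, hab, rfl⟩
    obtain ⟨l, hl⟩ := hh a b hab
    refine ⟨l, ?_⟩
    have h1 : ρ h (ρ (single a b hab.ne' 1) w) =
        ρ (single a b hab.ne' 1) (ρ h w) + ρ ⁅h, (single a b hab.ne' 1 : slLie n)⁆ w := by
      rw [LieHom.map_lie, LieRing.of_associative_ring_bracket]
      simp
    rw [h1, diag_bracket_single h hd, hl, hw, map_smul, map_smul, LinearMap.smul_apply, ← add_smul]
    congr 1
  have hle : stableSpan ρ (lowerRoots n) g ≤ Submodule.span ℂ {g} ⊔ Y := by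
    refine stableSpan_le (Submodule.mem_sup_left (Submodule.mem_span_singleton_self g))
      fun f hf w hw => ?_
    suffices hY : ρ f w ∈ Y from Submodule.mem_sup_right hY
    refine (?_ : Submodule.span ℂ {g} ⊔ Y ≤ Y.comap (ρ f)) hw
    refine sup_le ?_ (iSup_le fun j w hw => ?_)
    · rw [Submodule.span_le, Set.singleton_subset_iff]
      obtain ⟨l, hl⟩ := step μ g hg f hf
      exact Submodule.mem_iSup_of_mem l (Module.End.mem_eigenspace_iff.2 hl)
    · obtain ⟨l, hl⟩ := step _ w (Module.End.mem_eigenspace_iff.1 hw) f hf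
      refine Submodule.mem_iSup_of_mem (j + l + 1) (Module.End.mem_eigenspace_iff.2 ?_)
      rw [hl]
      congr 1
      push_cast
      ring
  obtain ⟨p, hp, q, hq, hpq⟩ := Submodule.mem_sup.1 (hle hmem)
  obtain ⟨c, rfl⟩ := Submodule.mem_span_singleton.1 hp
  have hdisj := (Module.End.eigenspaces_iSupIndep (ρ h)) μ
  have hq1 : q ∈ Module.End.eigenspace (ρ h) μ := by
    rw [Module.End.mem_eigenspace_iff]
    have : q = x - c • g := by rw [← hpq]; abel
    rw [this, map_sub, map_smul, hx, hg, smul_sub, smul_comm]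
  have hq2 : q ∈ ⨆ ν, ⨆ (_ : ν ≠ μ), Module.End.eigenspace (ρ h) ν := by
    refine (iSup_le fun j => ?_ : Y ≤ _) hq
    refine le_iSup₂_of_le (μ - ((j : ℂ) + 1)) ?_ le_rfl
    intro h
    have h2 : ((j : ℂ) + 1) = 0 := by linear_combination -h
    exact Nat.cast_add_one_ne_zero j h2
  have hq0 : q = 0 := Submodule.disjoint_def.1 hdisj q hq1 hq2
  rw [← hpq, hq0, add_zero]
  exact hp

/-- A diagonal element of `𝔰𝔩` whose entries decrease by one. -/
theorem exists_regular (n : ℕ) : ∃ h : slLie n, h.1.IsDiag ∧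
    ∀ a b : Fin (n + 1), b < a → ∃ l : ℕ, h.1 a a - h.1 b b = -((l : ℂ) + 1) := by
  -- Removing the trace shifts all diagonal entries equally and leaves their differences unchanged.
  obtain ⟨D, τ, hD⟩ := exists_eq_sl_add_smul_one
    (Matrix.diagonal fun a : Fin (n + 1) => -((a : ℕ) : ℂ))
  have hD' : D.1 = Matrix.diagonal fun a : Fin (n + 1) => -((a : ℕ) : ℂ) - τ := by
    rw [← sub_eq_iff_eq_add] at hD
    rw [← hD, ← Matrix.diagonal_one, ← Matrix.diagonal_smul, Matrix.diagonal_sub]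
    congr 1
    funext a
    simp
  refine ⟨D, ?_, fun a b hab => ⟨a - b - 1, ?_⟩⟩
  · rw [hD']; exact Matrix.isDiag_diagonal _
  · rw [hD', Matrix.diagonal_apply_eq, Matrix.diagonal_apply_eq]
    have h1 : (a : ℕ) = (b : ℕ) + ((a - b - 1 : ℕ) + 1) := by
      have : (b : ℕ) < a := hab
      omega
    have h2 : ((a : ℕ) : ℂ) = (b : ℕ) + (((a - b - 1 : ℕ) : ℂ) + 1) := by exact_mod_cast h1
    rw [h2]
    ring

end Embedding

section Embedding

open LieAlgebra.SpecialLinear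

variable {n : ℕ} {V : Type*} [AddCommGroup V] [Module ℂ V]
  [LieRingModule (slLie n) V] [LieModule ℂ (slLie n) V]

theorem glRep_rangeDiag_mem {i : ℕ} {R : Type*} [Fintype R] (K : Submodule ℂ (ModelRing n i R))
    (hK : K ≤ minorSpan n i R) (hstab : ∀ (y : slLie n), ∀ x ∈ K, glRep n i R y.1 x ∈ K)
    (A : Matrix (Fin (n + 1)) (Fin (n + 1)) ℂ) (x : ModelRing n i R) (hx : x ∈ K) :
    glRep n i R A x ∈ K := by
  obtain ⟨D, τ, hD⟩ := exists_eq_sl_add_smul_one A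
  rw [hD, map_add, LinearMap.add_apply, map_smul, LinearMap.smul_apply, glRep_one x (hK hx)]
  exact K.add_mem (hstab D x hx) (K.smul_mem _ (K.smul_mem _ hx))

/-- A proper submodule of the module generated by the extremal vector is zero. -/
theorem submodule_eq_bot {i : ℕ} {R : Type*} [Fintype R] (g : Fin i → Fin (n + 1))
    (K T : Submodule ℂ (ModelRing n i R)) (hKT : K ≤ T)
    (hT : T ≤ stableSpan ((glRep n i R).comp (slLie n).incl) (lowerRoots n) (extremalVec R g))
    (hTS : T ≤ minorSpan n i R) (hstab : ∀ (y : slLie n), ∀ x ∈ K, glRep n i R y.1 x ∈ K)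
    (hg : extremalVec R g ∉ K) : K = ⊥ := by
  have hKS := hKT.trans hTS
  have hξ : ∀ x, fischer (extremalVec R g) (glRep n i R (rangeDiag g) x) =
      ((Fintype.card (R × Fin i) : ℕ) : ℂ) * fischer (extremalVec R g) x := by
    intro x
    have hself : (rangeDiag g).conjTranspose = rangeDiag g := by
      classical
      rw [rangeDiag, Matrix.diagonal_conjTranspose]
      congr 1
      funext c
      simp only [Pi.star_apply]
      split_ifs <;> simp
    rw [fischer_glRep, hself, extremalVec, glRep_rangeDiag_self, LinearMap.map_smulₛₗ,
      LinearMap.smul_apply, smul_eq_mul]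
    simp
  have hperp : ∀ x ∈ K, fischer (extremalVec R g) x = 0 := fun x hx =>
    functional_eq_zero_of_stable g K hKS
      (fun y hy => glRep_rangeDiag_mem K hKS hstab _ y hy) hg _ hξ x hx
  -- The orthogonal complement of `K` is stable by contravariance and contains the generator, hence
  -- contains the whole generated module and in particular `K`. A self-orthogonal `K` is zero by
  -- positivity.
  let Z : Submodule ℂ (ModelRing n i R) :=
    { carrier := {y | ∀ x ∈ K, fischer y x = 0}
      zero_mem' := fun x _ => by simp
      add_mem' := fun {a b} ha hb x hx => by simp [ha x hx, hb x hx]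
      smul_mem' := fun c a ha x hx => by
        rw [LinearMap.map_smulₛₗ, LinearMap.smul_apply, ha x hx, smul_zero] }
  have hZ : stableSpan ((glRep n i R).comp (slLie n).incl) (lowerRoots n) (extremalVec R g) ≤ Z := by
    refine stableSpan_le hperp fun f _ w hw x hx => ?_
    have := fischer_glRep f.1.conjTranspose w x
    rw [Matrix.conjTranspose_conjTranspose] at this
    exact this.symm.trans (hw _ (glRep_rangeDiag_mem K hKS hstab _ x hx))
  rw [Submodule.eq_bot_iff]
  intro x hx
  exact eq_zero_of_fischer_self x (hZ (hT (hKT hx)) x hx)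

/-- The submodule of `V ⊕ ModelRing` generated by the pair of highest weight vectors. -/
theorem exists_graph {i m : ℕ} (hin : i ≤ n) (v₀ : V)
    (hv₀ : IsWeightVector (m • fundWeight n i) v₀)
    (hkill : ∀ x : slLie n, x ∈ nilPlus n → ⁅x, v₀⁆ = 0) :
    ∃ T : Submodule ℂ (V × ModelRing n i (Fin m)),
      (∀ (y : slLie n) (p : V × ModelRing n i (Fin m)), p ∈ T →
        (⁅y, p.1⁆, glRep n i (Fin m) y.1 p.2) ∈ T) ∧
      (v₀, extremalVec (Fin m) (firstRows hin 1)) ∈ T ∧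
      ((0 : V), extremalVec (Fin m) (firstRows hin 1)) ∉ T ∧
      (∀ p ∈ T, p.2 ∈ minorSpan n i (Fin m)) ∧
      ∀ p ∈ T, p.2 ∈ stableSpan ((glRep n i (Fin m)).comp (slLie n).incl) (lowerRoots n)
        (extremalVec (Fin m) (firstRows hin 1)) := by
  obtain ⟨hv₀, hwt⟩ := hv₀
  have hw₀ne : extremalVec (Fin m) (firstRows hin 1) ≠ 0 :=
    extremalVec_ne_zero (firstRows_injective hin 1)
  have hwt' : ∀ h : slLie n, h.1.IsDiag →
      glRep n i (Fin m) h.1 (extremalVec (Fin m) (firstRows hin 1)) =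
        (∑ a, ((m • fundWeight n i) a : ℂ) * h.1 a a) •
          extremalVec (Fin m) (firstRows hin 1) :=
    fun h hd => glRep_extremalVec_diag hin 1 h.1 hd
  have hkill' : ∀ x : slLie n, x ∈ nilPlus n →
      glRep n i (Fin m) x.1 (extremalVec (Fin m) (firstRows hin 1)) = 0 := by
    intro x hx
    refine glRep_extremalVec_eq_zero _ _ fun c s hne => ?_
    have hlt : c < firstRows hin 1 s := by
      by_contra h
      exact hne (hx _ _ (not_lt.1 h))
    refine ⟨(mem_range_firstRows hin 1 c).2 ?_, hlt.ne⟩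
    exact lt_trans (Fin.lt_def.1 hlt) s.2
  have hw₀S : extremalVec (Fin m) (firstRows hin 1) ∈ minorSpan n i (Fin m) :=
    Submodule.subset_span ⟨_, rfl⟩
  generalize extremalVec (Fin m) (firstRows hin 1) = w₀ at *
  obtain ⟨ρ, hρ⟩ : ∃ ρ : slLie n →ₗ⁅ℂ⁆ Module.End ℂ (V × ModelRing n i (Fin m)),
      ∀ y p, ρ y p = (⁅y, p.1⁆, glRep n i (Fin m) y.1 p.2) :=
    ⟨pairRep V i (Fin m), fun _ _ => rfl⟩
  have hgT := self_mem_stableSpan ρ (lowerRoots n) (v₀, w₀)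
  have hdiag : ∀ h : slLie n, h.1.IsDiag →
      ρ h (v₀, w₀) = (∑ a, ((m • fundWeight n i) a : ℂ) * h.1 a a) • (v₀, w₀) := by
    intro h hd
    rw [hρ]
    exact Prod.ext (hwt h hd) (hwt' h hd)
  have hup : ∀ x : slLie n, x ∈ nilPlus n → ρ x (v₀, w₀) = 0 := by
    intro x hx
    rw [hρ]
    exact Prod.ext (hkill x hx) (hkill' x hx)
  refine ⟨stableSpan ρ (lowerRoots n) (v₀, w₀), fun y p hp => ?_, hgT, fun hmem => ?_,
    fun p hp => ?_, fun p hp => ?_⟩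
  · rw [← hρ]
    refine stableSpan_stable ρ _ _ (fun y => ?_) y p hp
    have hy : ρ y (v₀, w₀) = ρ (lowerPart y) (v₀, w₀) + (ρ (diagPart y) (v₀, w₀) +
        ρ (y - lowerPart y - diagPart y) (v₀, w₀)) := by
      conv_lhs => rw [eq_triangular y]
      rw [map_add, map_add]
      rfl
    rw [hy, hup _ (sub_lower_sub_diag_mem y), add_zero,
      hdiag (diagPart y) (Matrix.isDiag_diagonal _)]
    exact Submodule.add_mem _ (lowerPart_apply_mem ρ _ _
      (fun f hf => apply_mem_stableSpan _ _ _ hf hgT) y) (Submodule.smul_mem _ _ hgT)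
  -- The vector `(0, w₀)` has the weight of the generator, so it would be a multiple of `(v₀, w₀)`;
  -- the first component forces the multiple to be zero.
  · obtain ⟨h, hd, hreg⟩ := exists_regular n
    obtain ⟨c, hc⟩ := Submodule.mem_span_singleton.1
      (mem_span_of_mem_stableSpan ρ (v₀, w₀) (0, w₀) h hd hreg _ (hdiag h hd) (by
        rw [hρ]
        exact Prod.ext (by simp) (hwt' h hd)) hmem)
    have h1 : c • v₀ = 0 := congrArg Prod.fst hc
    have h2 : c • w₀ = w₀ := congrArg Prod.snd hc
    rw [(smul_eq_zero.1 h1).resolve_right hv₀, zero_smul] at h2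
    exact hw₀ne h2.symm
  · refine (stableSpan_le (S := (minorSpan n i (Fin m)).comap
      (LinearMap.snd ℂ V (ModelRing n i (Fin m)))) hw₀S fun f _ w hw => ?_) hp
    rw [hρ]
    exact glRep_mem_minorSpan f.1 _ hw
  · refine (stableSpan_le (S := (stableSpan ((glRep n i (Fin m)).comp (slLie n).incl)
      (lowerRoots n) w₀).comap (LinearMap.snd ℂ V (ModelRing n i (Fin m))))
      (self_mem_stableSpan _ _ _) fun f hf w hw => ?_) hp
    rw [hρ]
    exact apply_mem_stableSpan ((glRep n i (Fin m)).comp (slLie n).incl) _ _ hf hw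

/-- A graph-like submodule of `V ⊕ ModelRing` is the graph of an embedding. -/
theorem exists_linearMap_of_graph {i m : ℕ} (hirr : LieModule.IsIrreducible ℂ (slLie n) V) (v₀ : V)
    (hv₀ : v₀ ≠ 0) (g : Fin i → Fin (n + 1)) (T : Submodule ℂ (V × ModelRing n i (Fin m)))
    (hstab : ∀ (y : slLie n) (p : V × ModelRing n i (Fin m)), p ∈ T →
      (⁅y, p.1⁆, glRep n i (Fin m) y.1 p.2) ∈ T)
    (hg : (v₀, extremalVec (Fin m) g) ∈ T) (hw₀ : ((0 : V), extremalVec (Fin m) g) ∉ T)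
    (hS : ∀ p ∈ T, p.2 ∈ minorSpan n i (Fin m))
    (hT : ∀ p ∈ T, p.2 ∈ stableSpan ((glRep n i (Fin m)).comp (slLie n).incl) (lowerRoots n)
        (extremalVec (Fin m) g)) :
    ∃ φ : V →ₗ[ℂ] ModelRing n i (Fin m), Function.Injective φ ∧
      (∀ (y : slLie n) (x : V), φ ⁅y, x⁆ = glRep n i (Fin m) y.1 (φ x)) ∧
      ∀ x, φ x ∈ minorSpan n i (Fin m) := by
  have hv₀T : (v₀, (0 : ModelRing n i (Fin m))) ∉ T := by
    intro hmem
    apply hw₀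
    have := T.sub_mem hg hmem
    simpa using this
  -- The ambiguity of the second component is a submodule of the model that misses the extremal
  -- vector. Its vanishing makes `T` a graph over its projection to `V`.
  have hK : T.comap (LinearMap.inr ℂ V (ModelRing n i (Fin m))) = ⊥ := by
    refine submodule_eq_bot g _ (T.map (LinearMap.snd ℂ V (ModelRing n i (Fin m))))
      (fun x hx => ⟨_, hx, rfl⟩) ?_ ?_ (fun y x hx => ?_) hw₀
    · rintro _ ⟨p, hp, rfl⟩
      exact hT p hp
    · rintro _ ⟨p, hp, rfl⟩
      exact hS p hp
    · have := hstab y _ hx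
      simpa using this
  have huniq : ∀ x w w', (x, w) ∈ T → (x, w') ∈ T → w = w' := by
    intro x w w' h1 h2
    have h3 : w - w' ∈ T.comap (LinearMap.inr ℂ V (ModelRing n i (Fin m))) := by
      have := T.sub_mem h1 h2
      simpa using this
    rw [hK, Submodule.mem_bot] at h3
    exact sub_eq_zero.1 h3
  let N : LieSubmodule ℂ (slLie n) V :=
    { T.map (LinearMap.fst ℂ V (ModelRing n i (Fin m))) with
      lie_mem := by
        rintro y _ ⟨p, hp, rfl⟩
        exact ⟨_, hstab y p hp, rfl⟩ }
  have hN : N = ⊤ := by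
    rcases eq_bot_or_eq_top N with hb | ht
    · exfalso
      have : v₀ ∈ N := ⟨_, hg, rfl⟩
      rw [hb, LieSubmodule.mem_bot] at this
      exact hv₀ this
    · exact ht
  have hex : ∀ x : V, ∃ w, (x, w) ∈ T := by
    intro x
    have : x ∈ N := by rw [hN]; exact LieSubmodule.mem_top x
    obtain ⟨p, hp, rfl⟩ := this
    exact ⟨p.2, hp⟩
  choose F hF using hex
  let φ : V →ₗ[ℂ] ModelRing n i (Fin m) :=
    { toFun := F
      map_add' := fun x y => huniq _ _ _ (hF _) (T.add_mem (hF x) (hF y))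
      map_smul' := fun c x => huniq _ _ _ (hF _) (T.smul_mem c (hF x)) }
  have hφ : ∀ (y : slLie n) (x : V), φ ⁅y, x⁆ = glRep n i (Fin m) y.1 (φ x) :=
    fun y x => huniq _ _ _ (hF _) (hstab y _ (hF x))
  let N' : LieSubmodule ℂ (slLie n) V :=
    { LinearMap.ker φ with
      lie_mem := by
        intro y x hx
        have hx' : φ x = 0 := hx
        change φ ⁅y, x⁆ = 0
        rw [hφ, hx', map_zero] }
  refine ⟨φ, ?_, hφ, fun x => hS _ (hF x)⟩
  rw [← LinearMap.ker_eq_bot]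
  rcases eq_bot_or_eq_top N' with hb | ht
  · have := congrArg LieSubmodule.toSubmodule hb
    simpa [N'] using this
  · exfalso
    have hmem : v₀ ∈ N' := by rw [ht]; exact LieSubmodule.mem_top v₀
    have h0 : F v₀ = 0 := hmem
    have := hF v₀
    rw [h0] at this
    exact hv₀T this

/-- `V(m ω_i)` embeds into the model. -/
theorem exists_embedding {i m : ℕ} (hin : i ≤ n)
    (hV : IsSimpleOfHighestWeight V (m • fundWeight n i)) :
    ∃ φ : V →ₗ[ℂ] ModelRing n i (Fin m), Function.Injective φ ∧
      (∀ (y : slLie n) (x : V), φ ⁅y, x⁆ = glRep n i (Fin m) y.1 (φ x)) ∧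
      ∀ x, φ x ∈ minorSpan n i (Fin m) := by
  obtain ⟨v₀, hv₀, hkill⟩ := hV.exists_highest
  obtain ⟨T, h1, h2, h3, h4, h5⟩ := exists_graph hin v₀ hv₀ hkill
  exact exists_linearMap_of_graph hV.irreducible v₀ hv₀.1 _ T h1 h2 h3 h4 h5

/-- Under an embedding into the model an extremal weight vector is a multiple of the
extremal vector. -/
theorem exists_smul_extremalVec {i m : ℕ} (hin : i ≤ n) (φ : V →ₗ[ℂ] ModelRing n i (Fin m))
    (hinj : Function.Injective φ)
    (hφ : ∀ (y : slLie n) (x : V), φ ⁅y, x⁆ = glRep n i (Fin m) y.1 (φ x))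
    (hS : ∀ x, φ x ∈ minorSpan n i (Fin m)) (u : Equiv.Perm (Fin (n + 1))) (v : V)
    (hv : IsWeightVector (weylAct u (m • fundWeight n i)) v) :
    ∃ c : ℂ, c ≠ 0 ∧ φ v = c • extremalVec (Fin m) (firstRows hin u) := by
  obtain ⟨D, τ, hD⟩ := exists_eq_sl_add_smul_one (rangeDiag (firstRows hin u))
  have hDd : D.1.IsDiag := by
    rw [← sub_eq_iff_eq_add] at hD
    rw [← hD, rangeDiag, ← Matrix.diagonal_one, ← Matrix.diagonal_smul, Matrix.diagonal_sub]
    exact Matrix.isDiag_diagonal _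
  have key : ∀ x : ModelRing n i (Fin m), x ∈ minorSpan n i (Fin m) →
      glRep n i (Fin m) D.1 x =
        (∑ c, ((weylAct u (m • fundWeight n i) c : ℤ) : ℂ) * D.1 c c) • x →
      glRep n i (Fin m) (rangeDiag (firstRows hin u)) x =
        ((∑ c, ((weylAct u (m • fundWeight n i) c : ℤ) : ℂ) * D.1 c c) +
          τ * ((Fintype.card (Fin m × Fin i) : ℕ) : ℂ)) • x := by
    intro x hx h
    rw [hD, map_add, LinearMap.add_apply, map_smul, LinearMap.smul_apply, glRep_one x hx, h,
      add_smul, mul_smul]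
  have h1 := key (extremalVec (Fin m) (firstRows hin u)) (Submodule.subset_span ⟨_, rfl⟩)
    (glRep_extremalVec_diag hin u D.1 hDd)
  have h2 := key (φ v) (hS v) (by rw [← hφ, hv.2 D hDd, map_smul])
  have h3 := glRep_rangeDiag_self (R := Fin m) (firstRows hin u)
  rw [← extremalVec] at h3
  -- Since the extremal vector has the same weight as `v`, it determines the scalar by which
  -- `rangeDiag` acts on `φ v`.
  have h4 := smul_left_injective ℂ
    (extremalVec_ne_zero (R := Fin m) (firstRows_injective hin u)) (h1.symm.trans h3)
  rw [h4] at h2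
  obtain ⟨c, hc⟩ := Submodule.mem_span_singleton.1 (mem_span_of_extremal _ _ (hS v) h2)
  refine ⟨c, ?_, hc.symm⟩
  rintro rfl
  rw [zero_smul] at hc
  exact hv.1 (hinj (by rw [← hc, map_zero]))

end Embedding

/-! ### Smallest exponents and determinants attached to antichains. -/

section MinimalExponent

open MvPolynomial

variable {n i : ℕ} {ell : Fin (n + 1) → ℕ}

/-- `p` is the lexicographically smallest exponent of `G`. -/
def HasMinExponent (G : MvPolynomial (Vertex n i ell) ℂ) (p : Vertex n i ell → ℕ) : Prop :=
  (∀ a : Vertex n i ell →₀ ℕ, coeff a G ≠ 0 → ⇑a = p ∨ LexLT p a) ∧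
    ∀ a : Vertex n i ell →₀ ℕ, ⇑a = p → coeff a G ≠ 0

theorem HasMinExponent.one : HasMinExponent (1 : MvPolynomial (Vertex n i ell) ℂ) 0 := by
  classical
  constructor
  · intro a ha
    rw [coeff_one] at ha
    left
    by_contra h
    exact ha (if_neg fun h0 => h (by rw [← h0]; rfl))
  · intro a ha
    have : a = 0 := DFunLike.coe_injective ha
    simp [this]

/-- The lexicographic order is compatible with addition, so only the two smallest terms contribute
at `p + q`. -/
theorem HasMinExponent.mul {G H : MvPolynomial (Vertex n i ell) ℂ} {p q : Vertex n i ell → ℕ}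
    (hG : HasMinExponent G p) (hH : HasMinExponent H q) : HasMinExponent (G * H) (p + q) := by
  classical
  have key : ∀ b c : Vertex n i ell →₀ ℕ, coeff b G * coeff c H ≠ 0 →
      (⇑b = p ∧ ⇑c = q) ∨ LexLT (p + q) (b + c : Vertex n i ell →₀ ℕ) := by
    intro b c h
    rw [Finsupp.coe_add]
    rcases hG.1 b (left_ne_zero_of_mul h) with hb | hb <;>
      rcases hH.1 c (right_ne_zero_of_mul h) with hc | hc
    · exact Or.inl ⟨hb, hc⟩
    · right
      rw [hb, add_comm p, add_comm p]
      exact hc.add_right p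
    · right
      rw [hc]
      exact hb.add_right q
    · exact Or.inr (hb.add hc)
  constructor
  · intro a ha
    rw [coeff_mul] at ha
    obtain ⟨⟨b, c⟩, hbc, hne⟩ := Finset.exists_ne_zero_of_sum_ne_zero ha
    rw [Finset.HasAntidiagonal.mem_antidiagonal] at hbc
    subst hbc
    rcases key b c hne with ⟨hb, hc⟩ | h
    · left; rw [Finsupp.coe_add, hb, hc]
    · exact Or.inr h
  · intro a ha
    let b := Finsupp.equivFunOnFinite.symm p
    let c := Finsupp.equivFunOnFinite.symm q
    have hb : ⇑b = p := rfl
    have hc : ⇑c = q := rfl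
    have habc : b + c = a := DFunLike.coe_injective (by rw [Finsupp.coe_add, hb, hc, ha])
    rw [coeff_mul, Finset.sum_eq_single (b, c)]
    · exact mul_ne_zero (hG.2 b hb) (hH.2 c hc)
    · rintro ⟨b', c'⟩ hbc hne
      rw [Finset.HasAntidiagonal.mem_antidiagonal] at hbc
      dsimp only at hbc
      by_contra h0
      rcases key b' c' h0 with ⟨hb', hc'⟩ | h
      · exact hne (Prod.ext (DFunLike.coe_injective hb') (DFunLike.coe_injective hc'))
      · rw [hbc, ha] at h
        exact LexLT.irrefl _ h
    · intro h
      exact absurd (Finset.HasAntidiagonal.mem_antidiagonal.2 habc) h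

theorem HasMinExponent.prod {ι : Type*} (s : Finset ι) (G : ι → MvPolynomial (Vertex n i ell) ℂ)
    (p : ι → Vertex n i ell → ℕ) (h : ∀ r, HasMinExponent (G r) (p r)) :
    HasMinExponent (∏ r ∈ s, G r) (∑ r ∈ s, p r) := by
  classical
  induction s using Finset.induction_on with
  | empty => simpa using HasMinExponent.one
  | insert a s ha ih =>
    rw [Finset.prod_insert ha, Finset.sum_insert ha]
    exact (h a).mul ih

/-- Triangularity: in a linear relation take the largest exponent with nonzero coefficient. Its
functional sees no other term of the relation. -/
theorem linearIndepOn_of_functionals {M : Type*} [AddCommGroup M] [Module ℂ M]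
    (w : (Vertex n i ell → ℕ) → M) (E : Set (Vertex n i ell → ℕ))
    (h : ∀ p ∈ E, ∃ ξ : M →ₗ[ℂ] ℂ, (∀ q, ξ (w q) ≠ 0 → q = p ∨ LexLT p q) ∧ ξ (w p) ≠ 0) :
    LinearIndepOn ℂ w E := by
  classical
  rw [linearIndepOn_iff']
  intro t a ht hsum q hq
  by_contra hne
  let t' := t.filter fun q => a q ≠ 0
  have hirr : Std.Irrefl fun x y : t' => LexLT (y : Vertex n i ell → ℕ) x :=
    ⟨fun x => LexLT.irrefl _⟩
  have htr : IsTrans t' fun x y => LexLT (y : Vertex n i ell → ℕ) x :=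
    ⟨fun x y z h1 h2 => h2.trans h1⟩
  have hwf := Finite.wellFounded_of_trans_of_irrefl
    fun x y : t' => LexLT (y : Vertex n i ell → ℕ) x
  obtain ⟨⟨p, hp⟩, -, hmin⟩ := hwf.has_min Set.univ
    ⟨⟨q, Finset.mem_filter.2 ⟨hq, hne⟩⟩, Set.mem_univ _⟩
  have hp' := Finset.mem_filter.1 hp
  obtain ⟨ξ, hξ, hξp⟩ := h p (ht hp'.1)
  have h0 := congrArg ξ hsum
  rw [map_sum, map_zero, Finset.sum_eq_single p] at h0
  · rw [map_smul, smul_eq_mul] at h0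
    exact (mul_ne_zero hp'.2 hξp) h0
  · intro r hr hrp
    by_contra hr0
    rw [map_smul, smul_eq_mul] at hr0
    rcases hξ r (right_ne_zero_of_mul hr0) with h | h
    · exact hrp h
    · exact hmin ⟨r, Finset.mem_filter.2 ⟨hr, left_ne_zero_of_mul hr0⟩⟩ (Set.mem_univ _) h
  · intro h
    exact absurd hp'.1 h

open Classical in
/-- The matrix whose determinant has the indicator of the antichain `A` as smallest exponent. -/
noncomputable def antichainMatrix (A : Finset (Vertex n i ell)) :
    Matrix (Fin i) (Fin i) (MvPolynomial (Vertex n i ell) ℂ) :=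
  Matrix.of fun s t => (if s = t ∧ ∀ y ∈ A, y.row.val ≠ t.val then 1 else 0) +
    ∑ x : Vertex n i ell,
      if x.row.val = s.val ∧ ∃ y ∈ A, y.row.val = t.val ∧ y.col = x.col then X x else 0

/-- The row of a vertex as an element of `Fin i`. -/
def Vertex.rowFin (x : Vertex n i ell) : Fin i := ⟨x.row.val, x.row_lt⟩

theorem antichainMatrix_of_not {A : Finset (Vertex n i ell)} {t : Fin i}
    (ht : ∀ y ∈ A, y.row.val ≠ t.val) (s : Fin i) :
    antichainMatrix A s t = if s = t then 1 else 0 := by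
  classical
  rw [antichainMatrix, Matrix.of_apply, Finset.sum_eq_zero, add_zero]
  · simp only [eq_true ht, and_true]
  · intro x _
    rw [if_neg]
    rintro ⟨-, y, hy, hyt, -⟩
    exact ht y hy hyt

theorem eq_of_row_eq_of_antichain {A : Finset (Vertex n i ell)}
    (hA : IsAntichain (· ≤ ·) (A : Set (Vertex n i ell))) {x y : Vertex n i ell} (hx : x ∈ A)
    (hy : y ∈ A) (h : x.row = y.row) : x = y := by
  rcases le_total x.col y.col with hc | hc
  · exact hA.eq hx hy ((Vertex.le_iff x y).2 ⟨h.ge, hc⟩)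
  · exact (hA.eq hy hx ((Vertex.le_iff y x).2 ⟨h.le, hc⟩)).symm

theorem eq_of_col_eq_of_antichain {A : Finset (Vertex n i ell)}
    (hA : IsAntichain (· ≤ ·) (A : Set (Vertex n i ell))) {x y : Vertex n i ell} (hx : x ∈ A)
    (hy : y ∈ A) (h : x.col = y.col) : x = y := by
  rcases le_total x.row y.row with hr | hr
  · exact (hA.eq hy hx ((Vertex.le_iff y x).2 ⟨hr, h.ge⟩)).symm
  · exact hA.eq hx hy ((Vertex.le_iff x y).2 ⟨hr, h.le⟩)

theorem antichainMatrix_of_mem {A : Finset (Vertex n i ell)}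
    (hA : IsAntichain (· ≤ ·) (A : Set (Vertex n i ell))) {y : Vertex n i ell} (hy : y ∈ A)
    (s : Fin i) : (antichainMatrix A s y.rowFin = 0 ∧
        ¬ ∃ x : Vertex n i ell, x.row.val = s.val ∧ x.col = y.col) ∨
      ∃ x : Vertex n i ell, x.row.val = s.val ∧ x.col = y.col ∧
        antichainMatrix A s y.rowFin = X x := by
  classical
  have h1 : antichainMatrix A s y.rowFin = ∑ x : Vertex n i ell,
      if x.row.val = s.val ∧ x.col = y.col then X x else 0 := by
    rw [antichainMatrix, Matrix.of_apply, if_neg, zero_add]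
    · refine Finset.sum_congr rfl fun x _ => if_congr (and_congr_right fun _ => ?_) rfl rfl
      constructor
      · rintro ⟨z, hz, hzr, hzc⟩
        rw [← hzc, eq_of_row_eq_of_antichain hA hz hy (Fin.ext hzr)]
      · intro h
        exact ⟨y, hy, rfl, h.symm⟩
    · rintro ⟨-, h⟩
      exact h y hy rfl
  by_cases hx : ∃ x : Vertex n i ell, x.row.val = s.val ∧ x.col = y.col
  · obtain ⟨x, hxr, hxc⟩ := hx
    refine Or.inr ⟨x, hxr, hxc, ?_⟩
    rw [h1, Finset.sum_eq_single x]
    · rw [if_pos ⟨hxr, hxc⟩]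
    · intro z _ hz
      rw [if_neg]
      rintro ⟨hzr, hzc⟩
      exact hz (Vertex.ext_row_col (Fin.ext (hzr.trans hxr.symm)) (hzc.trans hxc.symm))
    · simp
  · refine Or.inl ⟨?_, hx⟩
    rw [h1]
    refine Finset.sum_eq_zero fun x _ => ?_
    rw [if_neg fun h => hx ⟨x, h⟩]

open Classical in
/-- The indicator exponent of a set. -/
noncomputable def indicatorExp (A : Finset (Vertex n i ell)) : Vertex n i ell → ℕ :=
  fun x => if x ∈ A then 1 else 0

/-- A column indexed by no row of `A` is a unit vector and forces `σ` to fix that index. The other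
columns contribute variables in the columns of `A` with permuted rows, so the margins are preserved.
Elements of an antichain have distinct columns, so only the identity recovers `A`. -/
theorem prod_antichainMatrix {A : Finset (Vertex n i ell)}
    (hA : IsAntichain (· ≤ ·) (A : Set (Vertex n i ell))) (σ : Equiv.Perm (Fin i)) :
    ∏ t, antichainMatrix A (σ t) t = 0 ∨ ∃ q : Vertex n i ell →₀ ℕ,
      ∏ t, antichainMatrix A (σ t) t = monomial q 1 ∧ SameMargins (indicatorExp A) q ∧
      (⇑q = indicatorExp A → σ = 1) ∧ (σ = 1 → ⇑q = indicatorExp A) := by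
  classical
  have hinj : Set.InjOn Vertex.rowFin (A : Set (Vertex n i ell)) := fun x hx y hy h =>
    eq_of_row_eq_of_antichain hA hx hy (Fin.ext (Fin.mk.inj h))
  set T := A.image Vertex.rowFin with hT
  have hnT : ∀ t, t ∉ T → ∀ y ∈ A, y.row.val ≠ t.val := fun t ht y hy h =>
    ht (Finset.mem_image.2 ⟨y, hy, Fin.ext h⟩)
  by_cases hfix : ∀ t, t ∉ T → σ t = t
  swap
  · push Not at hfix
    obtain ⟨t, ht, hσ⟩ := hfix
    exact Or.inl (Finset.prod_eq_zero (Finset.mem_univ t)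
      (by rw [antichainMatrix_of_not (hnT t ht), if_neg hσ]))
  by_cases hex : ∀ y ∈ A, ∃ x : Vertex n i ell, x.row.val = (σ y.rowFin).val ∧ x.col = y.col ∧
      antichainMatrix A (σ y.rowFin) y.rowFin = X x
  swap
  · push Not at hex
    obtain ⟨y, hy, hne⟩ := hex
    refine Or.inl (Finset.prod_eq_zero (Finset.mem_univ y.rowFin) ?_)
    rcases antichainMatrix_of_mem hA hy (σ y.rowFin) with h | ⟨x, h1, h2, h3⟩
    · exact h.1
    · exact absurd h3 (hne x h1 h2)
  choose! x hxr hxc hxX using hex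
  have hprod : ∏ t, antichainMatrix A (σ t) t = monomial (∑ y ∈ A, Finsupp.single (x y) 1) 1 := by
    rw [← Finset.prod_subset (Finset.subset_univ T), hT, Finset.prod_image hinj,
      monomial_sum_one]
    · exact Finset.prod_congr rfl fun y hy => hxX y hy
    · intro t _ ht
      rw [antichainMatrix_of_not (hnT t ht), if_pos (hfix t ht)]
  have hlin : ∀ f : Vertex n i ell → ℕ,
      ∑ z, (∑ y ∈ A, Finsupp.single (x y) 1 : Vertex n i ell →₀ ℕ) z * f z = ∑ y ∈ A, f (x y) := by
    intro f
    simp only [Finsupp.finsetSum_apply, Finset.sum_mul]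
    rw [Finset.sum_comm]
    refine Finset.sum_congr rfl fun y _ => ?_
    rw [Finset.sum_eq_single (x y)]
    · simp
    · intro z _ hz
      rw [Finsupp.single_eq_of_ne (by simpa using hz), zero_mul]
    · simp
  have hlinA : ∀ f : Vertex n i ell → ℕ, ∑ z, indicatorExp A z * f z = ∑ y ∈ A, f y := by
    intro f
    simp [indicatorExp]
  refine Or.inr ⟨_, hprod, ⟨fun f => ?_, fun f => ?_⟩, fun hq => ?_, fun hσ => ?_⟩
  · rw [hlinA fun z => f z.row, hlin fun z => f z.row]
    have hcast : ∃ F : Fin i → ℕ, ∀ y : Vertex n i ell, F y.rowFin = f y.row := by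
      refine ⟨fun t => if h : t.val < n + 1 then f ⟨t, h⟩ else 0, fun y => ?_⟩
      have : y.rowFin.val < n + 1 := y.row.2
      simp only [dif_pos this]
      rfl
    obtain ⟨F, hF⟩ := hcast
    have h1 : ∑ y ∈ A, f y.row = ∑ t ∈ T, F t := by
      rw [hT, Finset.sum_image hinj]
      exact Finset.sum_congr rfl fun y _ => (hF y).symm
    have h2 : ∑ y ∈ A, f (x y).row = ∑ t ∈ T, F (σ t) := by
      rw [hT, Finset.sum_image hinj]
      refine Finset.sum_congr rfl fun y hy => ?_
      rw [← hF]
      congr 1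
      exact Fin.ext (hxr y hy)
    have h3 : ∑ t, F (σ t) = ∑ t, F t := Equiv.sum_comp σ F
    rw [← Finset.sum_add_sum_compl T, ← Finset.sum_add_sum_compl T (fun t => F t)] at h3
    have h4 : ∑ t ∈ Tᶜ, F (σ t) = ∑ t ∈ Tᶜ, F t :=
      Finset.sum_congr rfl fun t ht => by rw [hfix t (Finset.mem_compl.1 ht)]
    omega
  · rw [hlinA fun z => f z.col, hlin fun z => f z.col]
    exact Finset.sum_congr rfl fun y hy => by rw [hxc y hy]
  · refine Equiv.ext fun t => ?_
    by_cases ht : t ∈ T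
    · obtain ⟨y, hy, rfl⟩ := Finset.mem_image.1 ht
      have hmem : x y ∈ A := by
        by_contra hn
        have h1 : indicatorExp A (x y) = 0 := if_neg hn
        rw [← hq, Finsupp.finsetSum_apply, Finset.sum_eq_zero_iff] at h1
        simpa using h1 y hy
      have := eq_of_col_eq_of_antichain hA hmem hy (hxc y hy)
      apply Fin.ext
      rw [← hxr y hy, this]
      rfl
    · exact hfix t ht
  · have hxy : ∀ y ∈ A, x y = y := fun y hy =>
      Vertex.ext_row_col (Fin.ext (by rw [hxr y hy, hσ]; rfl)) (hxc y hy)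
    funext z
    rw [Finsupp.finsetSum_apply, Finset.sum_congr rfl fun y hy => by rw [hxy y hy]]
    simp [indicatorExp, Finsupp.single_apply]

theorem prod_antichainMatrix_diag_ne_zero {A : Finset (Vertex n i ell)}
    (hA : IsAntichain (· ≤ ·) (A : Set (Vertex n i ell))) :
    ∏ t, antichainMatrix A t t ≠ 0 := by
  classical
  refine Finset.prod_ne_zero_iff.2 fun t _ => ?_
  by_cases ht : ∀ y ∈ A, y.row.val ≠ t.val
  · rw [antichainMatrix_of_not ht, if_pos rfl]
    exact one_ne_zero
  · push Not at ht
    obtain ⟨y, hy, hyt⟩ := ht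
    obtain rfl : y.rowFin = t := Fin.ext hyt
    rcases antichainMatrix_of_mem hA hy y.rowFin with h | ⟨x, -, -, h⟩
    · exact absurd ⟨y, rfl, rfl⟩ h.2
    · rw [h]
      exact X_ne_zero x

/-- Every term of the Leibniz expansion has the margins of `A`, for which an antichain is smallest.
Only the identity permutation yields its exponent, so nothing cancels. -/
theorem hasMinExponent_det {A : Finset (Vertex n i ell)}
    (hA : IsAntichain (· ≤ ·) (A : Set (Vertex n i ell))) :
    HasMinExponent (antichainMatrix A).det (indicatorExp A) := by
  classical
  have hterm : ∀ (σ : Equiv.Perm (Fin i)) (a : Vertex n i ell →₀ ℕ),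
      coeff a (∏ t, antichainMatrix A (σ t) t) ≠ 0 →
        SameMargins (indicatorExp A) a ∧ (⇑a = indicatorExp A → σ = 1) := by
    intro σ a ha
    rcases prod_antichainMatrix hA σ with h | ⟨q, hq, h1, h2, -⟩
    · rw [h, coeff_zero] at ha
      exact absurd rfl ha
    · rw [hq, coeff_monomial] at ha
      have hqa : q = a := by
        by_contra h
        exact ha (if_neg h)
      subst hqa
      exact ⟨h1, h2⟩
  rw [Matrix.det_apply]
  constructor
  · intro a ha
    rw [coeff_sum] at ha
    obtain ⟨σ, -, hσ⟩ := Finset.exists_ne_zero_of_sum_ne_zero ha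
    rw [Units.smul_def, coeff_smul] at hσ
    have h := hterm σ a fun h0 => hσ (by rw [h0, smul_zero])
    by_cases hEq : ⇑a = indicatorExp A
    · exact Or.inl hEq
    · refine Or.inr (lexLT_of_antichain h.1 (fun x y hx hy hxy => ?_) (Ne.symm hEq))
      have hx' : x ∈ A := by by_contra h; exact hx (if_neg h)
      have hy' : y ∈ A := by by_contra h; exact hy (if_neg h)
      exact hA.eq hx' hy' hxy
  · intro a ha
    rw [coeff_sum, Finset.sum_eq_single 1]
    · rw [Equiv.Perm.sign_one, one_smul]
      rcases prod_antichainMatrix hA 1 with h | ⟨q, hq, -, -, h⟩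
      · exact absurd h (prod_antichainMatrix_diag_ne_zero hA)
      · have hqa : q = a := DFunLike.coe_injective ((h rfl).trans ha.symm)
        rw [hq, hqa, coeff_monomial, if_pos rfl]
        exact one_ne_zero
    · intro σ _ hσ
      rw [Units.smul_def, coeff_smul]
      by_contra h0
      exact hσ ((hterm σ a fun h1 => h0 (by rw [h1, smul_zero])).2 ha)
    · simp

end MinimalExponent

/-! ### Orbit maps and linear independence. -/

section Independence

open MvPolynomial

variable {n i : ℕ} {ell : Fin (n + 1) → ℕ} {R : Type*}

/-- The orbit map of `exp (∑ₓ tₓ Eₓ)` through the point `ev`, as a homomorphism of function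
rings. -/
noncomputable def orbitHom (u : Equiv.Perm (Fin (n + 1)))
    (ev : Fin (n + 1) × (R × Fin i) → ℂ) :
    ModelRing n i R →ₐ[ℂ] MvPolynomial (Vertex n i ell) ℂ :=
  aeval fun z => C (ev z) +
    ∑ x : Vertex n i ell, if u x.row = z.1 then C (ev (u x.col, z.2)) * X x else 0

theorem orbitHom_X (u : Equiv.Perm (Fin (n + 1))) (ev : Fin (n + 1) × (R × Fin i) → ℂ)
    (z : Fin (n + 1) × (R × Fin i)) :
    orbitHom (ell := ell) u ev (X z) = C (ev z) +
      ∑ x : Vertex n i ell, if u x.row = z.1 then C (ev (u x.col, z.2)) * X x else 0 :=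
  aeval_X _ _

/-- Rows precede `i` and columns do not, so the matrices involved have zero products and their
exponential is affine in the parameters. Differentiating the orbit map thus gives the infinitesimal
action. -/
theorem pderiv_orbitHom (u : Equiv.Perm (Fin (n + 1))) (ev : Fin (n + 1) × (R × Fin i) → ℂ)
    (x : Vertex n i ell) (f : ModelRing n i R) :
    pderiv x (orbitHom u ev f) =
      orbitHom u ev (glRep n i R (Matrix.single (u x.col) (u x.row) 1) f) := by
  classical
  change _ = orbitHom u ev (glDer (Matrix.single (u x.col) (u x.row) 1) f)
  induction f using MvPolynomial.induction_on with
  | C a => simp [← algebraMap_eq]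
  | add p q hp hq => simp only [map_add, hp, hq]
  | mul_X p z hp =>
    have h1 : pderiv x (orbitHom (ell := ell) u ev (X z)) =
        if u x.row = z.1 then C (ev (u x.col, z.2)) else 0 := by
      rw [orbitHom_X, map_add, pderiv_C, zero_add, map_sum, Finset.sum_eq_single x]
      · split_ifs
        · rw [pderiv_C_mul, pderiv_X_self, mul_one]
        · exact map_zero _
      · intro y _ hy
        split_ifs
        · rw [pderiv_C_mul, pderiv_X_of_ne hy, mul_zero]
        · exact map_zero _
      · simp
    have h2 : orbitHom (ell := ell) u ev (glDer (Matrix.single (u x.col) (u x.row) 1) (X z)) =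
        if u x.row = z.1 then C (ev (u x.col, z.2)) else 0 := by
      rw [glDer_X, Finset.sum_eq_single (u x.col)]
      · by_cases h : u x.row = z.1
        · rw [if_pos h, ← h, Matrix.single_apply_same, one_smul, orbitHom_X, Finset.sum_eq_zero,
            add_zero]
          intro y _
          rw [if_neg]
          intro hyx
          have := congrArg Fin.val (u.injective hyx)
          have h3 := y.row_lt
          have h4 := x.le_col
          omega
        · rw [if_neg h, Matrix.single_apply_of_ne _ _ _ _ _ fun h' => h h'.2, zero_smul, map_zero]
      · intro c _ hc
        rw [Matrix.single_apply_of_ne _ _ _ _ _ fun h' => hc h'.1.symm, zero_smul]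
      · simp
    rw [map_mul, pderiv_mul, hp, Derivation.leibniz, map_add, smul_eq_mul, smul_eq_mul, map_mul,
      map_mul, h1, h2]
    ring

/-- Iterated differentiation shifts coefficients up to nonzero factors. With `r = 0`, the constant
term after acting by a monomial reads off one coefficient of the pulled-back function. -/
theorem coeff_orbitHom (u : Equiv.Perm (Fin (n + 1))) (ev : Fin (n + 1) × (R × Fin i) → ℂ)
    (Ψ : MvPolynomial (Vertex n i ell) ℂ →ₐ[ℂ] Module.End ℂ (ModelRing n i R))
    (hΨ : ∀ x, Ψ (X x) = glRep n i R (Matrix.single (u x.col) (u x.row) 1))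
    (a r : Vertex n i ell →₀ ℕ) : ∃ c : ℂ, c ≠ 0 ∧ ∀ f : ModelRing n i R,
      coeff r (orbitHom u ev (Ψ (monomial a 1) f)) = c * coeff (r + a) (orbitHom u ev f) := by
  classical
  have hadd : ∀ a b : Vertex n i ell →₀ ℕ,
      (∀ r, ∃ c : ℂ, c ≠ 0 ∧ ∀ f : ModelRing n i R,
        coeff r (orbitHom u ev (Ψ (monomial a 1) f)) = c * coeff (r + a) (orbitHom u ev f)) →
      (∀ r, ∃ c : ℂ, c ≠ 0 ∧ ∀ f : ModelRing n i R,
        coeff r (orbitHom u ev (Ψ (monomial b 1) f)) = c * coeff (r + b) (orbitHom u ev f)) →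
      ∀ r, ∃ c : ℂ, c ≠ 0 ∧ ∀ f : ModelRing n i R,
        coeff r (orbitHom u ev (Ψ (monomial (a + b) 1) f)) =
          c * coeff (r + (a + b)) (orbitHom u ev f) := by
    intro a b ha hb r
    obtain ⟨c, hc, h1⟩ := ha r
    obtain ⟨d, hd, h2⟩ := hb (r + a)
    refine ⟨c * d, mul_ne_zero hc hd, fun f => ?_⟩
    have h3 : (monomial (a + b) 1 : MvPolynomial (Vertex n i ell) ℂ) =
        monomial a 1 * monomial b 1 := by rw [monomial_mul, one_mul]
    rw [h3, map_mul, Module.End.mul_apply, h1, h2, mul_assoc, add_assoc]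
  have hzero : ∀ r : Vertex n i ell →₀ ℕ, ∃ c : ℂ, c ≠ 0 ∧ ∀ f : ModelRing n i R,
      coeff r (orbitHom u ev (Ψ (monomial 0 1) f)) = c * coeff (r + 0) (orbitHom u ev f) := by
    refine fun r => ⟨1, one_ne_zero, fun f => ?_⟩
    rw [show (monomial 0 1 : MvPolynomial (Vertex n i ell) ℂ) = 1 from rfl, map_one,
      Module.End.one_apply, add_zero, one_mul]
  revert r
  induction a using Finsupp.induction_linear with
  | zero => exact hzero
  | add a b ha hb => exact hadd a b ha hb
  | single x k =>
    induction k with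
    | zero => simpa using hzero
    | succ k ih =>
      rw [Finsupp.single_add]
      refine hadd _ _ ih fun r => ⟨(r x + 1 : ℕ), Nat.cast_ne_zero.2 (Nat.succ_ne_zero _),
        fun f => ?_⟩
      rw [show (monomial (Finsupp.single x 1) 1 : MvPolynomial (Vertex n i ell) ℂ) = X x from rfl,
        hΨ, ← pderiv_orbitHom, coeff_pderiv]
      push_cast
      ring

open Classical in
/-- The point at which the product of minors restricts to a product of determinants of
antichain matrices. -/
noncomputable def antichainPoint (hin : i ≤ n) (u : Equiv.Perm (Fin (n + 1)))
    (A : R → Finset (Vertex n i ell)) (z : Fin (n + 1) × (R × Fin i)) : ℂ :=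
  if (u⁻¹ z.1).val < i then
    if z.1 = firstRows hin u z.2.2 ∧ ∀ y ∈ A z.2.1, y.row.val ≠ z.2.2.val then 1 else 0
  else if ∃ y ∈ A z.2.1, y.row.val = z.2.2.val ∧ y.col = u⁻¹ z.1 then 1 else 0

variable [Fintype R]

theorem orbitHom_extremalVec (hin : i ≤ n) (u : Equiv.Perm (Fin (n + 1)))
    (A : R → Finset (Vertex n i ell)) :
    orbitHom u (antichainPoint hin u A) (extremalVec R (firstRows hin u)) =
      ∏ r, (antichainMatrix (A r)).det := by
  classical
  rw [extremalVec, minorProd, map_prod]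
  refine Finset.prod_congr rfl fun r _ => ?_
  rw [AlgHom.map_det]
  congr 1
  ext1 s t
  rw [AlgHom.mapMatrix_apply, Matrix.map_apply, Matrix.of_apply, orbitHom_X, antichainMatrix,
    Matrix.of_apply]
  congr 1
  · have hs : (u⁻¹ (firstRows hin u s)).val < i := by simp [firstRows]
    simp only [antichainPoint, if_pos hs, (firstRows_injective hin u).eq_iff]
    split_ifs <;> simp
  · refine Finset.sum_congr rfl fun x _ => ?_
    have hinv : ∀ a, u⁻¹ (u a) = a := fun a => by simp
    have hx : ¬ x.col.val < i := not_lt.2 x.le_col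
    have hxs : u x.row = firstRows hin u s ↔ x.row.val = s.val := by
      rw [firstRows, u.injective.eq_iff, Fin.ext_iff, Fin.val_castLE]
    simp only [antichainPoint, hxs, hinv, if_neg hx, ite_and]
    split_ifs <;> simp

/-- For each `p`, distribute its antichains over the minors and evaluate along the orbit through the
matching point. The extremal vector pulls back to a product of determinants with smallest exponent
`p`, which gives the triangular functional. -/
theorem linearIndepOn_extremalVec (hin : i ≤ n) (u : Equiv.Perm (Fin (n + 1)))
    (Ψ : MvPolynomial (Vertex n i ell) ℂ →ₐ[ℂ] Module.End ℂ (ModelRing n i R))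
    (hΨ : ∀ x, Ψ (X x) = glRep n i R (Matrix.single (u x.col) (u x.row) 1)) :
    LinearIndepOn ℂ (fun q => Ψ (expMonomial q) (extremalVec R (firstRows hin u)))
      (chainExponents n i ell (Fintype.card R)) := by
  classical
  refine linearIndepOn_of_functionals _ _ fun p hp => ?_
  obtain ⟨A', hA', hpA'⟩ := exists_antichain_decomposition _ p hp
  let A : R → Finset (Vertex n i ell) := fun r => A' (Fintype.equivFin R r)
  have hmin : HasMinExponent (∏ r, (antichainMatrix (A r)).det) p := by
    have h := HasMinExponent.prod Finset.univ (fun r => (antichainMatrix (A r)).det)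
      (fun r => indicatorExp (A r)) fun r => hasMinExponent_det (hA' _)
    convert h using 1
    funext x
    rw [hpA', Finset.sum_apply, ← Equiv.sum_comp (Fintype.equivFin R)]
    rfl
  let η := orbitHom (ell := ell) u (antichainPoint hin u A)
  have hcoeff : ∀ q : Vertex n i ell → ℕ, ∃ c : ℂ, c ≠ 0 ∧
      coeff 0 (η (Ψ (expMonomial q) (extremalVec R (firstRows hin u)))) =
        c * coeff (Finsupp.equivFunOnFinite.symm q) (∏ r, (antichainMatrix (A r)).det) := by
    intro q
    obtain ⟨c, hc, h⟩ := coeff_orbitHom u (antichainPoint hin u A) Ψ hΨ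
      (Finsupp.equivFunOnFinite.symm q) 0
    refine ⟨c, hc, ?_⟩
    have hq : expMonomial q = monomial (Finsupp.equivFunOnFinite.symm q) 1 := by
      rw [monomial_eq, C_1, one_mul, Finsupp.prod_fintype _ _ fun _ => pow_zero _]
      rfl
    rw [hq, h, zero_add, orbitHom_extremalVec]
  refine ⟨(lcoeff ℂ 0).comp η.toLinearMap, fun q hq => ?_, ?_⟩
  · obtain ⟨c, -, h⟩ := hcoeff q
    change coeff 0 (η (Ψ (expMonomial q) (extremalVec R (firstRows hin u)))) ≠ 0 at hq
    rw [h] at hq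
    exact hmin.1 _ (right_ne_zero_of_mul hq)
  · obtain ⟨c, hc, h⟩ := hcoeff p
    change coeff 0 (η (Ψ (expMonomial p) (extremalVec R (firstRows hin u)))) ≠ 0
    rw [h]
    exact mul_ne_zero hc (hmin.2 _ rfl)

/-- Independence is inherited along an equivariant map to the model ring. -/
theorem linearIndepOn_of_equivariant {M : Type*} [AddCommGroup M] [Module ℂ M] (hin : i ≤ n)
    (u : Equiv.Perm (Fin (n + 1)))
    (Ψ : MvPolynomial (Vertex n i ell) ℂ →ₐ[ℂ] Module.End ℂ M) (θ : M →ₗ[ℂ] ModelRing n i R)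
    (hθ : ∀ x y, θ (Ψ (X x) y) = glRep n i R (Matrix.single (u x.col) (u x.row) 1) (θ y))
    (v : M) (c : ℂ) (hc : c ≠ 0) (hv : θ v = c • extremalVec R (firstRows hin u)) :
    LinearIndepOn ℂ (fun q => Ψ (expMonomial q) v)
      (chainExponents n i ell (Fintype.card R)) := by
  classical
  have hcomm : ∀ x y : Vertex n i ell,
      glRep n i R (Matrix.single (u x.col) (u x.row) 1) *
          glRep n i R (Matrix.single (u y.col) (u y.row) 1) =
        glRep n i R (Matrix.single (u y.col) (u y.row) 1) *
          glRep n i R (Matrix.single (u x.col) (u x.row) 1) := by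
    intro x y
    have hne : ∀ x y : Vertex n i ell, u x.row ≠ u y.col := by
      intro x y h
      have h1 := congrArg Fin.val (u.injective h)
      have h2 := x.row_lt
      have h3 := y.le_col
      omega
    rw [← sub_eq_zero, ← LieRing.of_associative_ring_bracket, ← LieHom.map_lie,
      LieRing.of_associative_ring_bracket, Matrix.single_mul_single_of_ne _ _ _ _ (hne x y),
      Matrix.single_mul_single_of_ne _ _ _ _ (hne y x), sub_zero, map_zero]
  obtain ⟨Φ, hΦ⟩ := exists_commAction _ hcomm
  have hΦθ : ∀ (f : MvPolynomial (Vertex n i ell) ℂ) (y : M), θ (Ψ f y) = Φ f (θ y) := by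
    intro f
    induction f using MvPolynomial.induction_on with
    | C a =>
      intro y
      rw [← algebraMap_eq, AlgHom.commutes, AlgHom.commutes, Module.algebraMap_end_apply,
        Module.algebraMap_end_apply, map_smul]
    | add p q hp hq => intro y; simp only [map_add, LinearMap.add_apply, hp, hq]
    | mul_X p x hp =>
      intro y
      rw [map_mul, map_mul, Module.End.mul_apply, Module.End.mul_apply, hp, hθ, hΦ]
  have hfin := linearIndepOn_extremalVec hin u Φ hΦ
  have h2 := hfin.units_smul (fun _ => Units.mk0 c hc)
  refine LinearIndependent.of_comp θ ?_
  convert! h2 using 1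
  funext q
  simp only [Function.comp_apply, hΦθ, hv, map_smul]
  rfl

end Independence

/-! ### Minimal coset representatives and the roots of the poset. -/

section MinimalRepresentatives

variable {n i : ℕ} {w u : Equiv.Perm (Fin (n + 1))}

theorem IsMinRep.weylAct_eq (hu : IsMinRep i w u) (m : ℕ) :
    weylAct w (m • fundWeight n i) = weylAct u (m • fundWeight n i) := by
  funext b
  have h := congrFun hu.1 (w⁻¹ b)
  simp only [weylAct, mul_inv_rev, inv_inv, Equiv.Perm.mul_apply] at h
  rw [show w (w⁻¹ b) = b by simp] at h
  simp only [weylAct, Pi.smul_apply, h]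

/-- The swap carries the inversions of `u * swap` injectively to inversions of `u`, and misses the
descent `(j, j')` itself. -/
theorem permLength_mul_swap_lt {j j' : Fin (n + 1)} (hj : j'.val = j.val + 1) (h : u j' < u j) :
    permLength (u * Equiv.swap j j') < permLength u := by
  classical
  set s := Equiv.swap j j' with hs
  have hinj : Function.Injective fun p : Fin (n + 1) × Fin (n + 1) => (s p.1, s p.2) := by
    rintro ⟨a, b⟩ ⟨c, d⟩ h
    simp only [Prod.mk.injEq, s.injective.eq_iff] at h
    exact Prod.ext h.1 h.2
  rw [permLength, permLength, ← Finset.card_image_of_injective _ hinj]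
  refine Finset.card_lt_card (Finset.ssubset_iff.2 ⟨(j, j'), ?_, ?_⟩)
  · simp only [Finset.mem_image, Finset.mem_filter, Prod.mk.injEq, not_exists, not_and]
    rintro ⟨a, b⟩ ⟨-, hab, -⟩ h1 h2
    obtain rfl : a = j' := by
      rw [← s.injective.eq_iff, h1, hs, Equiv.swap_apply_right]
    obtain rfl : b = j := by
      rw [← s.injective.eq_iff, h2, hs, Equiv.swap_apply_left]
    have : a.val < b.val := hab
    omega
  · intro p hp
    rcases Finset.mem_insert.1 hp with rfl | hp
    · rw [Finset.mem_filter]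
      exact ⟨Finset.mem_univ _, Fin.lt_def.2 (by simp only; omega), h⟩
    · obtain ⟨⟨a, b⟩, hab, rfl⟩ := Finset.mem_image.1 hp
      rw [Finset.mem_filter] at hab ⊢
      refine ⟨Finset.mem_univ _, ?_, hab.2.2⟩
      have hlt := hab.2.1
      have hu := hab.2.2
      simp only [Equiv.Perm.mul_apply] at hu hlt ⊢
      by_contra hcon
      -- An adjacent transposition reverses the order of no other pair.
      have key : a = j ∧ b = j' := by
        rw [hs, Equiv.swap_apply_def, Equiv.swap_apply_def] at hcon
        rw [Fin.lt_def] at hlt hcon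
        split_ifs at hcon with h1 h2 h3 h4 h5 h6 h7 <;> simp only [Fin.ext_iff] at * <;> omega
      obtain ⟨rfl, rfl⟩ := key
      rw [hs, Equiv.swap_apply_left, Equiv.swap_apply_right] at hu
      exact absurd h (not_lt.2 hu.le)

/-- A descent inside one of the two blocks could be removed by a swap in the stabilizer of the
fundamental weight, against minimality of the length. -/
theorem IsMinRep.lt_of_succ (hu : IsMinRep i w u) {j j' : Fin (n + 1)} (hj : j'.val = j.val + 1)
    (hside : j'.val < i ∨ i ≤ j.val) : u j < u j' := by
  by_contra h
  have hne : u j' ≠ u j := by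
    intro he
    have := congrArg Fin.val (u.injective he)
    omega
  refine absurd (hu.2 (Equiv.swap j j') ?_)
    (not_le.2 (permLength_mul_swap_lt hj (lt_of_le_of_ne (not_lt.1 h) hne)))
  funext a
  refine if_congr ?_ rfl rfl
  rw [Equiv.swap_inv, Equiv.swap_apply_def]
  split_ifs with h1 h2
  · rw [h1]
    omega
  · rw [h2]
    omega
  · rfl

theorem IsMinRep.lt_of_lt (hu : IsMinRep i w u) {a b : Fin (n + 1)} (hab : a < b)
    (hside : b.val < i ∨ i ≤ a.val) : u a < u b := by
  obtain ⟨b, hb⟩ := b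
  induction b with
  | zero => exact absurd (Fin.lt_def.1 hab) (Nat.not_lt_zero _)
  | succ b ih =>
    have hab' : a.val < b + 1 := Fin.lt_def.1 hab
    have hstep : u ⟨b, by omega⟩ < u ⟨b + 1, hb⟩ := hu.lt_of_succ rfl (by simp only at *; omega)
    rcases Nat.lt_succ_iff_lt_or_eq.1 hab' with h | h
    · exact (ih (by omega) (Fin.lt_def.2 h) (by simp only at *; omega)).trans hstep
    · rwa [show a = ⟨b, by omega⟩ from Fin.ext h]

/-- The default `i - 1` in `ellSeq` is below every column, so the bound comes from some `b` with `u
b < u x.row`; monotonicity on the second block extends this to all columns up to `b`. -/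
theorem IsMinRep.col_lt_row (hu : IsMinRep i w u) (hi : 1 ≤ i) (x : Vertex n i (ellSeq i u)) :
    u x.col < u x.row := by
  have h := x.col_le
  have h' := x.le_col
  rw [ellSeq, le_max_iff] at h
  rcases h with h | h
  · omega
  · obtain ⟨b, hb, hxb⟩ := (Finset.le_sup_iff (by simp only [Nat.bot_eq_zero]; omega)).1 h
    rw [Finset.mem_filter] at hb
    rcases eq_or_lt_of_le (show x.col ≤ b from hxb) with rfl | hlt
    · exact hb.2.2
    · exact (hu.lt_of_lt hlt (Or.inr h')).trans hb.2.2

/-- The vertex with a given row and column. -/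
def Vertex.ofLT {a b : Fin (n + 1)} (ha : a.val < i) (hb : i ≤ b.val) (h : u b < u a) :
    Vertex n i (ellSeq i u) :=
  ⟨a, b, ha, hb, le_max_of_le_right (Finset.le_sup (f := fun b : Fin (n + 1) => b.val)
    (Finset.mem_filter.2 ⟨Finset.mem_univ _, hb, h⟩))⟩

/-- The root attached to a vertex. -/
def IsMinRep.root (hu : IsMinRep i w u) (hi : 1 ≤ i) (x : Vertex n i (ellSeq i u)) : PosRoot n :=
  ⟨u x.col, u x.row, hu.col_lt_row hi x⟩

theorem IsMinRep.root_injective (hu : IsMinRep i w u) (hi : 1 ≤ i) :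
    Function.Injective (hu.root hi) := by
  intro x y h
  have h1 : u x.col = u y.col := congrArg PosRoot.fst h
  have h2 : u x.row = u y.row := congrArg PosRoot.snd h
  exact Vertex.ext_row_col (u.injective h2) (u.injective h1)

theorem IsMinRep.isRootOf_iff (hu : IsMinRep i w u) (hi : 1 ≤ i) (x : Vertex n i (ellSeq i u))
    (b : PosRoot n) : IsRootOf u x b ↔ hu.root hi x = b := by
  constructor
  · rintro ⟨h1, h2⟩
    exact PosRoot.toPair_injective n (Prod.ext h1.symm h2.symm)
  · rintro rfl
    exact ⟨rfl, rfl⟩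

theorem IsMinRep.mem_range_root (hu : IsMinRep i w u) (hi : 1 ≤ i) (b : PosRoot n)
    (h1 : i ≤ (u⁻¹ b.fst).val) (h2 : (u⁻¹ b.snd).val < i) : b ∈ Set.range (hu.root hi) := by
  refine ⟨Vertex.ofLT h2 h1 (by simpa using b.fst_lt_snd), ?_⟩
  exact PosRoot.toPair_injective n (by simp [IsMinRep.root, Vertex.ofLT])

/-- The principal order ideals of the poset are rectangles. -/
theorem IsMinRep.exists_vertex_le (hu : IsMinRep i w u) (hi : 1 ≤ i)
    (top : Vertex n i (ellSeq i u)) {a b : Fin (n + 1)} (ha : top.row ≤ a) (hai : a.val < i)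
    (hib : i ≤ b.val) (hb : b ≤ top.col) :
    ∃ x : Vertex n i (ellSeq i u), x.row = a ∧ x.col = b ∧ x ≤ top := by
  have h : u b < u a := by
    have h1 : u b ≤ u top.col := by
      rcases eq_or_lt_of_le hb with rfl | hlt
      · exact le_rfl
      · exact (hu.lt_of_lt hlt (Or.inr hib)).le
    have h2 : u top.row ≤ u a := by
      rcases eq_or_lt_of_le ha with rfl | hlt
      · exact le_rfl
      · exact (hu.lt_of_lt hlt (Or.inl hai)).le
    exact (h1.trans_lt (hu.col_lt_row hi top)).trans_le h2
  exact ⟨Vertex.ofLT hai hib h, rfl, rfl, (Vertex.le_iff _ _).2 ⟨ha, hb⟩⟩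

end MinimalRepresentatives

/-! ### Root vectors acting on extremal vectors. -/

section RootVectors

variable {n i : ℕ} {w u : Equiv.Perm (Fin (n + 1))}

theorem rootVectorBasis_val (b : PosRoot n) :
    (rootVectorBasis n b).1.1 = Matrix.single b.fst b.snd 1 := by
  classical
  ext a c
  have h : (rootVectorBasis n b) = (nilPlusEquiv n).symm (Pi.single b 1) := by
    rw [rootVectorBasis, Module.Basis.coe_ofEquivFun]
  rw [h]
  change (Matrix.of fun a b' => if h : a < b' then (Pi.single b (1 : ℂ) : PosRoot n → ℂ) ⟨a, b', h⟩
    else 0) a c = _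
  rw [Matrix.of_apply, Matrix.single_apply]
  by_cases hac : a < c
  · rw [dif_pos hac, Pi.single_apply]
    refine if_congr ⟨?_, ?_⟩ rfl rfl
    · rintro rfl
      exact ⟨rfl, rfl⟩
    · rintro ⟨h1, h2⟩
      exact PosRoot.toPair_injective n (Prod.ext h1.symm h2.symm)
  · rw [dif_neg hac, if_neg]
    rintro ⟨rfl, rfl⟩
    exact hac b.fst_lt_snd

/-- The representation of `𝔫⁺` on the model ring. -/
noncomputable def modelRep (n i : ℕ) (R : Type*) :
    nilPlus n →ₗ⁅ℂ⁆ Module.End ℂ (ModelRing n i R) :=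
  (glRep n i R).comp ((slLie n).incl.comp (nilPlus n).incl)

theorem modelRep_apply {R : Type*} (y : nilPlus n) :
    modelRep n i R y = glRep n i R y.1.1 := rfl

theorem modelRep_rootVector {R : Type*} (b : PosRoot n) :
    modelRep n i R (rootVectorBasis n b) = glRep n i R (Matrix.single b.fst b.snd 1) := by
  rw [modelRep_apply, rootVectorBasis_val]

/-- A root vector turns row `snd` into row `fst`. It can act nontrivially only if `snd` is a row of
the extremal vector and `fst` is not, and such positive roots all come from the poset. -/
theorem IsMinRep.modelRep_extremalVec_eq_zero (hu : IsMinRep i w u) (hi : 1 ≤ i) (hin : i ≤ n)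
    {R : Type*} [Fintype R] {b : PosRoot n} (hb : b ∉ Set.range (hu.root hi)) :
    modelRep n i R (rootVectorBasis n b) (extremalVec R (firstRows hin u)) = 0 := by
  rw [modelRep_rootVector]
  refine glRep_extremalVec_eq_zero _ _ fun c s hc => ?_
  rw [Matrix.single_apply] at hc
  obtain ⟨rfl, hs⟩ : b.fst = c ∧ b.snd = firstRows hin u s := by
    by_contra h
    exact hc (if_neg h)
  rw [← hs]
  refine ⟨?_, b.fst_lt_snd.ne⟩
  rw [mem_range_firstRows]
  by_contra h
  refine hb (hu.mem_range_root hi b (not_lt.1 h) ?_)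
  rw [← mem_range_firstRows hin, hs]
  exact ⟨s, rfl⟩

/-- The sums of root vectors over principal order ideals, with product coefficients, are matrices
of rank at most one. -/
theorem IsMinRep.exists_vecMulVec (hu : IsMinRep i w u) (hi : 1 ≤ i)
    (top : Vertex n i (ellSeq i u)) (s t : Fin (n + 1) → ℂ) (S : Finset (Vertex n i (ellSeq i u)))
    (hS : ∀ x, x ∈ S ↔ x ≤ top) : ∃ s' t' : Fin (n + 1) → ℂ, ∑ c, t' c * s' c = 0 ∧
      (∑ x ∈ S, (s x.row * t x.col) • rootVectorBasis n (hu.root hi x)).1.1 =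
        Matrix.vecMulVec s' t' := by
  classical
  -- The two vectors are the column and row weights restricted to the sides of the rectangle below
  -- `top` and moved by `u`. Their supports lie in different blocks, hence the orthogonality.
  refine ⟨fun c => if i ≤ (u⁻¹ c).val ∧ u⁻¹ c ≤ top.col then t (u⁻¹ c) else 0,
    fun c => if top.row ≤ u⁻¹ c ∧ (u⁻¹ c).val < i then s (u⁻¹ c) else 0, ?_, ?_⟩
  · refine Finset.sum_eq_zero fun c _ => ?_
    beta_reduce
    by_cases h : (u⁻¹ c).val < i
    · rw [if_neg (c := i ≤ (u⁻¹ c).val ∧ _) fun h' => absurd h (not_lt.2 h'.1), mul_zero]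
    · rw [if_neg fun h' => h h'.2, zero_mul]
  · have h1 : (∑ x ∈ S, (s x.row * t x.col) • rootVectorBasis n (hu.root hi x)).1.1 =
        ∑ x ∈ S, (s x.row * t x.col) • Matrix.single (u x.col) (u x.row) (1 : ℂ) := by
      change ((slLie n).toSubmodule.subtype.comp (nilPlus n).toSubmodule.subtype) _ = _
      rw [map_sum]
      refine Finset.sum_congr rfl fun x _ => ?_
      rw [map_smul]
      exact congrArg _ (rootVectorBasis_val _)
    rw [h1]
    ext a b
    rw [Matrix.sum_apply, Matrix.vecMulVec_apply]
    have hterm : ∀ x : Vertex n i (ellSeq i u),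
        ((s x.row * t x.col) • Matrix.single (u x.col) (u x.row) (1 : ℂ)) a b =
          if u x.col = a ∧ u x.row = b then s x.row * t x.col else 0 := by
      intro x
      rw [Matrix.smul_apply, Matrix.single_apply, smul_eq_mul, mul_ite, mul_one, mul_zero]
    simp only [hterm]
    by_cases hab : (i ≤ (u⁻¹ a).val ∧ u⁻¹ a ≤ top.col) ∧ (top.row ≤ u⁻¹ b ∧ (u⁻¹ b).val < i)
    · obtain ⟨x, hxr, hxc, hx⟩ := hu.exists_vertex_le hi top hab.2.1 hab.2.2 hab.1.1 hab.1.2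
      rw [if_pos hab.1, if_pos hab.2, Finset.sum_eq_single x, hxr, hxc, if_pos (by simp), mul_comm]
      · intro y _ hy
        rw [if_neg]
        rintro ⟨rfl, rfl⟩
        exact hy (Vertex.ext_row_col (by simp [hxr]) (by simp [hxc]))
      · exact fun h => absurd ((hS x).2 hx) h
    · rw [Finset.sum_eq_zero]
      · rw [not_and_or] at hab
        rcases hab with h | h
        · rw [if_neg h, zero_mul]
        · rw [if_neg h, mul_zero]
      · intro x hx
        rw [if_neg]
        rintro ⟨rfl, rfl⟩
        have hle := (Vertex.le_iff _ _).1 ((hS x).1 hx)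
        refine hab ⟨⟨?_, ?_⟩, ?_, ?_⟩
        · simpa using x.le_col
        · simpa using hle.2
        · simpa using hle.1
        · simpa using x.row_lt

variable {M : Type*} [AddCommGroup M] [Module ℂ M]

theorem rootVector_comm (ρ : nilPlus n →ₗ⁅ℂ⁆ Module.End ℂ M) (hu : IsMinRep i w u) (hi : 1 ≤ i)
    (x y : Vertex n i (ellSeq i u)) :
    ρ (rootVectorBasis n (hu.root hi x)) * ρ (rootVectorBasis n (hu.root hi y)) =
      ρ (rootVectorBasis n (hu.root hi y)) * ρ (rootVectorBasis n (hu.root hi x)) := by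
  have hne : ∀ x y : Vertex n i (ellSeq i u), (hu.root hi x).snd ≠ (hu.root hi y).fst := by
    intro x y h
    have h1 := congrArg Fin.val (u.injective h)
    have h2 := x.row_lt
    have h3 := y.le_col
    omega
  have h0 : ⁅rootVectorBasis n (hu.root hi x), rootVectorBasis n (hu.root hi y)⁆ = 0 := by
    apply Subtype.ext
    apply Subtype.ext
    change (rootVectorBasis n (hu.root hi x)).1.1 * (rootVectorBasis n (hu.root hi y)).1.1 -
      (rootVectorBasis n (hu.root hi y)).1.1 * (rootVectorBasis n (hu.root hi x)).1.1 = 0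
    rw [rootVectorBasis_val, rootVectorBasis_val,
      Matrix.single_mul_single_of_ne _ _ _ _ (hne x y),
      Matrix.single_mul_single_of_ne _ _ _ _ (hne y x), sub_zero]
  rw [← sub_eq_zero, ← LieRing.of_associative_ring_bracket, ← LieHom.map_lie, h0, map_zero]

/-- Independence pulls back along any equivariant `θ`, while the vanishing conditions are imposed on
`M` itself. Injectivity of `θ` is therefore unnecessary, which matters for tensor powers. -/
theorem IsMinRep.essential_and_basis [LinearOrder (PosRoot n)] (hu : IsMinRep i w u) (hi : 1 ≤ i)
    (hin : i ≤ n)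
    (hord : ∀ x y : Vertex n i (ellSeq i u), Vertex.totLT x y → hu.root hi x < hu.root hi y)
    (R : Type*) [Fintype R] (ρ : nilPlus n →ₗ⁅ℂ⁆ Module.End ℂ M) (v : M)
    (θ : M →ₗ[ℂ] ModelRing n i R) (hθ : ∀ y x, θ (ρ y x) = modelRep n i R y (θ x))
    (c : ℂ) (hc : c ≠ 0) (hv : θ v = c • extremalVec R (firstRows hin u))
    (hkill : ∀ b, b ∉ Set.range (hu.root hi) → ρ (rootVectorBasis n b) v = 0)
    (hpow : ∀ (y : nilPlus n) (s t : Fin (n + 1) → ℂ), ∑ c, t c * s c = 0 →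
      y.1.1 = Matrix.vecMulVec s t → ρ y ^ (Fintype.card R + 1) = 0) :
    LinearIndepOn ℂ (monomialVec ρ (rootVectorBasis n) v)
        ((fun q => Function.extend (hu.root hi) q 0) ''
          chainExponents n i (ellSeq i u) (Fintype.card R)) ∧
      Submodule.span ℂ (monomialVec ρ (rootVectorBasis n) v ''
        ((fun q => Function.extend (hu.root hi) q 0) ''
          chainExponents n i (ellSeq i u) (Fintype.card R))) = cyclicSpan ρ v ∧
      essentialSet ρ (rootVectorBasis n) v = (fun q => Function.extend (hu.root hi) q 0) ''
        chainExponents n i (ellSeq i u) (Fintype.card R) := by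
  obtain ⟨Ψ, hΨ⟩ := exists_commAction _ (rootVector_comm ρ hu hi)
  refine PBWDemazure.essential_and_basis ρ (rootVectorBasis n) v (Fintype.card R)
    (hu.root_injective hi) hord Ψ hΨ hkill (fun top s t S hS => ?_) ?_
  · obtain ⟨s', t', h0, h1⟩ := hu.exists_vecMulVec hi top s t S hS
    rw [hpow _ s' t' h0 h1, LinearMap.zero_apply]
  · refine linearIndepOn_of_equivariant hin u Ψ θ (fun x y => ?_) v c hc hv
    rw [hΨ, hθ, modelRep_rootVector]
    rfl

end RootVectors

/-! ### Tensor powers and their maps to the model. -/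

section TensorPower

variable {L : Type*} [LieRing L] [LieAlgebra ℂ L]
variable {M : Type*} [AddCommGroup M] [Module ℂ M]

theorem tensorPowerRep_apply (ρ : L →ₗ⁅ℂ⁆ Module.End ℂ M) (k : ℕ) (y : L) :
    tensorPowerRep ρ k y = ∑ j, slotMap k j (ρ y) := by
  change (∑ j : Fin k, (slotMap k j).comp (ρ : L →ₗ[ℂ] Module.End ℂ M)) y = _
  simp

theorem slotMap_tprod (k : ℕ) (j : Fin k) (f : Module.End ℂ M) (x : Fin k → M) :
    slotMap k j f (PiTensorProduct.tprod ℂ x) =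
      PiTensorProduct.tprod ℂ (Function.update x j (f (x j))) := by
  change PiTensorProduct.map _ _ = _
  rw [PiTensorProduct.map_tprod]
  congr 1
  funext l
  by_cases h : l = j
  · subst h
    simp
  · simp [Function.update_of_ne h]

theorem tensorPowerRep_vec_eq_zero (ρ : L →ₗ⁅ℂ⁆ Module.End ℂ M) (k : ℕ) {y : L} {v : M}
    (h : ρ y v = 0) : tensorPowerRep ρ k y (tensorPowerVec v k) = 0 := by
  rw [tensorPowerRep_apply, LinearMap.sum_apply]
  refine Finset.sum_eq_zero fun j _ => ?_
  rw [tensorPowerVec, slotMap_tprod, h]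
  exact (PiTensorProduct.tprod ℂ).map_update_zero _ j

theorem sum_pow_eq_zero {A ι : Type*} [Ring A] (f : ι → A) (s : Finset ι) (m : ℕ)
    (hcomm : ∀ j l, Commute (f j) (f l)) (hf : ∀ j, f j ^ (m + 1) = 0) :
    (∑ j ∈ s, f j) ^ (s.card * m + 1) = 0 := by
  classical
  induction s using Finset.induction_on with
  | empty => simp
  | insert a s ha ih =>
    rw [Finset.sum_insert ha, Finset.card_insert_of_notMem ha]
    exact (Commute.sum_right _ _ _ fun j _ => hcomm a j).add_pow_eq_zero_of_add_le_succ_of_pow_eq_zero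
      (hf a) ih (by rw [add_mul]; omega)

/-- The action is a sum of `k` commuting operators, each vanishing after `m + 1` applications; a
nonzero monomial in them has degree at most `k * m`. -/
theorem tensorPowerRep_pow_eq_zero (ρ : L →ₗ⁅ℂ⁆ Module.End ℂ M) (k m : ℕ) {y : L}
    (h : ρ y ^ (m + 1) = 0) : tensorPowerRep ρ k y ^ (k * m + 1) = 0 := by
  rw [tensorPowerRep_apply]
  have := sum_pow_eq_zero (fun j => slotMap k j (ρ y)) Finset.univ m (fun j l => ?_) fun j => ?_
  · rwa [Finset.card_univ, Fintype.card_fin] at this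
  · by_cases hjl : j = l
    · subst hjl
      exact Commute.refl _
    · exact slotMap_comm k hjl _ _
  · have hpow : ∀ d : ℕ, slotMap k j (ρ y) ^ (d + 1) = slotMap k j (ρ y ^ (d + 1)) := by
      intro d
      induction d with
      | zero => simp
      | succ d ih => rw [pow_succ, ih, ← slotMap_mul, ← pow_succ]
    rw [hpow, h, map_zero]

end TensorPower

section ModelTensor

open MvPolynomial

variable {n i m : ℕ}

/-- The inclusion of the model ring at the position `j`. -/
noncomputable def modelSlot (n i m k : ℕ) (j : Fin k) :
    ModelRing n i (Fin m) →ₐ[ℂ] ModelRing n i (Fin k × Fin m) :=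
  rename fun z => (z.1, ((j, z.2.1), z.2.2))

theorem modelSlot_glRep (k : ℕ) (j : Fin k) (A : Matrix (Fin (n + 1)) (Fin (n + 1)) ℂ)
    (f : ModelRing n i (Fin m)) :
    modelSlot n i m k j (glRep n i (Fin m) A f) =
      glRep n i (Fin k × Fin m) A (modelSlot n i m k j f) := by
  change modelSlot n i m k j (glDer A f) = glDer A (modelSlot n i m k j f)
  induction f using MvPolynomial.induction_on with
  | C a => simp [← algebraMap_eq]
  | add p q hp hq => simp only [map_add, hp, hq]
  | mul_X p z hp =>
    have hX : modelSlot n i m k j (glDer A (X z)) = glDer A (modelSlot n i m k j (X z)) := by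
      rw [glDer_X, modelSlot, rename_X, glDer_X, map_sum]
      exact Finset.sum_congr rfl fun c _ => by rw [map_smul, rename_X]
    rw [Derivation.leibniz, map_mul, Derivation.leibniz, map_add, smul_eq_mul, smul_eq_mul,
      smul_eq_mul, smul_eq_mul, map_mul, map_mul, hp, hX]

theorem prod_modelSlot_extremalVec (k : ℕ) (g : Fin i → Fin (n + 1)) :
    ∏ j, modelSlot n i m k j (extremalVec (Fin m) g) = extremalVec (Fin k × Fin m) g := by
  rw [extremalVec, extremalVec, minorProd, minorProd, Fintype.prod_prod_type]
  refine Finset.prod_congr rfl fun j _ => ?_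
  rw [map_prod]
  refine Finset.prod_congr rfl fun r _ => ?_
  rw [AlgHom.map_det]
  congr 1
  ext1 s t
  rw [AlgHom.mapMatrix_apply, Matrix.map_apply, Matrix.of_apply, Matrix.of_apply, modelSlot,
    rename_X]

variable {M : Type*} [AddCommGroup M] [Module ℂ M]

/-- The map from a tensor power to the model ring induced by a map from the module. -/
noncomputable def tensorModelMap (φ : M →ₗ[ℂ] ModelRing n i (Fin m)) (k : ℕ) :
    (⨂[ℂ] _ : Fin k, M) →ₗ[ℂ] ModelRing n i (Fin k × Fin m) :=
  PiTensorProduct.lift ((MultilinearMap.mkPiAlgebra ℂ (Fin k)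
    (ModelRing n i (Fin k × Fin m))).compLinearMap
      fun j => (modelSlot n i m k j).toLinearMap.comp φ)

theorem tensorModelMap_tprod (φ : M →ₗ[ℂ] ModelRing n i (Fin m)) (k : ℕ) (x : Fin k → M) :
    tensorModelMap φ k (PiTensorProduct.tprod ℂ x) = ∏ j, modelSlot n i m k j (φ (x j)) := by
  rw [tensorModelMap, PiTensorProduct.lift.tprod]
  rfl

/-- The Leibniz rule on a product of slots mirrors the sum over slots in the tensor power. -/
theorem tensorModelMap_apply (ρ : nilPlus n →ₗ⁅ℂ⁆ Module.End ℂ M)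
    (φ : M →ₗ[ℂ] ModelRing n i (Fin m)) (hφ : ∀ y x, φ (ρ y x) = modelRep n i (Fin m) y (φ x))
    (k : ℕ) (y : nilPlus n) (z : ⨂[ℂ] _ : Fin k, M) :
    tensorModelMap φ k (tensorPowerRep ρ k y z) =
      modelRep n i (Fin k × Fin m) y (tensorModelMap φ k z) := by
  classical
  suffices h : (tensorModelMap φ k).comp (tensorPowerRep ρ k y) =
      (modelRep n i (Fin k × Fin m) y : ModelRing n i (Fin k × Fin m) →ₗ[ℂ] _).comp
        (tensorModelMap φ k) from LinearMap.congr_fun h z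
  refine PiTensorProduct.ext (MultilinearMap.ext fun x => ?_)
  change tensorModelMap φ k (tensorPowerRep ρ k y (PiTensorProduct.tprod ℂ x)) =
    glDer y.1.1 (tensorModelMap φ k (PiTensorProduct.tprod ℂ x))
  rw [tensorPowerRep_apply, LinearMap.sum_apply, map_sum, tensorModelMap_tprod, derivation_prod]
  refine Finset.sum_congr rfl fun j _ => ?_
  rw [slotMap_tprod, tensorModelMap_tprod]
  refine Finset.prod_congr rfl fun l _ => ?_
  by_cases h : l = j
  · subst h
    rw [Function.update_self, Function.update_self, hφ, modelRep_apply, modelSlot_glRep]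
    rfl
  · rw [Function.update_of_ne h, Function.update_of_ne h]

theorem tensorModelMap_vec (φ : M →ₗ[ℂ] ModelRing n i (Fin m)) (k : ℕ) (v : M) (c : ℂ)
    (g : Fin i → Fin (n + 1)) (hv : φ v = c • extremalVec (Fin m) g) :
    tensorModelMap φ k (tensorPowerVec v k) = c ^ k • extremalVec (Fin k × Fin m) g := by
  rw [tensorPowerVec, tensorModelMap_tprod]
  simp only [hv, map_smul]
  rw [Finset.prod_smul, prod_modelSlot_extremalVec, Finset.prod_const, Finset.card_univ,
    Fintype.card_fin]

end ModelTensor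

/-! ### The Demazure module as a cyclic module over the nilradical. -/

section Demazure

theorem cyclicSpan_le_stableSpan {L M : Type*} [LieRing L] [LieAlgebra ℂ L] [AddCommGroup M]
    [Module ℂ M] (ρ : L →ₗ⁅ℂ⁆ Module.End ℂ M) (N : Set L) (v : M)
    (h : ∀ y, ∃ d, y - d ∈ N ∧ ∃ c : ℂ, ρ d v = c • v) : cyclicSpan ρ v ≤ stableSpan ρ N v := by
  have hgen : ∀ y, ρ y v ∈ stableSpan ρ N v := by
    intro y
    obtain ⟨d, hd, c, hc⟩ := h y
    have h : ρ y v = ρ (y - d) v + c • v := by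
      rw [map_sub, LinearMap.sub_apply, hc, sub_add_cancel]
    rw [h]
    exact Submodule.add_mem _ (apply_mem_stableSpan _ _ _ hd (self_mem_stableSpan _ _ _))
      (Submodule.smul_mem _ _ (self_mem_stableSpan _ _ _))
  exact cyclicSpan_le ρ v _ (self_mem_stableSpan _ _ _)
    fun y w hw => stableSpan_stable ρ N v hgen y w hw

theorem sub_diagPart_mem {n : ℕ} (y : borel n) : y.1 - diagPart y.1 ∈ nilPlus n := by
  intro a b hab
  change y.1.1 a b - Matrix.diagonal y.1.1.diag a b = 0
  rcases hab.lt_or_eq with h | rfl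
  · rw [Matrix.diagonal_apply_ne _ h.ne', y.2 a b h, sub_zero]
  · rw [Matrix.diagonal_apply_eq, Matrix.diag_apply, sub_self]

variable {n : ℕ} {V : Type*} [AddCommGroup V] [Module ℂ V]
  [LieRingModule (slLie n) V] [LieModule ℂ (slLie n) V]

/-- Diagonal matrices only rescale the weight vector, so the strictly upper triangular ones already
generate. -/
theorem demazureRep_cyclic {lam : Weight n} {v : V} (hv : IsWeightVector lam v) :
    cyclicSpan (demazureRep n v) (demazureGen n v) = ⊤ := by
  let N : Set (borel n) := {y | y.1 ∈ nilPlus n}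
  let ρ := LieModule.toEnd ℂ (borel n) V
  let S : Submodule ℂ V := (cyclicSpan (demazureRep n v) (demazureGen n v)).map
    (demazureModule n v).toSubmodule.subtype
  have hS : stableSpan ρ N v ≤ S := by
    refine stableSpan_le ⟨demazureGen n v, self_mem_cyclicSpan _ _, rfl⟩ ?_
    rintro f hf _ ⟨x, hx, rfl⟩
    exact ⟨demazureRep n v ⟨f.1, hf⟩ x, apply_mem_cyclicSpan _ _ _ _ hx, rfl⟩
  have hle : cyclicSpan ρ v ≤ S := by
    refine (cyclicSpan_le_stableSpan ρ N v fun y => ?_).trans hS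
    have hd : diagPart y.1 ∈ borel n := fun a b h => Matrix.diagonal_apply_ne _ h.ne'
    exact ⟨⟨diagPart y.1, hd⟩, sub_diagPart_mem y, _, hv.2 _ (Matrix.isDiag_diagonal _)⟩
  refine Submodule.eq_top_iff'.2 fun x => ?_
  obtain ⟨x', hx', h⟩ := hle x.2
  rwa [← Subtype.ext h]

/-- The restriction of an embedding of `V` to the Demazure module. -/
theorem exists_demazure_embedding {i m : ℕ} {w u : Equiv.Perm (Fin (n + 1))} (hin : i ≤ n)
    (hV : IsSimpleOfHighestWeight V (m • fundWeight n i)) (hu : IsMinRep i w u) (v : V)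
    (hv : IsWeightVector (weylAct w (m • fundWeight n i)) v) :
    ∃ φ : demazureModule n v →ₗ[ℂ] ModelRing n i (Fin m), Function.Injective φ ∧
      (∀ y x, φ (demazureRep n v y x) = modelRep n i (Fin m) y (φ x)) ∧
      (∀ x, φ x ∈ minorSpan n i (Fin m)) ∧
      ∃ c : ℂ, c ≠ 0 ∧ φ (demazureGen n v) = c • extremalVec (Fin m) (firstRows hin u) := by
  obtain ⟨φ, hinj, hφ, hS⟩ := exists_embedding hin hV
  rw [hu.weylAct_eq] at hv
  refine ⟨φ.comp (demazureModule n v).toSubmodule.subtype,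
    hinj.comp Subtype.val_injective, fun y x => ?_, fun x => hS _,
    exists_smul_extremalVec hin φ hinj hφ hS u v hv⟩
  exact hφ y.1 x

end Demazure

section Embedded

variable {n i m : ℕ} {M : Type*} [AddCommGroup M] [Module ℂ M]

theorem pow_eq_zero_of_embedding (ρ : nilPlus n →ₗ⁅ℂ⁆ Module.End ℂ M)
    (φ : M →ₗ[ℂ] ModelRing n i (Fin m)) (hinj : Function.Injective φ)
    (hφ : ∀ y x, φ (ρ y x) = modelRep n i (Fin m) y (φ x))
    (hS : ∀ x, φ x ∈ minorSpan n i (Fin m)) (y : nilPlus n) (N : ℕ)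
    (h : ∀ x ∈ minorSpan n i (Fin m), (glRep n i (Fin m) y.1.1 ^ N) x = 0) : ρ y ^ N = 0 := by
  have hpow : ∀ (d : ℕ) (x : M), φ ((ρ y ^ d) x) = (glRep n i (Fin m) y.1.1 ^ d) (φ x) := by
    intro d
    induction d with
    | zero => intro x; rfl
    | succ d ih =>
      intro x
      rw [pow_succ', pow_succ', Module.End.mul_apply, Module.End.mul_apply, hφ, ih]
      rfl
  refine LinearMap.ext fun x => hinj ?_
  rw [hpow, h _ (hS x), LinearMap.zero_apply, map_zero]

variable {w u : Equiv.Perm (Fin (n + 1))}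

/-- The structure of a cyclic module that embeds into the model ring, and of its tensor powers. -/
theorem IsMinRep.essential_and_basis_of_embedding [LinearOrder (PosRoot n)] (hu : IsMinRep i w u)
    (hi : 1 ≤ i) (hin : i ≤ n)
    (hord : ∀ x y : Vertex n i (ellSeq i u), Vertex.totLT x y → hu.root hi x < hu.root hi y)
    (ρ : nilPlus n →ₗ⁅ℂ⁆ Module.End ℂ M) (v : M)
    (φ : M →ₗ[ℂ] ModelRing n i (Fin m)) (hinj : Function.Injective φ)
    (hφ : ∀ y x, φ (ρ y x) = modelRep n i (Fin m) y (φ x))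
    (hS : ∀ x, φ x ∈ minorSpan n i (Fin m)) (c : ℂ) (hc : c ≠ 0)
    (hv : φ v = c • extremalVec (Fin m) (firstRows hin u)) :
    essentialSet ρ (rootVectorBasis n) v =
        (fun q => Function.extend (hu.root hi) q 0) '' chainExponents n i (ellSeq i u) m ∧
      ∀ k : ℕ, LinearIndepOn ℂ
          (monomialVec (tensorPowerRep ρ k) (rootVectorBasis n) (tensorPowerVec v k))
          ((fun q => Function.extend (hu.root hi) q 0) ''
            chainExponents n i (ellSeq i u) (k * m)) ∧
        Submodule.span ℂ
          (monomialVec (tensorPowerRep ρ k) (rootVectorBasis n) (tensorPowerVec v k) ''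
            ((fun q => Function.extend (hu.root hi) q 0) ''
              chainExponents n i (ellSeq i u) (k * m))) =
          cyclicSpan (tensorPowerRep ρ k) (tensorPowerVec v k) := by
  have hpow : ∀ (y : nilPlus n) (s t : Fin (n + 1) → ℂ), ∑ c, t c * s c = 0 →
      y.1.1 = Matrix.vecMulVec s t → ρ y ^ (m + 1) = 0 := by
    intro y s t hst hy
    refine pow_eq_zero_of_embedding ρ φ hinj hφ hS y _ fun x hx => ?_
    rw [hy]
    simpa using glRep_vecMulVec_pow s t hst x hx
  have hkill : ∀ b, b ∉ Set.range (hu.root hi) → ρ (rootVectorBasis n b) v = 0 := by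
    intro b hb
    apply hinj
    rw [hφ, hv, map_smul, hu.modelRep_extremalVec_eq_zero hi hin hb, smul_zero, map_zero]
  constructor
  · have h := hu.essential_and_basis hi hin hord (Fin m) ρ v φ hφ c hc hv hkill
      (by rwa [Fintype.card_fin])
    rw [Fintype.card_fin] at h
    exact h.2.2
  · intro k
    have hcard : Fintype.card (Fin k × Fin m) = k * m := by simp
    -- Each of the `k` tensor factors contributes its own `m` minors.
    have h := hu.essential_and_basis hi hin hord (Fin k × Fin m) (tensorPowerRep ρ k)
      (tensorPowerVec v k) (tensorModelMap φ k) (tensorModelMap_apply ρ φ hφ k) (c ^ k)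
      (pow_ne_zero k hc) (tensorModelMap_vec φ k v c _ hv)
      (fun b hb => tensorPowerRep_vec_eq_zero ρ k (hkill b hb))
      (fun y s t hst hy => by
        rw [hcard]
        exact tensorPowerRep_pow_eq_zero ρ k m (hpow y s t hst hy))
    rw [hcard] at h
    exact ⟨h.1, h.2.1⟩

end Embedded

/-! ### Lattice points, normality and dimensions. -/

section DemazurePolytope

variable {n i : ℕ} {w u : Equiv.Perm (Fin (n + 1))}

theorem finite_chainExponents (ell : Fin (n + 1) → ℕ) (N : ℕ) :
    (chainExponents n i ell N).Finite := by
  classical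
  refine (Set.finite_Icc (0 : Vertex n i ell → ℕ) fun _ => N).subset fun q hq =>
    ⟨fun _ => Nat.zero_le _, fun x => ?_⟩
  simpa using hq {x} (by simp)

/-- The exponents on the positive roots that correspond to the lattice points of a dilation of the
polytope. -/
def IsMinRep.rootExponents (hu : IsMinRep i w u) (hi : 1 ≤ i) (N : ℕ) : Set (PosRoot n → ℕ) :=
  (fun q => Function.extend (hu.root hi) q 0) '' chainExponents n i (ellSeq i u) N

theorem IsMinRep.transport_eq (hu : IsMinRep i w u) (hi : 1 ≤ i) (s : Vertex n i (ellSeq i u) → ℝ) :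
    transport u s = Function.extend (hu.root hi) s 0 := by
  classical
  funext b
  have h : transport u s b = ∑ x, if hu.root hi x = b then s x else 0 :=
    Finset.sum_congr rfl fun x _ => if_congr (hu.isRootOf_iff hi x b) rfl rfl
  rw [h]
  by_cases hb : ∃ x, hu.root hi x = b
  · obtain ⟨x, rfl⟩ := hb
    rw [(hu.root_injective hi).extend_apply]
    simp [(hu.root_injective hi).eq_iff]
  · rw [Function.extend_apply' _ _ _ hb]
    exact Finset.sum_eq_zero fun x _ => if_neg fun hx => hb ⟨x, hx⟩

theorem IsMinRep.latticePoints_smul (hu : IsMinRep i w u) (hi : 1 ≤ i) (N : ℕ) :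
    latticePoints ((N : ℝ) • demazurePolytope i u) =
      (fun (p : PosRoot n → ℕ) (a : PosRoot n) => (p a : ℤ)) '' hu.rootExponents hi N := by
  have hβ := hu.root_injective hi
  ext p
  constructor
  · rintro ⟨_, ⟨s, hs, rfl⟩, hp⟩
    have hp' : ∀ a, (p a : ℝ) = N * Function.extend (hu.root hi) s 0 a := by
      intro a
      rw [← hu.transport_eq hi]
      exact (congrFun hp a).symm
    have hp0 : ∀ x, (p (hu.root hi x) : ℝ) = N * s x := fun x => by rw [hp', hβ.extend_apply]
    have hnn : ∀ x, 0 ≤ p (hu.root hi x) := by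
      intro x
      have : (0 : ℝ) ≤ p (hu.root hi x) := by
        rw [hp0]
        exact mul_nonneg (Nat.cast_nonneg _) (hs.1 x)
      exact_mod_cast this
    have hcast : ∀ x, (((p (hu.root hi x)).toNat : ℕ) : ℝ) = N * s x := by
      intro x
      rw [← hp0, ← Int.cast_natCast, Int.toNat_of_nonneg (hnn x)]
    refine ⟨_, ⟨fun x => (p (hu.root hi x)).toNat, fun c hc => ?_, rfl⟩, ?_⟩
    · have h1 : ((∑ x ∈ c, (p (hu.root hi x)).toNat : ℕ) : ℝ) ≤ N := by
        rw [Nat.cast_sum]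
        simp only [hcast]
        rw [← Finset.mul_sum]
        exact mul_le_of_le_one_right (Nat.cast_nonneg _) (hs.2 c hc)
      exact_mod_cast h1
    · funext a
      by_cases ha : ∃ x, hu.root hi x = a
      · obtain ⟨x, rfl⟩ := ha
        simp only [hβ.extend_apply]
        exact Int.toNat_of_nonneg (hnn x)
      · have h0 := hp' a
        rw [Function.extend_apply' _ _ _ ha, Pi.zero_apply, mul_zero] at h0
        simp only [Function.extend_apply' _ _ _ ha, Pi.zero_apply, Nat.cast_zero]
        exact_mod_cast h0.symm
  · rintro ⟨_, ⟨q, hq, rfl⟩, rfl⟩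
    -- For `N = 0` the quotient is zero by convention; the chain condition on singletons makes `q`
    -- zero as well.
    have hN : ∀ x, (N : ℝ) * (q x / N) = q x := by
      intro x
      rcases Nat.eq_zero_or_pos N with rfl | hN
      · have h0 : q x ≤ 0 := by simpa using hq {x} (by simp)
        simp [Nat.le_zero.1 h0]
      · have : (N : ℝ) ≠ 0 := Nat.cast_ne_zero.2 hN.ne'
        field_simp
    refine ⟨_, ⟨fun x => (q x : ℝ) / N, ⟨fun x => by positivity, fun c hc => ?_⟩, rfl⟩, ?_⟩
    · rw [← Finset.sum_div]
      refine div_le_one_of_le₀ ?_ (Nat.cast_nonneg _)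
      exact_mod_cast hq c hc
    · funext a
      change (N : ℝ) * transport u _ a = _
      rw [hu.transport_eq hi]
      by_cases ha : ∃ x, hu.root hi x = a
      · obtain ⟨x, rfl⟩ := ha
        simp only [hβ.extend_apply, Int.cast_natCast]
        exact hN x
      · simp only [Function.extend_apply' _ _ _ ha, Pi.zero_apply, mul_zero, Nat.cast_zero,
          Int.cast_zero]

theorem IsMinRep.latticePoints_smul_smul (hu : IsMinRep i w u) (hi : 1 ≤ i) (k m : ℕ) :
    latticePoints ((k : ℝ) • (m : ℝ) • demazurePolytope i u) =
      (fun (p : PosRoot n → ℕ) (a : PosRoot n) => (p a : ℤ)) '' hu.rootExponents hi (k * m) := by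
  rw [smul_smul, ← Nat.cast_mul, hu.latticePoints_smul hi]

theorem natCast_pi_injective {ι : Type*} :
    Function.Injective fun (p : ι → ℕ) (a : ι) => (p a : ℤ) :=
  fun _ _ h => funext fun a => Nat.cast_injective (congrFun h a)

theorem IsMinRep.isLatticePolytope (hu : IsMinRep i w u) (hi : 1 ≤ i) (m : ℕ) :
    IsLatticePolytope ((m : ℝ) • demazurePolytope i u) := by
  classical
  let Λ : (Vertex n i (ellSeq i u) → ℝ) →ₗ[ℝ] (PosRoot n → ℝ) :=
    (m : ℝ) • Function.ExtendByZero.linearMap ℝ (hu.root hi)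
  have h1 : (m : ℝ) • demazurePolytope i u = Λ '' chainPolytope n i (ellSeq i u) := by
    rw [demazurePolytope, ← Set.image_smul, Set.image_image]
    refine Set.image_congr fun s _ => ?_
    rw [hu.transport_eq hi]
    rfl
  refine ⟨(fun (A : Finset (Vertex n i (ellSeq i u))) (a : PosRoot n) =>
    (m : ℤ) * Function.extend (hu.root hi) (fun x => if x ∈ A then 1 else 0) 0 a) ''
      {A | IsAntichain (· ≤ ·) (A : Set (Vertex n i (ellSeq i u)))},
    (Set.toFinite _).image _, ?_⟩
  rw [h1, chainPolytope_eq_convexHull, LinearMap.image_convexHull, Set.image_image]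
  congr 1
  have h2 : antichainIndicators (Vertex n i (ellSeq i u)) =
      (fun (A : Finset (Vertex n i (ellSeq i u))) x => if x ∈ A then (1 : ℝ) else 0) ''
        {A | IsAntichain (· ≤ ·) (A : Set (Vertex n i (ellSeq i u)))} := by
    ext s
    constructor
    · rintro ⟨A, hA, rfl⟩
      refine ⟨A, hA, ?_⟩
      funext x
      exact if_congr Iff.rfl rfl rfl
    · rintro ⟨A, hA, rfl⟩
      refine ⟨A, hA, ?_⟩
      funext x
      exact if_congr Iff.rfl rfl rfl
  rw [h2, Set.image_image]
  refine Set.image_congr fun A _ => ?_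
  funext a
  change (m : ℝ) * Function.extend (hu.root hi) (fun x => if x ∈ A then (1 : ℝ) else 0) 0 a = _
  by_cases ha : ∃ x, hu.root hi x = a
  · obtain ⟨x, rfl⟩ := ha
    simp only [(hu.root_injective hi).extend_apply]
    push_cast
    rfl
  · simp only [Function.extend_apply' _ _ _ ha, Pi.zero_apply, mul_zero, Int.cast_zero]

/-- Decompose into `k * m` antichains and group them into `k` blocks of `m`; a chain meets each
antichain of a block at most once. -/
theorem chainExponents_decomp {ell : Fin (n + 1) → ℕ} (k m : ℕ) {q : Vertex n i ell → ℕ}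
    (hq : q ∈ chainExponents n i ell (k * m)) : ∃ p : Fin k → Vertex n i ell → ℕ,
      (∀ j, p j ∈ chainExponents n i ell m) ∧ ∀ x, q x = ∑ j, p j x := by
  classical
  obtain ⟨A, hA, hqA⟩ := exists_antichain_decomposition _ q hq
  refine ⟨fun j x => ∑ r : Fin m, if x ∈ A (finProdFinEquiv (j, r)) then 1 else 0,
    fun j c hc => ?_, fun x => ?_⟩
  · rw [Finset.sum_comm]
    calc _ ≤ ∑ r : Fin m, 1 := Finset.sum_le_sum fun r _ => by
            have h := sum_indicator_le_one hc (hA (finProdFinEquiv (j, r)))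
            exact_mod_cast h
      _ = m := by simp
  · rw [hqA, ← Equiv.sum_comp finProdFinEquiv, Fintype.sum_prod_type]

theorem IsMinRep.isNormalPolytope (hu : IsMinRep i w u) (hi : 1 ≤ i) (m : ℕ) :
    IsNormalPolytope ((m : ℝ) • demazurePolytope i u) where
  isLatticePolytope := hu.isLatticePolytope hi m
  decomp k _ p hp := by
    rw [hu.latticePoints_smul_smul hi] at hp
    obtain ⟨_, ⟨q, hq, rfl⟩, rfl⟩ := hp
    obtain ⟨r, hr, hqr⟩ := chainExponents_decomp k m hq
    refine ⟨fun j a => (Function.extend (hu.root hi) (r j) 0 a : ℕ), fun j => ?_, ?_⟩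
    · rw [hu.latticePoints_smul hi]
      exact ⟨_, ⟨r j, hr j, rfl⟩, rfl⟩
    · funext a
      rw [Finset.sum_apply]
      by_cases ha : ∃ x, hu.root hi x = a
      · obtain ⟨x, rfl⟩ := ha
        simp only [(hu.root_injective hi).extend_apply, hqr]
        push_cast
        rfl
      · simp [Function.extend_apply' _ _ _ ha]

theorem finrank_span_image_eq_ncard {ι M : Type*} [AddCommGroup M] [Module ℂ M] {f : ι → M}
    {E : Set ι} (hE : E.Finite) (h : LinearIndepOn ℂ f E) :
    Module.finrank ℂ (Submodule.span ℂ (f '' E)) = E.ncard := by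
  have := hE.fintype
  rw [Set.image_eq_range, finrank_span_eq_card h, ← Nat.card_eq_fintype_card]
  rfl

end DemazurePolytope

end PBWDemazure

theorem mainTheorem5 (n i m : ℕ) (hi : 1 ≤ i) (hin : i ≤ n)
    (V : Type*) [AddCommGroup V] [Module ℂ V]
    [LieRingModule (slLie n) V] [LieModule ℂ (slLie n) V]
    (hV : IsSimpleOfHighestWeight V (m • fundWeight n i))
    (w u : Equiv.Perm (Fin (n + 1))) (hu : IsMinRep i w u)
    (v : V) (hv : IsWeightVector (weylAct w (m • fundWeight n i)) v)
    [LinearOrder (PosRoot n)]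
    (hord : ∀ (x y : Vertex n i (ellSeq i u)) (β γ : PosRoot n),
      IsRootOf u x β → IsRootOf u y γ → Vertex.totLT x y → β < γ) :
    IsFavourableVia (demazureRep n v) (rootVectorBasis n) (demazureGen n v)
        ((m : ℝ) • demazurePolytope i u) ∧
      ∀ k : ℕ, 1 ≤ k →
        ParametrizesBasis (tensorPowerRep (demazureRep n v) k) (rootVectorBasis n)
          (tensorPowerVec (demazureGen n v) k) ((k : ℝ) • (m : ℝ) • demazurePolytope i u) := by
  have hroot : ∀ x y : Vertex n i (ellSeq i u), Vertex.totLT x y → hu.root hi x < hu.root hi y :=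
    fun x y h => hord x y _ _ ((hu.isRootOf_iff hi x _).2 rfl) ((hu.isRootOf_iff hi y _).2 rfl) h
  obtain ⟨φ, hinj, hφ, hS, c, hc, hv'⟩ := exists_demazure_embedding hin hV hu v hv
  obtain ⟨hess, hbasis⟩ := hu.essential_and_basis_of_embedding hi hin hroot (demazureRep n v)
    (demazureGen n v) φ hinj hφ hS c hc hv'
  refine ⟨⟨?_, fun y => ?_, demazureRep_cyclic hv, hu.isNormalPolytope hi m, ?_, fun k _ => ?_⟩,
    fun k _ => ?_⟩
  · have := hV.finite
    exact inferInstanceAs (Module.Finite ℂ (demazureModule n v).toSubmodule)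
  · obtain ⟨N, hN⟩ := glRep_pow_eq_zero (i := i) (R := Fin m) y.1.1 y.2
    exact ⟨N, pow_eq_zero_of_embedding _ φ hinj hφ hS y N hN⟩
  · rw [hu.latticePoints_smul hi, hess]
    rfl
  · rw [hu.latticePoints_smul_smul hi, Set.ncard_image_of_injective _ natCast_pi_injective,
      ← (hbasis k).2]
    exact finrank_span_image_eq_ncard ((finite_chainExponents _ _).image _) (hbasis k).1
  · rw [ParametrizesBasis, hu.latticePoints_smul_smul hi]
    have hE : {p : PosRoot n → ℕ | (fun a => (p a : ℤ)) ∈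
        (fun (p : PosRoot n → ℕ) (a : PosRoot n) => (p a : ℤ)) '' hu.rootExponents hi (k * m)} =
        hu.rootExponents hi (k * m) :=
      Set.preimage_image_eq _ natCast_pi_injective
    rw [hE]
    exact hbasis k
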